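/- Let $K$ be a strictly henselian discretely valued field with normalized valuation $v$ (value group $\mathbb{Z}$), valuation ring $\mathcal{O}_K$ (a henselian discrete valuation ring with separably closed residue field), uniformizer $\pi$, and let $S=\operatorname{Spec}\mathcal{O}_K$. Let $$\phi(z)=\frac{1}{\pi^{n}}f(z),\qquad f(z)=uz^3+a_1z^2+a_2z+a_3\in\mathcal{O}_K[z],$$ where $n\ge 1$, $v(u)=0$ and $v(a_i)>0$ for $i=1,2,3$, and assume that the fixed-point polynomial $\phi(z)-z$ is irreducible over $K$. Write $v(a_3)=3l+r$ with integers $l\ge 0$ and $0\le r\le 2$, and assume that $\phi$ is normalized in the sense that either 1. $l=0$ and $n\ge 2r/3$, or 2. $n=1<2l+2r/3$. Let $b:X_1\to\mathbb{P}^1_S$ be the blow-up of $\mathbb{P}^1_S$ at the closed point $\tilde z=0$ of its special fibre (with its reduced structure), which exists, and let $\mathcal{X}\subset X_1$ be the smooth locus of $X_1$ over $S$. Then the morphism $\phi:\mathbb{P}^1_K\to\mathbb{P}^1_K$ extends to an $S$-morphism $\Phi:\mathcal{X}\to\mathcal{X}$, and $(\mathcal{X},\Phi)$ is a weak Néron model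 of $(\mathbb{P}^1_K,\phi)$, that is: $\mathcal{X}$ is smooth, separated and of finite type over $S$; the generic fibre of $\mathcal{X}$ is $\mathbb{P}^1_K$ (the identification being the one induced by $b$); every point $P\in\mathbb{P}^1(K)$ extends to a section $S\to\mathcal{X}$; and $\Phi$ restricts to $\phi$ on the generic fibre. -/

import Mathlib

open CategoryTheory AlgebraicGeometry Limits Polynomial

open scoped nonZeroDivisors

universe u

namespace WeakNeron

attribute [local instance] MvPolynomial.gradedAlgebra

noncomputable section

/-! ### The projective line -/

section ProjectiveLine

variable (R : Type u) [CommRing R]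

/-- The polynomial ring `R[x, y]`, graded by total degree; `x = X 0` and `y = X 1`. -/
abbrev grading : ℕ → Submodule R (MvPolynomial (Fin 2) R) :=
  MvPolynomial.homogeneousSubmodule (Fin 2) R

/-- The projective line `ℙ¹` over `R`, as `Proj R[x, y]`. -/
def P1 : Scheme.{u} := Proj (grading R)

/-- The structure morphism of `ℙ¹` over `R`. -/
def P1.toSpec : P1 R ⟶ Spec (.of R) :=
  Proj.toSpecZero (grading R) ≫ Spec.map (CommRingCat.ofHom (algebraMap R (grading R 0)))

variable {R}

lemma X_mem_irrelevant (i : Fin 2) :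
    (MvPolynomial.X i : MvPolynomial (Fin 2) R) ∈
      (HomogeneousIdeal.irrelevant (grading R)).toIdeal :=
  HomogeneousIdeal.mem_irrelevant_of_mem (grading R) Nat.one_pos
    (MvPolynomial.isHomogeneous_X R i)

lemma irrelevant_le_span :
    (HomogeneousIdeal.irrelevant (grading R)).toIdeal ≤
      Ideal.span (Set.range (MvPolynomial.X : Fin 2 → MvPolynomial (Fin 2) R)) := by
  rw [HomogeneousIdeal.toIdeal_irrelevant_le]
  intro i hi p hp
  replace hp : p.IsHomogeneous i := hp
  rw [Submodule.mem_toAddSubmonoid, ← Set.image_univ, MvPolynomial.mem_ideal_span_X_image]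
  intro m hm
  by_contra! h
  have h0 : m = 0 := by
    ext j
    simpa using h j
  have := hp (MvPolynomial.mem_support_iff.mp hm)
  simp [h0] at this
  omega

variable (R)

/-- The ring homomorphism `R[x, y] → Γ(Spec A, ⊤) = A` with `x ↦ a` and `y ↦ b`. -/
def coordHom {A : Type u} [CommRing A] [Algebra R A] (a b : A) :
    MvPolynomial (Fin 2) R →+* Γ(Spec (.of A), ⊤) :=
  (Scheme.ΓSpecIso (.of A)).inv.hom.comp
    (MvPolynomial.eval₂Hom (algebraMap R A) ![a, b])

lemma coordHom_map_irrelevant {A : Type u} [CommRing A] [Algebra R A] (a b : A)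
    (h : IsCoprime a b) :
    (HomogeneousIdeal.irrelevant (grading R)).toIdeal.map (coordHom R a b) = ⊤ := by
  obtain ⟨c, d, hcd⟩ := h
  rw [coordHom, ← Ideal.map_map, show Ideal.map (MvPolynomial.eval₂Hom (algebraMap R A) ![a, b])
    (HomogeneousIdeal.irrelevant (grading R)).toIdeal = ⊤ from ?_, Ideal.map_top]
  rw [Ideal.eq_top_iff_one, ← hcd]
  refine Ideal.add_mem _ (Ideal.mul_mem_left _ _ ?_) (Ideal.mul_mem_left _ _ ?_)
  · simpa using Ideal.mem_map_of_mem (MvPolynomial.eval₂Hom (algebraMap R A) ![a, b])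
      (X_mem_irrelevant (R := R) 0)
  · simpa using Ideal.mem_map_of_mem (MvPolynomial.eval₂Hom (algebraMap R A) ![a, b])
      (X_mem_irrelevant (R := R) 1)

/-- The `A`-valued point `[a : b]` of `ℙ¹` over `R`, for `a, b` generating the unit ideal of the
`R`-algebra `A`. -/
def P1.point {A : Type u} [CommRing A] [Algebra R A] (a b : A) (h : IsCoprime a b) :
    Spec (.of A) ⟶ P1 R :=
  Proj.fromOfGlobalSections (grading R) (coordHom R a b) (coordHom_map_irrelevant R a b h)

/-- The affine chart `𝔸¹ = Spec R[z] → ℙ¹`, `z ↦ [z : 1]`. -/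
def P1.chart : Spec (.of R[X]) ⟶ P1 R :=
  P1.point R (A := R[X]) X 1 isCoprime_one_right

/-- The closed point `z̃ = 0` of the special fibre of `ℙ¹` over a local ring `R`, as the point
`[0 : 1]` with values in the residue field. -/
def P1.zeroPoint [IsLocalRing R] : Spec (.of (IsLocalRing.ResidueField R)) ⟶ P1 R :=
  P1.point R (A := IsLocalRing.ResidueField R) 0 1 isCoprime_one_right

variable (K : Type u) [CommRing K] [Algebra R K]

/-- Base change of coefficients `R[x, y] → K[x, y]`, as a graded homomorphism. -/
def gradedMap : GradedRingHom (grading R) (grading K) where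
  __ := MvPolynomial.map (σ := Fin 2) (algebraMap R K)
  map_mem {_ p} hp := MvPolynomial.IsHomogeneous.map (φ := p) hp (algebraMap R K)

lemma irrelevant_le_map_gradedMap :
    HomogeneousIdeal.irrelevant (grading K) ≤
      (HomogeneousIdeal.irrelevant (grading R)).map (gradedMap R K) := by
  refine (irrelevant_le_span (R := K)).trans (Ideal.span_le.mpr ?_)
  rintro _ ⟨i, rfl⟩
  have h : gradedMap R K (MvPolynomial.X i) = MvPolynomial.X i :=
    MvPolynomial.map_X (algebraMap R K) i
  rw [← h]
  exact Ideal.mem_map_of_mem _ (X_mem_irrelevant i)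

/-- The base change morphism `ℙ¹_K → ℙ¹_R`. -/
def P1.baseChange : P1 K ⟶ P1 R :=
  Proj.map (gradedMap R K) (irrelevant_le_map_gradedMap R K)

end ProjectiveLine

/-- `φ : ℙ¹_K → ℙ¹_K` is the `K`-morphism given in the affine coordinate `z` by the polynomial
`p`, that is, by `z ↦ p(z)` on the chart `𝔸¹_K`. -/
structure IsPolynomialMap {K : Type u} [Field K] (p : K[X]) (φ : P1 K ⟶ P1 K) : Prop where
  comp_toSpec : φ ≫ P1.toSpec K = P1.toSpec K
  chart : P1.chart K ≫ φ =
    Spec.map (CommRingCat.ofHom (Polynomial.aeval (R := K) p).toRingHom) ≫ P1.chart K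

/-! ### Blowing up -/

/-- The ideal sheaf `I` is invertible: locally it is generated by one nonzerodivisor, so that
the closed subscheme it defines is an effective Cartier divisor. -/
def IsInvertible {X : Scheme.{u}} (I : X.IdealSheafData) : Prop :=
  ∀ x : X, ∃ U : X.affineOpens, x ∈ U.1 ∧ ∃ t ∈ Γ(X, U.1)⁰, I.ideal U = Ideal.span {t}

/-- `b : Y → X` is the blow-up of `X` along the ideal sheaf `I`: the inverse image ideal sheaf
of `I` on `Y` is invertible, and `b` is universal (terminal) with this property. -/
structure IsBlowUp {X Y : Scheme.{u}} (I : X.IdealSheafData) (b : Y ⟶ X) : Prop where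
  invertible : IsInvertible (I.comap b)
  existsUnique_lift {T : Scheme.{u}} (g : T ⟶ X) (hg : IsInvertible (I.comap g)) :
    ∃! h : T ⟶ Y, h ≫ b = g

/-! ### Weak Néron models -/

/-- The `R`-scheme `s : V → Spec R` with the morphism `Φ : V → V` is a weak Néron model of
`(ℙ¹_K, φ)`, where `j : ℙ¹_K → V` identifies `ℙ¹_K` with the generic fibre of `V`. -/
structure IsWeakNeronModel (R K : Type u) [CommRing R] [Field K] [Algebra R K]
    (φ : P1 K ⟶ P1 K) {V : Scheme.{u}} (s : V ⟶ Spec (.of R)) (j : P1 K ⟶ V) (Φ : V ⟶ V) :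
    Prop where
  smooth : Smooth s
  separated : IsSeparated s
  locallyOfFiniteType : LocallyOfFiniteType s
  quasiCompact : QuasiCompact s
  /-- `Φ` is an `R`-morphism. -/
  comp_structure : Φ ≫ s = s
  /-- The generic fibre of `V` is `ℙ¹_K`. -/
  genericFibre :
    IsPullback j (P1.toSpec K) s (Spec.map (CommRingCat.ofHom (algebraMap R K)))
  /-- Every `K`-rational point of `ℙ¹` extends to a section over `Spec R`. -/
  extends_point (P : Spec (.of K) ⟶ P1 K) (hP : P ≫ P1.toSpec K = 𝟙 _) :
    ∃ Q : Spec (.of R) ⟶ V, Q ≫ s = 𝟙 _ ∧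
      Spec.map (CommRingCat.ofHom (algebraMap R K)) ≫ Q = P ≫ j
  /-- `Φ` restricts to `φ` on the generic fibre. -/
  restrict : j ≫ Φ = φ ≫ j

end

end WeakNeron

/-!
The special fibre of the blow-up `b : X₁ → ℙ¹_R` at `z̃ = 0` consists of two projective lines
crossing in a node. Around them, `X₁` has three charts: `c₀` with coordinate `w = z / π`, `c₁` with
coordinates `x = z`, `y = π / z` and ring `R[x, y] / (x y - π)`, which contains the node, and `c₂`
with coordinate `s = 1 / z`. To construct it, take the closure in `ℙ¹ × ℙ¹` of the graph of
`z ↦ z / π` (`exists_model`). Its universal property (`exists_isBlowUp`) is elementary: if the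
inverse image `(a, π)` of the centre under a point `[a : 1]` is generated by a nonzerodivisor `t`,
then `[a / t : π / t]` is the only point that solves the equation of the graph. Since blow-ups are
unique, every blow-up has these charts (`IsBlowUp.exists_charts`).

The node is not a smooth point, because `π = x y` is not in `𝔪²` for a uniformizer `π`
(`not_formallySmooth_nodeRing`). So the smooth locus `V` is the union of the two affine lines `c₀`
and `c₂` (`HasBlowUpCharts.coe_smoothLocus`). A rational point `ζ` extends to a section of `V`
because one of `ζ / π` and `1 / ζ` is integral (`HasBlowUpCharts.exists_section`).

`V` is reduced and separated, so a morphism on `V` amounts to morphisms defined locally that agree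
at the generic point (`exists_extension_of_local`). On the generic fibre one takes `φ`. Near a point
of the special fibre, there are the following formulas, with `φ = f / πⁿ`
(`HasSmoothCharts.exists_extension`).

* On `c₂`, where `s = 1 / z`, the denominator in `1 / φ = πⁿ s³ / (c + a₁ s + a₂ s² + a₃ s³)`
  reduces to the nonzero constant `c`, so that `c₂` maps to `c₂`.
* On `c₀`, where `z = π w`, everything depends on `f(π w)`. If it is divisible by `πⁿ⁺¹`, then
  `φ(π w) / π` is a polynomial in `w`, and `c₀` maps to `c₀`. If it is `πʳ` times a polynomial that
  reduces to a nonzero constant, with `r ≤ n`, then `1 / φ(π w)` is regular, and `c₀` maps to `c₂`.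

The normalization of `φ` puts us in one of these two cases (`comp_eq_of_normalized`), with one
exception: if `v(a₃) = 2`, then `v(a₂) = 1` has to be excluded. In that case `f(z) - πⁿ z` has
exactly one root of valuation `1` by its Newton polygon, which is therefore rational: Hensel's lemma
gives it (`exists_unit_root`). This contradicts the irreducibility of `φ(z) - z`
(`sq_dvd_of_irreducible`).
-/

namespace WeakNeron

attribute [local instance] MvPolynomial.gradedAlgebra

noncomputable section

/-! ### Morphisms to `Proj` given by global sections -/

section Proj

variable {A σ : Type u} [CommRing A] [SetLike σ A] [AddSubgroupClass σ A] (𝒜 : ℕ → σ)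
  [GradedRing 𝒜]

lemma toSpecΓ_morphismRestrict_basicOpenIsoSpecAway (X : Scheme.{u}) (x : Γ(X, ⊤)) :
    X.toSpecΓ ∣_ PrimeSpectrum.basicOpen x ≫ (basicOpenIsoSpecAway x).hom ≫
      Spec.map (CommRingCat.ofHom (algebraMap Γ(X, ⊤) (Localization.Away x))) =
    (X.toSpecΓ ⁻¹ᵁ PrimeSpectrum.basicOpen x).ι ≫ X.toSpecΓ :=
  (congrArg _ (basicOpenIsoSpecAway_hom_SpecMap x)).trans (morphismRestrict_ι _ _)

open HomogeneousLocalization in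
/-- A morphism `Spec T ⟶ Spec S ⟶ Proj 𝒜` given by global sections lands in the chart `D₊(t)`
as soon as `t` becomes invertible on `Spec T`. -/
lemma SpecMap_fromOfGlobalSections {S T : CommRingCat.{u}} (g : S ⟶ T)
    (f : A →+* Γ(Spec S, ⊤)) (hf : (HomogeneousIdeal.irrelevant 𝒜).toIdeal.map f = ⊤)
    {t : A} {d : ℕ} (ht : t ∈ 𝒜 d) (hd : 0 < d) (e : Away 𝒜 t →+* T)
    (hunit : IsUnit (g.hom ((Scheme.ΓSpecIso S).hom.hom (f t))))
    (he : ∀ (n : ℕ) (a : A) (ha : a ∈ 𝒜 (n • d)),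
      e (Away.mk 𝒜 ht n a ha) * g.hom ((Scheme.ΓSpecIso S).hom.hom (f t)) ^ n =
        g.hom ((Scheme.ΓSpecIso S).hom.hom (f a))) :
    Spec.map g ≫ Proj.fromOfGlobalSections 𝒜 f hf =
      Spec.map (CommRingCat.ofHom e) ≫ Proj.awayι 𝒜 t ht hd := by
  have hr : Set.range (Spec.map g) ⊆ Set.range ((Spec S).basicOpen (f t)).ι := by
    rw [Scheme.Opens.range_ι]
    rintro _ ⟨x, rfl⟩
    have h : IsUnit ((Spec.map g).appTop.hom (f t)) := by
      rw [← isUnit_map_iff (Scheme.ΓSpecIso T).hom.hom, ← RingHom.comp_apply,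
        ← CommRingCat.hom_comp, Scheme.ΓSpecIso_naturality]
      exact hunit
    have h2 : (Spec.map g) ⁻¹ᵁ ((Spec S).basicOpen (f t)) = ⊤ := by
      rw [Scheme.preimage_basicOpen_top, Scheme.basicOpen_of_isUnit _ h]
    exact h2.ge (Set.mem_univ x)
  obtain ⟨l, hl⟩ : ∃ l, l ≫ ((Spec S).basicOpen (f t)).ι = Spec.map g :=
    ⟨IsOpenImmersion.lift _ _ hr, IsOpenImmersion.lift_fac _ _ _⟩
  have h1 : ((Spec S).basicOpen (f t)).ι ≫ Proj.fromOfGlobalSections 𝒜 f hf =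
      Proj.toBasicOpenOfGlobalSections 𝒜 f rfl hd ht ≫ (Proj.basicOpen 𝒜 t).ι := by
    rw [← Proj.fromOfGlobalSections_resLE 𝒜 f hf hd ht, Scheme.Hom.resLE_comp_ι]
  rw [← hl, Category.assoc, h1, Proj.toBasicOpenOfGlobalSections]
  simp only [Category.assoc, Proj.basicOpenIsoSpec_inv_ι]
  simp only [← Category.assoc]
  congr 1
  let q : Γ(Spec S, ⊤) →+* T := g.hom.comp (Scheme.ΓSpecIso S).hom.hom
  let q' : Localization.Away (f t) →+* T := IsLocalization.Away.lift (f t) (g := q) hunit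
  have hq (x) : q' (algebraMap _ _ x) = q x := IsLocalization.Away.lift_eq (f t) hunit x
  have hq' : q'.comp (algebraMap _ _) = q := RingHom.ext hq
  have h2 : (((l ≫ ((Spec S).isoOfEq ((Spec S).toSpecΓ_preimage_basicOpen (f t))).inv) ≫
      (Spec S).toSpecΓ ∣_ PrimeSpectrum.basicOpen (f t)) ≫ (basicOpenIsoSpecAway (f t)).hom) =
      Spec.map (CommRingCat.ofHom q') := by
    rw [← cancel_mono (Spec.map (CommRingCat.ofHom
      (algebraMap Γ(Spec S, ⊤) (Localization.Away (f t)))))]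
    rw [← Spec.map_comp, ← CommRingCat.ofHom_comp]
    simp only [Category.assoc]
    refine (congrArg (fun z => l ≫ _ ≫ z)
      (toSpecΓ_morphismRestrict_basicOpenIsoSpecAway (Spec S) (f t))).trans ?_
    simp only [Scheme.isoOfEq_inv, Scheme.homOfLE_ι_assoc]
    rw [reassoc_of% hl, hq']
    simp only [q]
    rw [CommRingCat.ofHom_comp, Spec.map_comp, CommRingCat.ofHom_hom, CommRingCat.ofHom_hom]
    rw [← cancel_mono (Spec.map (Scheme.ΓSpecIso S).inv)]
    rw [Category.assoc, Category.assoc, toSpecΓ_SpecMap_ΓSpecIso_inv, ← Spec.map_comp,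
      Iso.inv_hom_id, Spec.map_id]
  rw [h2, ← Spec.map_comp, ← CommRingCat.ofHom_comp]
  congr 2
  ext a
  obtain ⟨n, a, ha, rfl⟩ := a.mk_surjective _ ht
  rw [← (hunit.pow n).mul_left_inj]
  erw [he]
  simp only [RingHom.coe_comp, Function.comp_apply, HomogeneousLocalization.algebraMap_apply,
    Away.val_mk, Localization.mk_eq_mk', IsLocalization.map_mk']
  refine Eq.trans ?_ (hq (f a))
  rw [← IsLocalization.mk'_spec (M := .powers (f t)) (Localization.Away (f t)) (f a)
    ⟨f t ^ n, n, rfl⟩, map_mul, hq]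
  simp [q]

end Proj

/-! ### The affine charts of the projective line -/

section ProjectiveLineCharts

lemma eval₂_mul_of_isHomogeneous {σ R S : Type*} [CommSemiring R] [CommSemiring S]
    {p : MvPolynomial σ R} {n : ℕ} (hp : p.IsHomogeneous n) (f : R →+* S) (c : S) (x : σ → S) :
    p.eval₂ f (fun i ↦ c * x i) = c ^ n * p.eval₂ f x := by
  rw [MvPolynomial.eval₂_eq, MvPolynomial.eval₂_eq, Finset.mul_sum]
  refine Finset.sum_congr rfl fun d hd ↦ ?_
  rw [hp.degree_eq_sum_deg_support hd]
  simp_rw [mul_pow, Finset.prod_mul_distrib, Finset.prod_pow_eq_pow_sum]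
  ring

variable (R : Type u) [CommRing R]

open HomogeneousLocalization

/-- The ring of the chart `D₊(X i)` of the projective line. -/
abbrev AwayX (i : Fin 2) : Type u := Away (grading R) (MvPolynomial.X i)

lemma X_mem_grading (i : Fin 2) : (MvPolynomial.X i : MvPolynomial (Fin 2) R) ∈ grading R 1 :=
  MvPolynomial.isHomogeneous_X R i

variable {B : Type u} [CommRing B] [Algebra R B]

/-- Evaluation of fractions of degree zero `p / X i ^ n` at a vector `w` whose `i`-th coordinate
is invertible. -/
def awayEval (i : Fin 2) (w : Fin 2 → B) (hw : IsUnit (w i)) : AwayX R i →+* B :=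
  (IsLocalization.Away.lift (S := Localization.Away (MvPolynomial.X i : MvPolynomial (Fin 2) R))
    (MvPolynomial.X i) (g := MvPolynomial.eval₂Hom (algebraMap R B) w) (by simpa using hw)).comp
    (algebraMap (AwayX R i) (Localization.Away (MvPolynomial.X i)))

lemma awayEval_mk (i : Fin 2) (w : Fin 2 → B) (hw : IsUnit (w i)) (n : ℕ)
    (p : MvPolynomial (Fin 2) R) (hp : p ∈ grading R (n • 1)) :
    awayEval R i w hw (Away.mk _ (X_mem_grading R i) n p hp) * w i ^ n =
      p.eval₂ (algebraMap R B) w := by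
  rw [awayEval, RingHom.comp_apply, HomogeneousLocalization.algebraMap_apply, Away.val_mk]
  have h (x) := IsLocalization.Away.lift_eq
    (S := Localization.Away (MvPolynomial.X i : MvPolynomial (Fin 2) R))
    (g := MvPolynomial.eval₂Hom (algebraMap R B) w) (MvPolynomial.X i) (by simpa using hw) x
  rw [← MvPolynomial.coe_eval₂Hom, ← h, Localization.mk_eq_mk', ← IsLocalization.mk'_spec
    (M := .powers (MvPolynomial.X i : MvPolynomial (Fin 2) R)) (Localization.Away _) p
    ⟨MvPolynomial.X i ^ n, n, rfl⟩, map_mul, h]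
  simp

variable {R}

omit [Algebra R B] in
lemma awayX_hom_ext {i : Fin 2} {e e' : AwayX R i →+* B} (c : B) (hc : IsUnit c)
    (h : ∀ (n : ℕ) (p : MvPolynomial (Fin 2) R) (hp : p ∈ grading R (n • 1)),
      e (Away.mk _ (X_mem_grading R i) n p hp) * c ^ n =
      e' (Away.mk _ (X_mem_grading R i) n p hp) * c ^ n) : e = e' := by
  ext x
  obtain ⟨n, p, hp, rfl⟩ := x.mk_surjective _ (X_mem_grading R i)
  exact (hc.pow n).mul_left_inj.mp (h n p hp)

/-- Evaluation is compatible with homomorphisms and does not change if the vector is multiplied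
by a scalar. -/
lemma comp_awayEval {A : Type u} [CommRing A] [Algebra R A] (g : A →ₐ[R] B) (i : Fin 2)
    (w : Fin 2 → A) (hw : IsUnit (w i)) (w' : Fin 2 → B) (hw' : IsUnit (w' i)) (c : B)
    (h : ∀ j, w' j = c * g (w j)) :
    g.toRingHom.comp (awayEval R i w hw) = awayEval R i w' hw' := by
  refine awayX_hom_ext (w' i) hw' fun n p hp ↦ ?_
  rw [awayEval_mk]
  obtain rfl : w' = fun j ↦ c * g (w j) := funext h
  rw [eval₂_mul_of_isHomogeneous hp, mul_pow, mul_left_comm, ← map_pow, RingHom.comp_apply]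
  erw [← map_mul g, awayEval_mk, MvPolynomial.hom_eval₂]
  simp only [smul_eq_mul, mul_one]
  congr 2
  exact g.comp_algebraMap

/-- The coordinate vector of the standard section over the chart `D₊(X i)`: the `i`-th
coordinate is `1` and the other one is `a`. -/
def chartVec {A : Type u} [CommRing A] (i : Fin 2) (a : A) : Fin 2 → A :=
  fun j ↦ if j = i then 1 else a

lemma chartVec_self {A : Type u} [CommRing A] (i : Fin 2) (a : A) : chartVec i a i = 1 := if_pos rfl

variable (R) in
/-- The homomorphism `R[X] → AwayX R i` that maps the variable to the quotient of the other
coordinate `X (1 - i)` by `X i`. It is inverse to evaluation at `chartVec i X`. -/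
def polyToAwayX (i : Fin 2) : R[X] →+* AwayX R i :=
  Polynomial.eval₂RingHom ((fromZeroRingHom (grading R) _).comp (algebraMap R (grading R 0)))
    (Away.mk _ (X_mem_grading R i) 1 (MvPolynomial.X (1 - i)) (X_mem_grading R (1 - i)))

lemma awayEval_comp_polyToAwayX (i : Fin 2) :
    (awayEval R i (chartVec i (X : R[X])) (by simp [chartVec_self])).comp (polyToAwayX R i) =
      RingHom.id _ := by
  have key (n : ℕ) (p : MvPolynomial (Fin 2) R) (hp : p ∈ grading R (n • 1)) :=
    awayEval_mk R i (chartVec i (X : R[X])) (by simp [chartVec_self]) n p hp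
  simp only [chartVec_self, one_pow, mul_one] at key
  refine Polynomial.ringHom_ext (fun a ↦ ?_) ?_
  · have := key 0 (MvPolynomial.C a) (MvPolynomial.isHomogeneous_C _ a)
    simp only [MvPolynomial.eval₂_C] at this
    simp only [polyToAwayX, RingHom.comp_apply, coe_eval₂RingHom, eval₂_C, RingHom.id_apply]
    refine Eq.trans (congrArg _ ?_) this
    ext
    simp [fromZeroRingHom]
    rfl
  · simp only [polyToAwayX, RingHom.comp_apply, coe_eval₂RingHom, eval₂_X, RingHom.id_apply, key,
      MvPolynomial.eval₂_X]
    fin_cases i <;> simp [chartVec]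

lemma polyToAwayX_comp_awayEval (i : Fin 2) :
    (polyToAwayX R i).comp (awayEval R i (chartVec i (X : R[X])) (by simp [chartVec_self])) =
      RingHom.id _ := by
  let : Algebra R (AwayX R i) := ((fromZeroRingHom (grading R) _).comp
    (algebraMap R (grading R 0))).toAlgebra
  have hC (r : R) : polyToAwayX R i (C r) = algebraMap R (AwayX R i) r := by
    simp only [polyToAwayX, coe_eval₂RingHom, eval₂_C]
    rfl
  let g : R[X] →ₐ[R] AwayX R i := { polyToAwayX R i with commutes' := hC }
  let u : Fin 2 → AwayX R i := fun j ↦ g (chartVec i X j)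
  have hu : u i = 1 := by simp [u, chartVec_self]
  refine (comp_awayEval g i _ _ u (by simp [hu]) 1 fun j ↦ (one_mul _).symm).trans ?_
  refine awayX_hom_ext 1 isUnit_one fun n p hp ↦ ?_
  simp only [one_pow, mul_one, RingHom.id_apply]
  have := awayEval_mk R i u (by simp [hu]) n p hp
  have hun : u i ^ n = 1 := by rw [hu, one_pow]
  rw [hun, mul_one] at this
  rw [this]
  apply HomogeneousLocalization.val_injective
  let L := Localization.Away (MvPolynomial.X i : MvPolynomial (Fin 2) R)
  let c : L := Localization.mk 1 ⟨MvPolynomial.X i, 1, pow_one _⟩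
  have h1 (j : Fin 2) : algebraMap (AwayX R i) L (u j) =
      c * algebraMap (MvPolynomial (Fin 2) R) L (MvPolynomial.X j) := by
    by_cases hj : j = i
    · subst hj
      rw [hu, map_one, ← Localization.mk_one_eq_algebraMap, Localization.mk_mul, one_mul, mul_one]
      exact (Localization.mk_self (⟨MvPolynomial.X j, 1, pow_one _⟩ :
        Submonoid.powers (MvPolynomial.X j : MvPolynomial (Fin 2) R))).symm
    · have hj' : j = 1 - i := by omega
      have : u j = Away.mk _ (X_mem_grading R i) 1 (MvPolynomial.X (1 - i))
          (X_mem_grading R (1 - i)) := by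
        simp only [u, chartVec, if_neg hj]
        exact Polynomial.eval₂_X _ _
      rw [this, HomogeneousLocalization.algebraMap_apply, Away.val_mk,
        ← Localization.mk_one_eq_algebraMap, Localization.mk_mul, one_mul, mul_one, hj']
      congr 2
      exact pow_one _
  have h2 : (algebraMap (AwayX R i) L).comp (algebraMap R (AwayX R i)) =
      (algebraMap (MvPolynomial (Fin 2) R) L).comp MvPolynomial.C := by
    ext r
    simp only [RingHom.comp_apply]
    rw [← Localization.mk_one_eq_algebraMap]
    rfl
  rw [← HomogeneousLocalization.algebraMap_apply, MvPolynomial.hom_eval₂, h2]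
  refine (congrArg (fun z ↦ MvPolynomial.eval₂ _ z p) (funext h1)).trans ?_
  rw [eval₂_mul_of_isHomogeneous (by simpa using hp)]
  have h3 := MvPolynomial.hom_eval₂ p MvPolynomial.C (algebraMap (MvPolynomial (Fin 2) R) L)
    MvPolynomial.X
  rw [MvPolynomial.eval₂_eta] at h3
  rw [← h3, Away.val_mk, ← Localization.mk_one_eq_algebraMap, Localization.mk_pow,
    Localization.mk_mul, one_pow, one_mul, mul_one]
  rfl

lemma awayEval_chartVec_bijective (i : Fin 2) :
    Function.Bijective (awayEval R i (chartVec i (X : R[X])) (by simp [chartVec_self])) :=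
  Function.bijective_iff_has_inverse.mpr ⟨polyToAwayX R i,
    fun x ↦ congr($(polyToAwayX_comp_awayEval (R := R) i) x),
    fun x ↦ congr($(awayEval_comp_polyToAwayX (R := R) i) x)⟩

variable (R)

/-- The open immersion of the chart `D₊(X i)` of the projective line. -/
def awayιX (i : Fin 2) : Spec (.of (AwayX R i)) ⟶ P1 R :=
  Proj.awayι (grading R) (MvPolynomial.X i) (X_mem_grading R i) one_pos

instance (i : Fin 2) : IsOpenImmersion (awayιX R i) :=
  inferInstanceAs (IsOpenImmersion (Proj.awayι (grading R) (MvPolynomial.X i) _ _))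

/-- The open subset `D₊(X i)` of the projective line. -/
def P1.basicOpenX (i : Fin 2) : (P1 R).Opens :=
  Proj.basicOpen (grading R) (MvPolynomial.X i)

lemma opensRange_awayιX (i : Fin 2) : (awayιX R i).opensRange = P1.basicOpenX R i :=
  Proj.opensRange_awayι _ _ _ _

/-- The pullback of `[a : b]` along `g : A → B` lands in `D₊(X i)` if the `i`-th coordinate
becomes invertible in `B`. -/
lemma SpecMap_point_awayιX {A : Type u} [CommRing A] [Algebra R A] (g : A →ₐ[R] B) (a b : A)
    (h : IsCoprime a b) (i : Fin 2) (hu : IsUnit (g (![a, b] i))) :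
    Spec.map (CommRingCat.ofHom g.toRingHom) ≫ P1.point R a b h =
      Spec.map (CommRingCat.ofHom (awayEval R i (fun j ↦ g (![a, b] j)) hu)) ≫ awayιX R i := by
  have h0 (p : MvPolynomial (Fin 2) R) : (Scheme.ΓSpecIso (.of A)).hom.hom (coordHom R a b p) =
      p.eval₂ (algebraMap R A) ![a, b] :=
    congr($((Scheme.ΓSpecIso (.of A)).inv_hom_id).hom (p.eval₂ (algebraMap R A) ![a, b]))
  have h1 (p : MvPolynomial (Fin 2) R) :
      g.toRingHom ((Scheme.ΓSpecIso (.of A)).hom.hom (coordHom R a b p)) =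
        p.eval₂ (algebraMap R B) (fun j ↦ g (![a, b] j)) := by
    rw [h0, MvPolynomial.hom_eval₂]
    congr 1
    exact g.comp_algebraMap
  have h2 : g.toRingHom ((Scheme.ΓSpecIso (.of A)).hom.hom (coordHom R a b (MvPolynomial.X i))) =
      g (![a, b] i) := by rw [h1, MvPolynomial.eval₂_X]
  refine SpecMap_fromOfGlobalSections (grading R) (CommRingCat.ofHom g.toRingHom) _ _
    (X_mem_grading R i) one_pos _ ?_ fun n p hp ↦ ?_
  · exact h2 ▸ hu
  · refine Eq.trans ?_ ((awayEval_mk R i _ hu n p hp).trans (h1 p).symm)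
    exact congrArg (_ * · ^ n) h2

/-- The affine chart `Spec R[s] ⟶ ℙ¹` around infinity, `s ↦ [1 : s]`. -/
def P1.chartInfty : Spec (.of R[X]) ⟶ P1 R :=
  P1.point R (A := R[X]) 1 X isCoprime_one_left

lemma chart_eq_awayιX : P1.chart R = Spec.map (CommRingCat.ofHom
    (awayEval R 1 (chartVec 1 (X : R[X])) (by simp [chartVec_self]))) ≫ awayιX R 1 := by
  have := SpecMap_point_awayιX R (AlgHom.id R R[X]) X 1 isCoprime_one_right 1 isUnit_one
  rw [show CommRingCat.ofHom (AlgHom.id R R[X]).toRingHom = 𝟙 _ from rfl, Spec.map_id,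
    Category.id_comp] at this
  rw [P1.chart, this]
  congr 4
  ext j
  fin_cases j <;> simp [chartVec]

lemma chartInfty_eq_awayιX : P1.chartInfty R = Spec.map (CommRingCat.ofHom
    (awayEval R 0 (chartVec 0 (X : R[X])) (by simp [chartVec_self]))) ≫ awayιX R 0 := by
  have := SpecMap_point_awayιX R (AlgHom.id R R[X]) 1 X isCoprime_one_left 0 isUnit_one
  rw [show CommRingCat.ofHom (AlgHom.id R R[X]).toRingHom = 𝟙 _ from rfl, Spec.map_id,
    Category.id_comp] at this
  rw [P1.chartInfty, this]
  congr 4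
  ext j
  fin_cases j <;> simp [chartVec]

lemma isIso_SpecMap_awayEval (i : Fin 2) : IsIso (Spec.map (CommRingCat.ofHom
    (awayEval R i (chartVec i (X : R[X])) (by simp [chartVec_self])))) := by
  have : IsIso (CommRingCat.ofHom
    (awayEval R i (chartVec i (X : R[X])) (by simp [chartVec_self]))) :=
    (ConcreteCategory.isIso_iff_bijective _).mpr (awayEval_chartVec_bijective i)
  infer_instance

instance : IsOpenImmersion (P1.chart R) := by
  have := isIso_SpecMap_awayEval R 1
  rw [chart_eq_awayιX]
  infer_instance

instance : IsOpenImmersion (P1.chartInfty R) := by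
  have := isIso_SpecMap_awayEval R 0
  rw [chartInfty_eq_awayιX]
  infer_instance

lemma opensRange_chart : (P1.chart R).opensRange = P1.basicOpenX R 1 := by
  have := isIso_SpecMap_awayEval R 1
  simp_rw [chart_eq_awayιX]
  rw [Scheme.Hom.opensRange_comp_of_isIso]
  exact opensRange_awayιX R _

lemma opensRange_chartInfty :
    (P1.chartInfty R).opensRange = P1.basicOpenX R 0 := by
  have := isIso_SpecMap_awayEval R 0
  simp_rw [chartInfty_eq_awayιX]
  rw [Scheme.Hom.opensRange_comp_of_isIso]
  exact opensRange_awayιX R _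

lemma opensRange_chart_sup_chartInfty :
    (P1.chart R).opensRange ⊔ (P1.chartInfty R).opensRange = ⊤ := by
  have : ⨆ i, P1.basicOpenX R i = ⊤ := Proj.iSup_basicOpen_eq_top (grading R)
    (MvPolynomial.X : Fin 2 → MvPolynomial (Fin 2) R) irrelevant_le_span
  rw [opensRange_chart, opensRange_chartInfty, eq_top_iff, ← this, iSup_le_iff]
  intro i
  fin_cases i
  · exact le_sup_right
  · exact le_sup_left

variable {R}

lemma SpecMap_point_chart {A : Type u} [CommRing A] [Algebra R A] (g : A →ₐ[R] B) (a b : A)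
    (h : IsCoprime a b) (c : B) (hc : g b * c = 1) :
    Spec.map (CommRingCat.ofHom g.toRingHom) ≫ P1.point R a b h =
      Spec.map (CommRingCat.ofHom (aeval (R := R) (g a * c)).toRingHom) ≫ P1.chart R := by
  rw [SpecMap_point_awayιX R g a b h 1 (.of_mul_eq_one _ hc), chart_eq_awayιX,
    ← Spec.map_comp_assoc,
    ← CommRingCat.ofHom_comp]
  congr 3
  symm
  refine comp_awayEval _ _ _ _ _ _ (g b) fun j ↦ ?_
  fin_cases j
  · simp only [chartVec, Fin.zero_eta]
    simp
    linear_combination (-g a) * hc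
  · simp [chartVec]

lemma SpecMap_point_chartInfty {A : Type u} [CommRing A] [Algebra R A] (g : A →ₐ[R] B) (a b : A)
    (h : IsCoprime a b) (c : B) (hc : g a * c = 1) :
    Spec.map (CommRingCat.ofHom g.toRingHom) ≫ P1.point R a b h =
      Spec.map (CommRingCat.ofHom (aeval (R := R) (g b * c)).toRingHom) ≫ P1.chartInfty R := by
  rw [SpecMap_point_awayιX R g a b h 0 (.of_mul_eq_one _ hc), chartInfty_eq_awayιX,
    ← Spec.map_comp_assoc,
    ← CommRingCat.ofHom_comp]
  congr 3
  symm
  refine comp_awayEval _ _ _ _ _ _ (g a) fun j ↦ ?_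
  fin_cases j
  · simp [chartVec]
  · simp only [chartVec, Fin.mk_one]
    simp
    linear_combination (-g b) * hc

end ProjectiveLineCharts

/-! ### Points of the projective line with values in an algebra -/

section Points

lemma Spec_hom_ext_of_isCoprime {B : Type u} [CommRing B] {a b : B} (h : IsCoprime a b)
    {Y : Scheme.{u}} {f g : Spec (.of B) ⟶ Y}
    (ha : Spec.map (CommRingCat.ofHom (algebraMap B (Localization.Away a))) ≫ f =
      Spec.map (CommRingCat.ofHom (algebraMap B (Localization.Away a))) ≫ g)
    (hb : Spec.map (CommRingCat.ofHom (algebraMap B (Localization.Away b))) ≫ f =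
      Spec.map (CommRingCat.ofHom (algebraMap B (Localization.Away b))) ≫ g) : f = g := by
  have hs : Ideal.span (Set.range ![a, b]) = ⊤ := by
    rw [Ideal.eq_top_iff_one]
    obtain ⟨c, d, hcd⟩ := h
    rw [← hcd]
    exact Ideal.add_mem _ (Ideal.mul_mem_left _ _ (Ideal.subset_span ⟨0, rfl⟩))
      (Ideal.mul_mem_left _ _ (Ideal.subset_span ⟨1, rfl⟩))
  have key (i : Fin 2) :
      Spec.map (CommRingCat.ofHom (algebraMap B (Localization.Away (![a, b] i)))) ≫ f =
      Spec.map (CommRingCat.ofHom (algebraMap B (Localization.Away (![a, b] i)))) ≫ g := by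
    fin_cases i
    · exact ha
    · exact hb
  exact (Scheme.affineOpenCoverOfSpanRangeEqTop (R := .of B) ![a, b] hs).openCover.hom_ext _ _ key

variable {R : Type u} [CommRing R] {A B : Type u} [CommRing A] [CommRing B] [Algebra R A]
  [Algebra R B]

lemma SpecMap_point (g : A →ₐ[R] B) (a b : A) (h : IsCoprime a b) :
    Spec.map (CommRingCat.ofHom g.toRingHom) ≫ P1.point R a b h =
      P1.point R (g a) (g b) (h.map g.toRingHom) := by
  refine Spec_hom_ext_of_isCoprime (h.map g.toRingHom) ?_ ?_
  · let ψ : B →ₐ[R] Localization.Away (g a) := IsScalarTower.toAlgHom R B _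
    rw [← Spec.map_comp_assoc, ← CommRingCat.ofHom_comp]
    have hc : ψ (g a) * IsLocalization.Away.invSelf (g a) = 1 :=
      IsLocalization.Away.mul_invSelf _
    exact (SpecMap_point_chartInfty (ψ.comp g) a b h _ hc).trans
      (SpecMap_point_chartInfty ψ (g a) (g b) _ _ hc).symm
  · let ψ : B →ₐ[R] Localization.Away (g b) := IsScalarTower.toAlgHom R B _
    rw [← Spec.map_comp_assoc, ← CommRingCat.ofHom_comp]
    have hc : ψ (g b) * IsLocalization.Away.invSelf (g b) = 1 :=
      IsLocalization.Away.mul_invSelf _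
    exact (SpecMap_point_chart (ψ.comp g) a b h _ hc).trans
      (SpecMap_point_chart ψ (g a) (g b) _ _ hc).symm

lemma point_right_eq (a b : A) (h : IsCoprime a b) (c : A) (hc : b * c = 1) :
    P1.point R a b h =
      Spec.map (CommRingCat.ofHom (aeval (R := R) (a * c)).toRingHom) ≫ P1.chart R := by
  have := SpecMap_point_chart (AlgHom.id R A) a b h c hc
  rwa [show CommRingCat.ofHom (AlgHom.id R A).toRingHom = 𝟙 _ from rfl, Spec.map_id,
    Category.id_comp] at this

lemma point_left_eq (a b : A) (h : IsCoprime a b) (c : A) (hc : a * c = 1) :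
    P1.point R a b h =
      Spec.map (CommRingCat.ofHom (aeval (R := R) (b * c)).toRingHom) ≫ P1.chartInfty R := by
  have := SpecMap_point_chartInfty (AlgHom.id R A) a b h c hc
  rwa [show CommRingCat.ofHom (AlgHom.id R A).toRingHom = 𝟙 _ from rfl, Spec.map_id,
    Category.id_comp] at this

lemma point_one_right (a : A) :
    P1.point R a 1 isCoprime_one_right =
      Spec.map (CommRingCat.ofHom (aeval (R := R) a).toRingHom) ≫ P1.chart R := by
  simpa using point_right_eq a (1 : A) isCoprime_one_right 1 (mul_one 1)

lemma point_one_left (a : A) :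
    P1.point R 1 a isCoprime_one_left =
      Spec.map (CommRingCat.ofHom (aeval (R := R) a).toRingHom) ≫ P1.chartInfty R := by
  simpa using point_left_eq (1 : A) a isCoprime_one_left 1 (mul_one 1)

lemma dvd_of_isCoprime_of_mul_eq_mul {a b a' b' : A} (h' : IsCoprime a' b')
    (e : a * b' = a' * b) : b' ∣ b := by
  obtain ⟨c, d, hcd⟩ := h'
  exact ⟨c * a + d * b, by linear_combination (-b) * hcd - c * e⟩

lemma point_eq_of_mul_eq_mul {a b a' b' : A} (h : IsCoprime a b) (h' : IsCoprime a' b')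
    (e : a * b' = a' * b) : P1.point R a b h = P1.point R a' b' h' := by
  refine Spec_hom_ext_of_isCoprime h ?_ ?_
  · let ψ : A →ₐ[R] Localization.Away a := IsScalarTower.toAlgHom R A _
    have hc : ψ a * IsLocalization.Away.invSelf a = 1 := IsLocalization.Away.mul_invSelf _
    obtain ⟨k, hk⟩ := dvd_of_isCoprime_of_mul_eq_mul (a := b) (b := a) h'.symm
      (by linear_combination -e)
    have hk' : ψ a = ψ a' * ψ k := by rw [← map_mul, ← hk]
    have e' : ψ a * ψ b' = ψ a' * ψ b := by rw [← map_mul, e, map_mul]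
    have hc' : ψ a' * (ψ k * IsLocalization.Away.invSelf a) = 1 := by
      linear_combination hc - IsLocalization.Away.invSelf a * hk'
    refine (SpecMap_point_chartInfty ψ a b h _ hc).trans
      (Eq.trans ?_ (SpecMap_point_chartInfty ψ a' b' h' _ hc').symm)
    congr 5
    linear_combination (-ψ b * IsLocalization.Away.invSelf a) * hc' -
      (ψ k * IsLocalization.Away.invSelf a ^ 2) * e' +
      (ψ b' * ψ k * IsLocalization.Away.invSelf a) * hc
  · let ψ : A →ₐ[R] Localization.Away b := IsScalarTower.toAlgHom R A _
    have hc : ψ b * IsLocalization.Away.invSelf b = 1 := IsLocalization.Away.mul_invSelf _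
    obtain ⟨k, hk⟩ := dvd_of_isCoprime_of_mul_eq_mul h' e
    have hk' : ψ b = ψ b' * ψ k := by rw [← map_mul, ← hk]
    have e' : ψ a * ψ b' = ψ a' * ψ b := by rw [← map_mul, e, map_mul]
    have hc' : ψ b' * (ψ k * IsLocalization.Away.invSelf b) = 1 := by
      linear_combination hc - IsLocalization.Away.invSelf b * hk'
    refine (SpecMap_point_chart ψ a b h _ hc).trans
      (Eq.trans ?_ (SpecMap_point_chart ψ a' b' h' _ hc').symm)
    congr 5
    linear_combination (-ψ a * IsLocalization.Away.invSelf b) * hc' +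
      (ψ k * IsLocalization.Away.invSelf b ^ 2) * e' +
      (ψ a' * ψ k * IsLocalization.Away.invSelf b) * hc

lemma point_preimage_basicOpenX (a b : A) (h : IsCoprime a b) (i : Fin 2) :
    P1.point R a b h ⁻¹ᵁ P1.basicOpenX R i = PrimeSpectrum.basicOpen (![a, b] i) := by
  refine (Proj.fromOfGlobalSections_preimage_basicOpen (grading R) (coordHom R a b)
    (coordHom_map_irrelevant R a b h) one_pos (X_mem_grading R i)).trans ?_
  have : coordHom R a b (MvPolynomial.X i) = (Scheme.ΓSpecIso (.of A)).inv.hom (![a, b] i) := by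
    simp [coordHom]
  rw [this]
  exact basicOpen_eq_of_affine _

lemma aeval_toRingHom_eq_of_SpecMap_comp_eq {a a' : B} {Y : Scheme.{u}}
    (f : Spec (.of R[X]) ⟶ Y) [Mono f]
    (h : Spec.map (CommRingCat.ofHom (aeval (R := R) a).toRingHom) ≫ f =
      Spec.map (CommRingCat.ofHom (aeval (R := R) a').toRingHom) ≫ f) : a = a' := by
  rw [cancel_mono] at h
  have h2 := congr(($(Spec.map_injective h)).hom X)
  have h3 (z : B) : (CommRingCat.ofHom (aeval (R := R) z).toRingHom).hom X = z := aeval_X z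
  rwa [h3, h3] at h2

lemma isUnit_algebraMap_of_point_eq {a b a' b' : A} (h : IsCoprime a b) (h' : IsCoprime a' b')
    (e : P1.point R a b h = P1.point R a' b' h') (i : Fin 2) :
    IsUnit (algebraMap A (Localization.Away (![a, b] i)) (![a', b'] i)) := by
  have h1 : PrimeSpectrum.basicOpen (![a, b] i) = PrimeSpectrum.basicOpen (![a', b'] i) := by
    rw [← point_preimage_basicOpenX (R := R) a b h i, e, point_preimage_basicOpenX]
  exact PrimeSpectrum.basicOpen_le_basicOpen_iff_algebraMap_isUnit.mp h1.le

lemma mul_eq_mul_of_point_eq {a b a' b' : A} (h : IsCoprime a b) (h' : IsCoprime a' b')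
    (e : P1.point R a b h = P1.point R a' b' h') : a * b' = a' * b := by
  have hb : algebraMap A (Localization.Away b) (a * b') = algebraMap A _ (a' * b) := by
    let ψ : A →ₐ[R] Localization.Away b := IsScalarTower.toAlgHom R A _
    have hc : ψ b * IsLocalization.Away.invSelf b = 1 := IsLocalization.Away.mul_invSelf _
    have hu : IsUnit (ψ b') := isUnit_algebraMap_of_point_eq h h' e 1
    obtain ⟨c', hc'⟩ := hu.exists_right_inv
    have h1 := (SpecMap_point_chart ψ a b h _ hc).symm.trans
      ((congrArg _ e).trans (SpecMap_point_chart ψ a' b' h' _ hc'))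
    have h2 := aeval_toRingHom_eq_of_SpecMap_comp_eq _ h1
    change ψ (a * b') = ψ (a' * b)
    rw [map_mul, map_mul]
    linear_combination (ψ b * ψ b') * h2 - (ψ a * ψ b') * hc + (ψ a' * ψ b) * hc'
  have ha : algebraMap A (Localization.Away a) (a * b') = algebraMap A _ (a' * b) := by
    let ψ : A →ₐ[R] Localization.Away a := IsScalarTower.toAlgHom R A _
    have hc : ψ a * IsLocalization.Away.invSelf a = 1 := IsLocalization.Away.mul_invSelf _
    have hu : IsUnit (ψ a') := isUnit_algebraMap_of_point_eq h h' e 0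
    obtain ⟨c', hc'⟩ := hu.exists_right_inv
    have h1 := (SpecMap_point_chartInfty ψ a b h _ hc).symm.trans
      ((congrArg _ e).trans (SpecMap_point_chartInfty ψ a' b' h' _ hc'))
    have h2 := aeval_toRingHom_eq_of_SpecMap_comp_eq _ h1
    change ψ (a * b') = ψ (a' * b)
    rw [map_mul, map_mul]
    linear_combination (-ψ a * ψ a') * h2 + (ψ a' * ψ b) * hc - (ψ a * ψ b') * hc'
  rw [IsLocalization.eq_iff_exists (.powers b)] at hb
  rw [IsLocalization.eq_iff_exists (.powers a)] at ha
  obtain ⟨⟨_, n, rfl⟩, hn⟩ := hb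
  obtain ⟨⟨_, m, rfl⟩, hm⟩ := ha
  obtain ⟨c, d, hcd⟩ := h.pow (m := m) (n := n)
  simp only at hn hm
  linear_combination (-(a * b' - a' * b)) * hcd + c * hm + d * hn

lemma point_toSpec (a b : A) (h : IsCoprime a b) :
    P1.point R a b h ≫ P1.toSpec R = Spec.map (CommRingCat.ofHom (algebraMap R A)) := by
  refine (Proj.fromOfGlobalSections_toSpecZero_assoc (grading R) (coordHom R a b)
    (coordHom_map_irrelevant R a b h) _).trans ?_
  have h1 : CommRingCat.ofHom (algebraMap R (grading R 0)) ≫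
      CommRingCat.ofHom
        ((coordHom R a b).comp (algebraMap (grading R 0) (MvPolynomial (Fin 2) R))) =
      CommRingCat.ofHom (algebraMap R A) ≫ (Scheme.ΓSpecIso (.of A)).inv := by
    ext r
    have : coordHom R a b (MvPolynomial.C r) =
        (Scheme.ΓSpecIso (.of A)).inv.hom (algebraMap R A r) := by
      simp [coordHom]
    exact this
  rw [← Spec.map_comp, h1, Spec.map_comp]
  exact (Category.assoc _ _ _).symm.trans
    ((congrArg (· ≫ _) (toSpecΓ_SpecMap_ΓSpecIso_inv (.of A))).trans (Category.id_comp _))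

variable (K : Type u) [CommRing K] [Algebra R K] [Algebra K A] [IsScalarTower R K A]

omit [Algebra K A] [IsScalarTower R K A] in
open HomogeneousLocalization in
lemma exists_awayιX_baseChange (i : Fin 2) : ∃ e : AwayX R i →+* AwayX K i,
    awayιX K i ≫ P1.baseChange R K = Spec.map (CommRingCat.ofHom e) ≫ awayιX R i ∧
    ∀ (n : ℕ) (p : MvPolynomial (Fin 2) R) (hp : p ∈ grading R (n • 1)),
      e (Away.mk _ (X_mem_grading R i) n p hp) = Away.mk _ (X_mem_grading K i) n
        (MvPolynomial.map (algebraMap R K) p) ((gradedMap R K).map_mem hp) := by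
  suffices H : ∀ (t : MvPolynomial (Fin 2) K) (ht : t ∈ grading K 1)
      (_ : gradedMap R K (MvPolynomial.X i) = t),
      ∃ e : AwayX R i →+* Away (grading K) t,
      Proj.awayι (grading K) t ht one_pos ≫
          Proj.map (gradedMap R K) (irrelevant_le_map_gradedMap R K) =
        Spec.map (CommRingCat.ofHom e) ≫ awayιX R i ∧
      ∀ (n : ℕ) (p : MvPolynomial (Fin 2) R) (hp : p ∈ grading R (n • 1)),
        e (Away.mk _ (X_mem_grading R i) n p hp) = Away.mk _ ht n
        (MvPolynomial.map (algebraMap R K) p) ((gradedMap R K).map_mem hp) from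
    H _ (X_mem_grading K i) (MvPolynomial.map_X (algebraMap R K) i)
  rintro t ht rfl
  refine ⟨Away.map (gradedMap R K) (MvPolynomial.X i), ?_, ?_⟩
  · exact Proj.awayι_comp_map (gradedMap R K) (irrelevant_le_map_gradedMap R K) one_pos
      (MvPolynomial.X i) (X_mem_grading R i)
  · intro n p hp
    exact Away.map_mk (gradedMap R K) _ (X_mem_grading R i) n p hp

omit [Algebra R A] [IsScalarTower R K A] in
variable {K} in
lemma SpecMap_point_baseChange [Algebra K B] [IsScalarTower R K B] (g : A →ₐ[K] B) (a b : A)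
    (h : IsCoprime a b) (i : Fin 2) (hu : IsUnit (g (![a, b] i))) :
    Spec.map (CommRingCat.ofHom g.toRingHom) ≫ P1.point K a b h ≫ P1.baseChange R K =
      Spec.map (CommRingCat.ofHom (awayEval R i (fun j ↦ g (![a, b] j)) hu)) ≫ awayιX R i := by
  obtain ⟨e, he, he'⟩ := exists_awayιX_baseChange (R := R) K i
  rw [← Category.assoc, SpecMap_point_awayιX K g a b h i hu, Category.assoc, he,
    ← Spec.map_comp_assoc, ← CommRingCat.ofHom_comp]
  congr 3
  refine awayX_hom_ext _ hu fun n p hp ↦ ?_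
  rw [RingHom.comp_apply, he']
  have h1 := awayEval_mk K i (fun j ↦ g (![a, b] j)) hu n (MvPolynomial.map (algebraMap R K) p)
    ((gradedMap R K).map_mem hp)
  have h2 := awayEval_mk R i (fun j ↦ g (![a, b] j)) hu n p hp
  rw [MvPolynomial.eval₂_map, ← IsScalarTower.algebraMap_eq] at h1
  exact h1.trans h2.symm

lemma point_baseChange (a b : A) (h : IsCoprime a b) :
    P1.point K a b h ≫ P1.baseChange R K = P1.point R a b h := by
  refine Spec_hom_ext_of_isCoprime h ?_ ?_
  · let ψ : A →ₐ[K] Localization.Away a := IsScalarTower.toAlgHom K A _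
    have hu : IsUnit (ψ (![a, b] 0)) := IsLocalization.Away.algebraMap_isUnit a
    exact (SpecMap_point_baseChange ψ a b h 0 hu).trans
      (SpecMap_point_awayιX R (ψ.restrictScalars R) a b h 0 hu).symm
  · let ψ : A →ₐ[K] Localization.Away b := IsScalarTower.toAlgHom K A _
    have hu : IsUnit (ψ (![a, b] 1)) := IsLocalization.Away.algebraMap_isUnit b
    exact (SpecMap_point_baseChange ψ a b h 1 hu).trans
      (SpecMap_point_awayιX R (ψ.restrictScalars R) a b h 1 hu).symm

end Points

/-! ### Gluing morphisms of schemes -/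

section Gluing

/-- The open cover of a scheme by a family of open immersions indexed by its points. -/
abbrev coverOfPoints {T : Scheme.{u}} (W : T → Scheme.{u}) (w : ∀ x, W x ⟶ T)
    (hw : ∀ x, IsOpenImmersion (w x)) (hx : ∀ x, x ∈ (w x).opensRange) : T.OpenCover :=
  Scheme.Cover.mkOfCovers T W w (fun x ↦ ⟨x, hx x⟩) hw

/-- Lifts of `g : T ⟶ Y` along `f : X ⟶ Y` glue, if they exist locally and are unique. -/
lemma exists_lift_of_local {X Y T : Scheme.{u}} (f : X ⟶ Y) (g : T ⟶ Y)
    (hu : ∀ (W : Scheme.{u}) (w : W ⟶ T) [IsOpenImmersion w] (l l' : W ⟶ X),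
      l ≫ f = w ≫ g → l' ≫ f = w ≫ g → l = l')
    (he : ∀ x : T, ∃ (W : Scheme.{u}) (w : W ⟶ T) (l : W ⟶ X), IsOpenImmersion w ∧
      x ∈ Set.range w ∧ l ≫ f = w ≫ g) : ∃ l : T ⟶ X, l ≫ f = g := by
  choose W w l hw hx hl using he
  let 𝒰 := coverOfPoints W w hw hx
  have h (x y : T) : pullback.fst (w x) (w y) ≫ l x = pullback.snd (w x) (w y) ≫ l y := by
    have := hw x
    have := hw y
    refine hu _ (pullback.fst (w x) (w y) ≫ w x) _ _ ?_ ?_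
    · rw [Category.assoc, hl, Category.assoc]
    · rw [Category.assoc, hl, pullback.condition, Category.assoc]
  refine ⟨Scheme.Cover.glueMorphisms 𝒰 l h, Scheme.Cover.hom_ext 𝒰 _ _ fun x ↦ ?_⟩
  exact (Category.assoc _ _ _).symm.trans
    ((congrArg (· ≫ f) (Scheme.Cover.ι_glueMorphisms 𝒰 l h x)).trans (hl x))

/-- A morphism `e : T ⟶ Y` given at the generic points `η : T ⟶ X` of a reduced scheme `X`
extends to `X` if it extends locally, the target `Y` being separated. -/
lemma exists_extension_of_local {X Y T : Scheme.{u}} [IsReduced X] [Y.IsSeparated] (η : T ⟶ X)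
    (e : T ⟶ Y) (h : ∀ x : X, ∃ (W : Scheme.{u}) (w : W ⟶ X) (t : T ⟶ W) (m : W ⟶ Y),
      IsOpenImmersion w ∧ x ∈ Set.range w ∧ IsDominant t ∧ t ≫ w = η ∧ t ≫ m = e) :
    ∃ F : X ⟶ Y, ∀ (W : Scheme.{u}) (w : W ⟶ X) (t : T ⟶ W) (m : W ⟶ Y),
      IsOpenImmersion w → IsDominant t → t ≫ w = η → t ≫ m = e → w ≫ F = m := by
  choose W w t m hw hx ht hη he using h
  have ext {Z Z' : Scheme.{u}} (z : Z ⟶ X) (z' : Z' ⟶ X) [IsOpenImmersion z] [IsOpenImmersion z']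
      (s : T ⟶ Z) (s' : T ⟶ Z') [IsDominant s] (hs : s ≫ z = η) (hs' : s' ≫ z' = η)
      (n : Z ⟶ Y) (n' : Z' ⟶ Y) (hn : s ≫ n = e) (hn' : s' ≫ n' = e) :
      pullback.fst z z' ≫ n = pullback.snd z z' ≫ n' := by
    let τ : T ⟶ pullback z z' := pullback.lift s s' (hs.trans hs'.symm)
    have h1 : τ ≫ pullback.fst z z' = s := pullback.lift_fst _ _ _
    have h2 : τ ≫ pullback.snd z z' = s' := pullback.lift_snd _ _ _
    have : IsDominant (τ ≫ pullback.fst z z') := h1 ▸ inferInstance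
    have : IsDominant τ := .of_comp_of_isOpenImmersion τ (pullback.fst z z')
    have : IsReduced (pullback z z') := isReduced_of_isOpenImmersion (pullback.fst z z' ≫ z)
    refine ext_of_isDominant (ι := τ) ?_
    rw [reassoc_of% h1, reassoc_of% h2, hn, hn']
  let 𝒰 := coverOfPoints W w hw hx
  have hglue (x y : X) : pullback.fst (w x) (w y) ≫ m x = pullback.snd (w x) (w y) ≫ m y := by
    have := hw x
    have := hw y
    have := ht x
    exact ext (w x) (w y) (t x) (t y) (hη x) (hη y) (m x) (m y) (he x) (he y)
  refine ⟨Scheme.Cover.glueMorphisms 𝒰 m hglue, fun Z z s n hz hs hsη hn ↦ ?_⟩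
  refine Scheme.Cover.hom_ext (Precoverage.ZeroHypercover.pullback₁ z 𝒰) _ _ fun x ↦ ?_
  have := hw x
  have h1 : pullback.fst z (w x) ≫ z ≫ Scheme.Cover.glueMorphisms 𝒰 m hglue =
      pullback.snd z (w x) ≫ m x := by
    rw [pullback.condition_assoc]
    exact congrArg _ (Scheme.Cover.ι_glueMorphisms 𝒰 m hglue x)
  exact h1.trans (ext z (w x) s (t x) hsη (hη x) n (m x) hn (he x)).symm

/-- Every point of a scheme has an affine open neighbourhood inside a given open neighbourhood. -/
lemma exists_affine_nhd {T : Scheme.{u}} (x : T) (W : T.Opens) (hx : x ∈ W) :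
    ∃ (A : CommRingCat.{u}) (w : Spec A ⟶ T), IsOpenImmersion w ∧ x ∈ Set.range w ∧
      Set.range w ⊆ W := by
  obtain ⟨_, ⟨U, hU, rfl⟩, hxU, hUW⟩ := T.isBasis_affineOpens.exists_subset_of_mem_open hx W.2
  refine ⟨_, IsAffineOpen.fromSpec hU, hU.isOpenImmersion_fromSpec, ?_, ?_⟩
  · rwa [hU.range_fromSpec]
  · rwa [hU.range_fromSpec]

end Gluing

/-! ### Ideal sheaves on affine charts -/

section Invertible

/-- The ideal of `A` corresponding to an ideal sheaf on `Spec A`. -/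
def specIdeal {A : CommRingCat.{u}} (J : (Spec A).IdealSheafData) : Ideal A :=
  (J.ideal ⟨⊤, isAffineOpen_top _⟩).comap (Scheme.ΓSpecIso A).inv.hom

lemma bijective_ΓSpecIso_inv (A : CommRingCat.{u}) :
    Function.Bijective (Scheme.ΓSpecIso A).inv.hom :=
  ConcreteCategory.bijective_of_isIso (Scheme.ΓSpecIso A).inv

lemma specIdeal_le_iff {A : CommRingCat.{u}} {J J' : (Spec A).IdealSheafData} :
    specIdeal J ≤ specIdeal J' ↔ J ≤ J' := by
  refine ⟨fun h ↦ Scheme.IdealSheafData.le_of_isAffine ?_, fun h ↦ Ideal.comap_mono (h _)⟩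
  have := Ideal.map_mono (f := (Scheme.ΓSpecIso A).inv.hom) h
  rwa [specIdeal, specIdeal, Ideal.map_comap_of_surjective _ (bijective_ΓSpecIso_inv A).2,
    Ideal.map_comap_of_surjective _ (bijective_ΓSpecIso_inv A).2] at this

lemma exists_specIdeal_eq {A : CommRingCat.{u}} (I : Ideal A) :
    ∃ J : (Spec A).IdealSheafData, specIdeal J = I :=
  ⟨.ofIdealTop (I.map (Scheme.ΓSpecIso A).inv.hom), by
    rw [specIdeal, Scheme.IdealSheafData.ofIdealTop_ideal]
    simpa using Ideal.comap_map_of_bijective _ (bijective_ΓSpecIso_inv A)⟩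

lemma specIdeal_bot (A : CommRingCat.{u}) : specIdeal (⊥ : (Spec A).IdealSheafData) = ⊥ := by
  rw [specIdeal, Scheme.IdealSheafData.ideal_bot]
  exact (RingHom.injective_iff_ker_eq_bot _).mp (bijective_ΓSpecIso_inv A).1

lemma specIdeal_top (A : CommRingCat.{u}) : specIdeal (⊤ : (Spec A).IdealSheafData) = ⊤ := by
  rw [specIdeal, Scheme.IdealSheafData.ideal_top]
  exact Ideal.comap_top

lemma specIdeal_map {A B : CommRingCat.{u}} (φ : A ⟶ B) (J : (Spec B).IdealSheafData) :
    specIdeal (J.map (Spec.map φ)) = (specIdeal J).comap φ.hom := by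
  rw [specIdeal, specIdeal, Scheme.IdealSheafData.ideal_map_of_isAffineHom, Ideal.comap_comap,
    Ideal.comap_comap, ← CommRingCat.hom_comp, ← CommRingCat.hom_comp]
  congr 2
  exact (Scheme.ΓSpecIso_inv_naturality φ).symm

lemma specIdeal_comap {A B : CommRingCat.{u}} (φ : A ⟶ B) (J : (Spec A).IdealSheafData) :
    specIdeal (J.comap (Spec.map φ)) = (specIdeal J).map φ.hom := by
  refine eq_of_forall_ge_iff fun I ↦ ?_
  obtain ⟨J', rfl⟩ := exists_specIdeal_eq I
  rw [specIdeal_le_iff, ← Scheme.IdealSheafData.le_map_iff_comap_le, ← specIdeal_le_iff,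
    specIdeal_map, Ideal.map_le_iff_le_comap]

lemma specIdeal_ker {A B : CommRingCat.{u}} (φ : A ⟶ B) :
    specIdeal (Spec.map φ).ker = RingHom.ker φ.hom := by
  rw [← Scheme.IdealSheafData.map_bot, specIdeal_map, specIdeal_bot]
  rfl

/-- Kernels of quasi-compact morphisms can be computed on open subsets of the target. -/
lemma comap_ker_of_isPullback {X Y U V : Scheme.{u}} {f : X ⟶ Y} {f' : U ⟶ V} {iU : U ⟶ X}
    {iV : V ⟶ Y} [IsOpenImmersion iV] [QuasiCompact f] (H : IsPullback f' iU iV f) :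
    f.ker.comap iV = f'.ker := by
  ext W : 2
  rw [Scheme.ker_ideal_of_isPullback_of_isOpenImmersion f f' iU iV H,
    Scheme.IdealSheafData.ideal_comap_of_isOpenImmersion]

/-- An ideal generated by one nonzerodivisor. -/
def IsNzdPrincipal {A : Type u} [CommRing A] (I : Ideal A) : Prop :=
  ∃ t ∈ A⁰, I = Ideal.span {t}

lemma isNzdPrincipal_comap_iff {A B : Type u} [CommRing A] [CommRing B] (e : A ≃+* B)
    (I : Ideal B) : IsNzdPrincipal (I.comap (e : A →+* B)) ↔ IsNzdPrincipal I := by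
  constructor
  · rintro ⟨t, ht, h⟩
    refine ⟨e t, mem_nonZeroDivisors_of_injective e.symm.injective (by simpa using ht), ?_⟩
    have := congrArg (Ideal.map (e : A →+* B)) h
    rw [Ideal.map_comap_of_surjective (e : A →+* B) e.surjective, Ideal.map_span] at this
    simpa using this
  · rintro ⟨t, ht, rfl⟩
    refine ⟨e.symm t, mem_nonZeroDivisors_of_injective e.injective (by simpa using ht), ?_⟩
    rw [← Ideal.comap_map_of_bijective (e : A →+* B) e.bijective (I := Ideal.span {e.symm t}),
      Ideal.map_span]
    simp

lemma isNzdPrincipal_specIdeal_comap_iff {T : Scheme.{u}} (J : T.IdealSheafData)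
    {A : CommRingCat.{u}} (w : Spec A ⟶ T) [IsOpenImmersion w] (U : T.affineOpens)
    (hU : (U : Set T) = Set.range w) :
    IsNzdPrincipal (specIdeal (J.comap w)) ↔ IsNzdPrincipal (J.ideal U) := by
  obtain rfl : U = ⟨w ''ᵁ ⊤, (isAffineOpen_top _).image_of_isOpenImmersion w⟩ := by
    ext : 2
    rw [hU]
    simp
  rw [specIdeal, Scheme.IdealSheafData.ideal_comap_of_isOpenImmersion J w
    ⟨⊤, isAffineOpen_top _⟩, Ideal.comap_comap]
  let e : A ≅ Γ(T, w ''ᵁ ⊤) := (Scheme.ΓSpecIso A).symm ≪≫ (w.appIso ⊤).symm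
  exact isNzdPrincipal_comap_iff e.commRingCatIsoToRingEquiv _

lemma IsNzdPrincipal.map_localization {A B : Type u} [CommRing A] [CommRing B] [Algebra A B]
    (M : Submonoid A) [IsLocalization M B] {I : Ideal A} (hI : IsNzdPrincipal I) :
    IsNzdPrincipal (I.map (algebraMap A B)) := by
  obtain ⟨t, ht, rfl⟩ := hI
  refine ⟨algebraMap A B t, ?_, by rw [Ideal.map_span, Set.image_singleton]⟩
  exact IsLocalization.map_nonZeroDivisors_le M B (Submonoid.mem_map_of_mem _ ht)

lemma exists_basicOpen_nhd {A : CommRingCat.{u}} (y : Spec A) (W : (Spec A).Opens) (hy : y ∈ W) :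
    ∃ a : A, y ∈ Set.range (Spec.map (CommRingCat.ofHom (algebraMap A (Localization.Away a)))) ∧
      Set.range (Spec.map (CommRingCat.ofHom (algebraMap A (Localization.Away a)))) ⊆ W := by
  obtain ⟨_, ⟨a, rfl⟩, ha, haW⟩ :=
    PrimeSpectrum.isTopologicalBasis_basic_opens.exists_subset_of_mem_open hy W.2
  have := PrimeSpectrum.localization_away_comap_range (Localization.Away a) a
  refine ⟨a, ?_, ?_⟩
  · exact this.ge ha
  · exact this.le.trans haW

/-- An invertible ideal sheaf is generated by one nonzerodivisor on arbitrarily small affine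
charts. -/
lemma IsInvertible.exists_chart {T : Scheme.{u}} {J : T.IdealSheafData} (hJ : IsInvertible J)
    (x : T) (W : T.Opens) (hx : x ∈ W) :
    ∃ (A : CommRingCat.{u}) (w : Spec A ⟶ T), IsOpenImmersion w ∧ x ∈ Set.range w ∧
      Set.range w ⊆ W ∧ IsNzdPrincipal (specIdeal (J.comap w)) := by
  obtain ⟨⟨U, hUa⟩, hxU, hU⟩ := hJ x
  replace hUa : IsAffineOpen U := hUa
  have := hUa.isOpenImmersion_fromSpec
  have hU' : IsNzdPrincipal (specIdeal (J.comap hUa.fromSpec)) :=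
    (isNzdPrincipal_specIdeal_comap_iff J _ ⟨U, hUa⟩ hUa.range_fromSpec.symm).mpr hU
  obtain ⟨y, rfl⟩ : x ∈ Set.range hUa.fromSpec := by rwa [hUa.range_fromSpec]
  obtain ⟨a, hya, haW⟩ := exists_basicOpen_nhd y (hUa.fromSpec ⁻¹ᵁ W) hx
  have hi : IsOpenImmersion
      (Spec.map (CommRingCat.ofHom (algebraMap Γ(T, U) (Localization.Away a)))) :=
    IsOpenImmersion.of_isLocalization a
  refine ⟨_, Spec.map (CommRingCat.ofHom (algebraMap Γ(T, U) (Localization.Away a))) ≫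
    hUa.fromSpec, inferInstance, ?_, ?_, ?_⟩
  · obtain ⟨z, hz⟩ := hya
    exact ⟨z, by simp [hz]⟩
  · rintro _ ⟨z, rfl⟩
    simpa using haW ⟨z, rfl⟩
  · rw [Scheme.IdealSheafData.comap_comp, specIdeal_comap]
    exact hU'.map_localization (.powers a)

lemma isInvertible_of_charts {T : Scheme.{u}} {J : T.IdealSheafData}
    (h : ∀ x : T, ∃ (A : CommRingCat.{u}) (w : Spec A ⟶ T), IsOpenImmersion w ∧ x ∈ Set.range w ∧
      IsNzdPrincipal (specIdeal (J.comap w))) : IsInvertible J := by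
  intro x
  obtain ⟨A, w, hw, hx, h⟩ := h x
  refine ⟨⟨w.opensRange, isAffineOpen_opensRange w⟩, hx, ?_⟩
  exact (isNzdPrincipal_specIdeal_comap_iff J w _ rfl).mp h

lemma IsInvertible.comap_of_isOpenImmersion {T T' : Scheme.{u}} {J : T.IdealSheafData}
    (hJ : IsInvertible J) (w : T' ⟶ T) [IsOpenImmersion w] : IsInvertible (J.comap w) := by
  refine isInvertible_of_charts fun x ↦ ?_
  obtain ⟨A, v, hv, hxv, hvW, h⟩ := hJ.exists_chart (w x) w.opensRange ⟨x, rfl⟩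
  have hl := IsOpenImmersion.lift_fac w v hvW
  have : IsOpenImmersion (IsOpenImmersion.lift w v hvW ≫ w) := by rwa [hl]
  have : IsOpenImmersion (IsOpenImmersion.lift w v hvW) := .of_comp _ w
  refine ⟨A, IsOpenImmersion.lift w v hvW, this, ?_, ?_⟩
  · obtain ⟨y, hy⟩ := hxv
    refine ⟨y, w.isOpenEmbedding.injective ?_⟩
    rw [← hy, ← Scheme.Hom.comp_apply, hl]
  · rwa [← Scheme.IdealSheafData.comap_comp, hl]

end Invertible

/-! ### Local coordinates on the projective line -/

section LocalCoordinates

variable {R : Type u} [CommRing R]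

instance : (P1 R).IsSeparated := inferInstanceAs (Proj (grading R)).IsSeparated

instance : IsSeparated (P1.toSpec R) := by
  have : IsSeparated (P1.toSpec R ≫ terminal.from _) := by
    rw [terminal.comp_from]
    infer_instance
  exact IsSeparated.of_comp _ (terminal.from _)

lemma exists_eq_SpecMap_aeval {A : CommRingCat.{u}} (l : Spec A ⟶ Spec (.of R[X])) :
    ∃ (_ : Algebra R A) (a : A), l = Spec.map (CommRingCat.ofHom (aeval (R := R) a).toRingHom) := by
  let φ := (Spec.preimage l).hom
  let _ : Algebra R A := (φ.comp C).toAlgebra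
  refine ⟨inferInstance, φ X, ?_⟩
  rw [← Spec.map_preimage l]
  congr 1
  refine CommRingCat.hom_ext (Polynomial.ringHom_ext (f := φ)
    (fun a ↦ (aeval_C (φ X) a).symm) (aeval_X (φ X)).symm)

lemma exists_eq_point_one_right {A : CommRingCat.{u}} (g : Spec A ⟶ P1 R)
    (h : Set.range g ⊆ Set.range (P1.chart R)) :
    ∃ (_ : Algebra R A) (a : A), g = P1.point R a 1 isCoprime_one_right := by
  obtain ⟨i, a, ha⟩ := exists_eq_SpecMap_aeval (IsOpenImmersion.lift (P1.chart R) g h)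
  exact ⟨i, a, by rw [point_one_right, ← ha, IsOpenImmersion.lift_fac]⟩

lemma exists_eq_point_one_left {A : CommRingCat.{u}} (g : Spec A ⟶ P1 R)
    (h : Set.range g ⊆ Set.range (P1.chartInfty R)) :
    ∃ (_ : Algebra R A) (a : A), g = P1.point R 1 a isCoprime_one_left := by
  obtain ⟨i, a, ha⟩ := exists_eq_SpecMap_aeval (IsOpenImmersion.lift (P1.chartInfty R) g h)
  exact ⟨i, a, by rw [point_one_left, ← ha, IsOpenImmersion.lift_fac]⟩

lemma mem_range_chart_or (x : P1 R) :
    x ∈ (P1.chart R).opensRange ∨ x ∈ (P1.chartInfty R).opensRange := by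
  have : x ∈ (P1.chart R).opensRange ⊔ (P1.chartInfty R).opensRange := by
    rw [opensRange_chart_sup_chartInfty]
    trivial
  exact this

end LocalCoordinates

/-! ### The centre of the blow-up -/

section Centre

variable (R : Type u) [CommRing R] [IsLocalRing R]

lemma zeroPoint_eq : P1.zeroPoint R = Spec.map (CommRingCat.ofHom
    (aeval (R := R) (0 : IsLocalRing.ResidueField R)).toRingHom) ≫ P1.chart R :=
  point_one_right _

lemma comap_chart_ker_zeroPoint : (P1.zeroPoint R).ker.comap (P1.chart R) =
    (Spec.map (CommRingCat.ofHom
      (aeval (R := R) (0 : IsLocalRing.ResidueField R)).toRingHom)).ker := by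
  refine comap_ker_of_isPullback (iU := 𝟙 _) ?_
  rw [zeroPoint_eq]
  exact (IsPullback.of_horiz_isIso_mono ⟨Category.id_comp _⟩).flip

lemma comap_chartInfty_ker_zeroPoint : (P1.zeroPoint R).ker.comap (P1.chartInfty R) = ⊤ := by
  rw [comap_ker_of_isPullback (IsPullback.of_hasPullback (P1.chartInfty R) (P1.zeroPoint R))]
  have : IsEmpty ↥(pullback (P1.chartInfty R) (P1.zeroPoint R)) := by
    refine ⟨fun y ↦ ?_⟩
    have h1 : P1.zeroPoint R (pullback.snd (P1.chartInfty R) (P1.zeroPoint R) y) ∈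
        (P1.chartInfty R).opensRange := by
      rw [← Scheme.Hom.comp_apply, ← pullback.condition, Scheme.Hom.comp_apply]
      exact ⟨_, rfl⟩
    rw [opensRange_chartInfty] at h1
    have h2 := (point_preimage_basicOpenX (R := R) (A := IsLocalRing.ResidueField R) 0 1
      isCoprime_one_right 0).le h1
    exact h2 (by simp)
  exact Scheme.ker_eq_top_of_isEmpty _

lemma ker_aeval_zero_residueField :
    RingHom.ker (aeval (R := R) (0 : IsLocalRing.ResidueField R)).toRingHom =
      Ideal.span {X} ⊔ (IsLocalRing.maximalIdeal R).map C := by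
  refine le_antisymm (fun f hf ↦ ?_) (sup_le ?_ ?_)
  · have h0 : f.coeff 0 ∈ IsLocalRing.maximalIdeal R := by
      have h1 : aeval (R := R) (0 : IsLocalRing.ResidueField R) f = 0 := hf
      rw [← coeff_zero_eq_aeval_zero'] at h1
      exact (IsLocalRing.residue_eq_zero_iff _).mp h1
    rw [← X_mul_divX_add f]
    exact Ideal.add_mem _
      (Ideal.mul_mem_right _ _ (Ideal.mem_sup_left (Ideal.mem_span_singleton_self X)))
      (Ideal.mem_sup_right (Ideal.mem_map_of_mem _ h0))
  · rw [Ideal.span_singleton_le_iff_mem]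
    exact aeval_X _
  · rw [Ideal.map_le_iff_le_comap]
    intro a ha
    exact (aeval_C _ a).trans ((IsLocalRing.residue_eq_zero_iff a).mpr ha)

variable {R} {A : Type u} [CommRing A] [Algebra R A]

lemma specIdeal_comap_point_one_right (a : A) :
    specIdeal ((P1.zeroPoint R).ker.comap (P1.point R a 1 isCoprime_one_right)) =
      Ideal.span {a} ⊔ (IsLocalRing.maximalIdeal R).map (algebraMap R A) := by
  rw [point_one_right, Scheme.IdealSheafData.comap_comp, specIdeal_comap,
    comap_chart_ker_zeroPoint, specIdeal_ker]
  refine (congrArg _ (ker_aeval_zero_residueField R)).trans ?_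
  rw [Ideal.map_sup, Ideal.map_span, Ideal.map_map]
  congr 2
  · rw [Set.image_singleton]
    exact congrArg (fun x ↦ ({x} : Set A)) (aeval_X a)
  · exact RingHom.ext fun r ↦ aeval_C a r

lemma specIdeal_comap_point_one_left (b : A) :
    specIdeal ((P1.zeroPoint R).ker.comap (P1.point R 1 b isCoprime_one_left)) = ⊤ := by
  rw [point_one_left, Scheme.IdealSheafData.comap_comp, comap_chartInfty_ker_zeroPoint,
    Scheme.IdealSheafData.comap_top, specIdeal_top]

end Centre

/-! ### The coordinate ring at the node -/

section NodeRing

variable {R : Type u} [CommRing R]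

/-- The coordinate ring `R[x, y] / (x y - π)` of the chart of the blow-up that contains the node
of the special fibre. -/
abbrev NodeRing (π : R) : Type u := AdjoinRoot (C X * X - C (C π) : R[X][X])

namespace NodeRing

variable (π : R)

/-- The coordinate `x` of `R[x, y] / (x y - π)`. -/
def x : NodeRing π := AdjoinRoot.of _ X

/-- The coordinate `y` of `R[x, y] / (x y - π)`. -/
def y : NodeRing π := AdjoinRoot.root _

lemma x_mul_y : x π * y π = algebraMap R _ π := by
  have h := AdjoinRoot.eval₂_root (C X * X - C (C π) : R[X][X])
  simp only [eval₂_sub, eval₂_mul, eval₂_C, eval₂_X] at h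
  exact sub_eq_zero.mp h

variable {π}

/-- The homomorphism `R[x, y] / (x y - π) → A` with `x ↦ a`, `y ↦ b`. -/
def lift {A : Type u} [CommRing A] [Algebra R A] (a b : A) (h : a * b = algebraMap R A π) :
    NodeRing π →ₐ[R] A :=
  AdjoinRoot.liftAlgHom _ (aeval a) b (by simp [eval₂_mul, h])

section lift

variable {A : Type u} [CommRing A] [Algebra R A] (a b : A) (h : a * b = algebraMap R A π)

@[simp] lemma lift_x : lift a b h (x π) = a := by
  simp [lift, x]

@[simp] lemma lift_y : lift a b h (y π) = b := by
  simp [lift, y]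

end lift

variable (π)

lemma adjoin_eq_top : Algebra.adjoin R {x π, y π} = ⊤ := by
  refine top_le_iff.mp fun a _ ↦ ?_
  obtain ⟨p, rfl⟩ := AdjoinRoot.mk_surjective a
  have h1 (q : R[X]) : AdjoinRoot.of (C X * X - C (C π) : R[X][X]) q ∈
      Algebra.adjoin R {x π, y π} := by
    have : AdjoinRoot.of (C X * X - C (C π) : R[X][X]) q = aeval (x π) q := by
      have : AdjoinRoot.ofAlgHom R (C X * X - C (C π) : R[X][X]) = aeval (x π) := by
        ext
        simp [x]
      exact congr($this q)
    rw [this, aeval_eq_sum_range]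
    exact sum_mem fun i _ ↦ Subalgebra.smul_mem _
      (pow_mem (Algebra.subset_adjoin (Set.mem_insert _ _)) _) _
  induction p using Polynomial.induction_on' with
  | add p q hp hq =>
    rw [map_add]
    exact add_mem (hp trivial) (hq trivial)
  | monomial k q =>
    rw [← C_mul_X_pow_eq_monomial, map_mul, map_pow, AdjoinRoot.mk_C, AdjoinRoot.mk_X]
    have hy : AdjoinRoot.root (C X * X - C (C π) : R[X][X]) = y π := rfl
    have hy' : y π ∈ Algebra.adjoin R {x π, y π} :=
      Algebra.subset_adjoin (Set.mem_insert_of_mem _ rfl)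
    rw [hy]
    exact mul_mem (h1 q) (pow_mem hy' k)

lemma exists_x_pow_mul_eq (a : NodeRing π) :
    ∃ (n : ℕ) (p : R[X]), x π ^ n * a = AdjoinRoot.of _ p := by
  obtain ⟨f, rfl⟩ := AdjoinRoot.mk_surjective a
  induction f using Polynomial.induction_on' with
  | add f g hf hg =>
    obtain ⟨n, p, hp⟩ := hf
    obtain ⟨m, q, hq⟩ := hg
    refine ⟨n + m, X ^ m * p + X ^ n * q, ?_⟩
    have hx : AdjoinRoot.of (C X * X - C (C π) : R[X][X]) X = x π := rfl
    rw [map_add, map_add, map_mul, map_mul, map_pow, map_pow, ← hp, ← hq, hx]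
    ring
  | monomial k q =>
    refine ⟨k, q * C π ^ k, ?_⟩
    rw [← C_mul_X_pow_eq_monomial, map_mul, map_pow, AdjoinRoot.mk_C, AdjoinRoot.mk_X, map_mul,
      map_pow]
    have : AdjoinRoot.of (C X * X - C (C π) : R[X][X]) (C π) = x π * y π := (x_mul_y π).symm
    rw [this]
    have hy : AdjoinRoot.root (C X * X - C (C π) : R[X][X]) = y π := rfl
    rw [hy]
    ring

variable [IsDomain R] {π} (hπ : π ≠ 0)
include hπ

lemma eq_zero_of_x_mul_eq_zero (a : NodeRing π) (h : x π * a = 0) : a = 0 := by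
  obtain ⟨f, rfl⟩ := AdjoinRoot.mk_surjective a
  have h' : AdjoinRoot.mk (C X * X - C (C π) : R[X][X]) (C X * f) = 0 := by
    rw [map_mul, AdjoinRoot.mk_C]
    exact h
  rw [AdjoinRoot.mk_eq_zero] at h' ⊢
  obtain ⟨g, hg⟩ := h'
  have hg0 : g.map (evalRingHom 0) = 0 := by
    have := congrArg (Polynomial.map (evalRingHom 0)) hg
    simp only [Polynomial.map_mul, Polynomial.map_sub, map_C, coe_evalRingHom, eval_X, eval_C,
      C_0, zero_mul, map_X, zero_sub] at this
    simpa [hπ] using this.symm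
  have hXg : (C X : R[X][X]) ∣ g := by
    rw [C_dvd_iff_dvd_coeff]
    intro i
    rw [X_dvd_iff, coeff_zero_eq_eval_zero]
    have := congrArg (fun p ↦ coeff p i) hg0
    simpa using this
  obtain ⟨g', rfl⟩ := hXg
  refine ⟨g', ?_⟩
  have hC : (C X : R[X][X]) ≠ 0 := by simp
  apply mul_left_cancel₀ hC
  rw [hg]
  ring

lemma lift_injective {L : Type u} [Field L] [Algebra R[X] L] [IsFractionRing R[X] L] [Algebra R L]
    [IsScalarTower R R[X] L] (b : L) (h : algebraMap R[X] L X * b = algebraMap R L π) :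
    Function.Injective (lift (algebraMap R[X] L X) b h) := by
  rw [injective_iff_map_eq_zero]
  intro a ha
  obtain ⟨n, p, hp⟩ := exists_x_pow_mul_eq π a
  have h1 : lift (algebraMap R[X] L X) b h (AdjoinRoot.of _ p) = algebraMap R[X] L p := by
    have : (lift (algebraMap R[X] L X) b h).comp
        (AdjoinRoot.ofAlgHom R (C X * X - C (C π) : R[X][X])) =
        IsScalarTower.toAlgHom R R[X] L := by
      ext
      exact lift_x _ _ h
    exact congr($this p)
  have h2 : p = 0 := by
    apply IsFractionRing.injective R[X] L
    rw [← h1, ← hp, map_mul, ha, mul_zero, map_zero]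
  rw [h2, map_zero] at hp
  clear h1
  induction n with
  | zero => simpa using hp
  | succ n ih =>
    apply ih
    apply eq_zero_of_x_mul_eq_zero hπ
    rw [← hp]
    ring

end NodeRing

end NodeRing

/-! ### Charts of a scheme-theoretic image -/

section ImageCharts

/-- If the restriction of `g : T ⟶ Q` to an open `w : W ⟶ Q` factors through a closed subscheme
`i : Z ⟶ W` with the same kernel, then `Z` is the restriction to `W` of the
scheme-theoretic image of `g`. -/
lemma exists_isPullback_imageι {T Q W Z : Scheme.{u}} (g : T ⟶ Q) [QuasiCompact g] (w : W ⟶ Q)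
    [IsOpenImmersion w] (i : Z ⟶ W) [IsClosedImmersion i] (d : T ⟶ Z) (hd : d.ker = ⊥)
    (h : d ≫ i ≫ w = g) : ∃ c : Z ⟶ g.image, IsPullback i c w g.imageι := by
  have hg : g.ker.comap w = i.ker := by
    rw [comap_ker_of_isPullback (f' := d ≫ i) (iU := 𝟙 _), Scheme.Hom.ker_comp, hd,
      Scheme.IdealSheafData.map_bot]
    exact (IsPullback.of_horiz_isIso_mono ⟨by simp [h]⟩).flip
  have hk : g.imageι.ker ≤ (i ≫ w).ker := by
    rw [g.ker.ker_subschemeι, Scheme.Hom.ker_comp, Scheme.IdealSheafData.le_map_iff_comap_le, hg]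
  refine ⟨IsClosedImmersion.lift g.imageι (i ≫ w) hk,
    isPullback_of_isClosedImmersion _ _ _ _ ?_ ?_⟩
  · rw [IsClosedImmersion.lift_fac]
  · rw [g.ker.ker_subschemeι, hg]

lemma ker_SpecMap_eq_bot {A B : CommRingCat.{u}} (φ : A ⟶ B) (hφ : Function.Injective φ.hom) :
    (Spec.map φ).ker = ⊥ := by
  rw [← le_bot_iff, ← specIdeal_le_iff, specIdeal_ker, specIdeal_bot,
    (RingHom.injective_iff_ker_eq_bot _).mp hφ]

variable {R : Type u} [CommRing R] {A : Type u} [CommRing A] [Algebra R A]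

/-- The closed immersion of `Spec A` in the affine plane given by two generators of the
`R`-algebra `A`. -/
lemma isClosedImmersion_lift_of_adjoin_eq_top (a b : A) (h : Algebra.adjoin R {a, b} = ⊤)
    (e : Spec.map (CommRingCat.ofHom (aeval (R := R) a).toRingHom) ≫
        Spec.map (CommRingCat.ofHom (algebraMap R R[X])) =
      Spec.map (CommRingCat.ofHom (aeval (R := R) b).toRingHom) ≫
        Spec.map (CommRingCat.ofHom (algebraMap R R[X]))) :
    IsClosedImmersion (pullback.lift (Spec.map (CommRingCat.ofHom (aeval (R := R) a).toRingHom))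
      (Spec.map (CommRingCat.ofHom (aeval (R := R) b).toRingHom)) e) := by
  let φ : TensorProduct R R[X] R[X] →ₐ[R] A := Algebra.TensorProduct.productMap (aeval a) (aeval b)
  have hφ : Function.Surjective φ := by
    rw [← AlgHom.range_eq_top, ← top_le_iff, ← h, Algebra.adjoin_le_iff]
    rintro _ (rfl | rfl)
    · exact ⟨X ⊗ₜ 1, by simp [φ]⟩
    · exact ⟨1 ⊗ₜ X, by simp [φ]⟩
  have : IsClosedImmersion (Spec.map (CommRingCat.ofHom φ.toRingHom)) :=
    IsClosedImmersion.spec_of_surjective _ hφ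
  have : pullback.lift (Spec.map (CommRingCat.ofHom (aeval (R := R) a).toRingHom))
      (Spec.map (CommRingCat.ofHom (aeval (R := R) b).toRingHom)) e =
      Spec.map (CommRingCat.ofHom φ.toRingHom) ≫ (pullbackSpecIso R R[X] R[X]).inv := by
    apply pullback.hom_ext
    · rw [pullback.lift_fst, Category.assoc, pullbackSpecIso_inv_fst, ← Spec.map_comp,
        ← CommRingCat.ofHom_comp]
      congr 2
      exact RingHom.ext fun x ↦ by simp [φ]
    · rw [pullback.lift_snd, Category.assoc, pullbackSpecIso_inv_snd, ← Spec.map_comp,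
        ← CommRingCat.ofHom_comp]
      congr 2
      exact RingHom.ext fun x ↦ by simp [φ]
  rw [this]
  infer_instance

/-- The charts of the scheme-theoretic image of a point of `ℙ¹ × ℙ¹` with values in an extension
`L` of `R`, where `χ` and `χ'` are affine charts of `ℙ¹`. -/
lemma exists_image_chart {L : Type u} [CommRing L] [Algebra R L] (χ χ' : Spec (.of R[X]) ⟶ P1 R)
    [IsOpenImmersion χ] [IsOpenImmersion χ']
    (hχ : χ ≫ P1.toSpec R = Spec.map (CommRingCat.ofHom (algebraMap R R[X])))
    (hχ' : χ' ≫ P1.toSpec R = Spec.map (CommRingCat.ofHom (algebraMap R R[X])))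
    (g : Spec (.of L) ⟶ pullback (P1.toSpec R) (P1.toSpec R)) [QuasiCompact g] (a b : A)
    (h : Algebra.adjoin R {a, b} = ⊤) (ψ : A →ₐ[R] L) (hψ : Function.Injective ψ)
    (hg : g ≫ pullback.fst _ _ =
      Spec.map (CommRingCat.ofHom (aeval (R := R) (ψ a)).toRingHom) ≫ χ)
    (hg' : g ≫ pullback.snd _ _ =
      Spec.map (CommRingCat.ofHom (aeval (R := R) (ψ b)).toRingHom) ≫ χ') :
    ∃ c : Spec (.of A) ⟶ g.image, IsOpenImmersion c ∧
      c ≫ g.imageι ≫ pullback.fst _ _ =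
        Spec.map (CommRingCat.ofHom (aeval (R := R) a).toRingHom) ≫ χ ∧
      c ≫ g.imageι ≫ pullback.snd _ _ =
        Spec.map (CommRingCat.ofHom (aeval (R := R) b).toRingHom) ≫ χ' ∧
      ∀ y, (g.imageι ≫ pullback.fst _ _) y ∈ Set.range χ →
        (g.imageι ≫ pullback.snd _ _) y ∈ Set.range χ' → y ∈ Set.range c := by
  have e (a : A) : Spec.map (CommRingCat.ofHom (aeval (R := R) a).toRingHom) ≫
        Spec.map (CommRingCat.ofHom (algebraMap R R[X])) =
      Spec.map (CommRingCat.ofHom (algebraMap R A)) := by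
    rw [← Spec.map_comp, ← CommRingCat.ofHom_comp]
    congr 2
    exact RingHom.ext fun r ↦ aeval_C a r
  let i := pullback.lift _ _ ((e a).trans (e b).symm)
  have : IsClosedImmersion i := isClosedImmersion_lift_of_adjoin_eq_top a b h _
  let w : pullback (Spec.map (CommRingCat.ofHom (algebraMap R R[X])))
      (Spec.map (CommRingCat.ofHom (algebraMap R R[X]))) ⟶ pullback (P1.toSpec R) (P1.toSpec R) :=
    pullback.map _ _ _ _ χ χ' (𝟙 _) (by rw [hχ, Category.comp_id]) (by rw [hχ', Category.comp_id])
  have : IsOpenImmersion w := inferInstance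
  have hcomp (a : A) : Spec.map (CommRingCat.ofHom ψ.toRingHom) ≫
      Spec.map (CommRingCat.ofHom (aeval (R := R) a).toRingHom) =
      Spec.map (CommRingCat.ofHom (aeval (R := R) (ψ a)).toRingHom) := by
    rw [← Spec.map_comp, ← CommRingCat.ofHom_comp]
    congr 2
    exact congrArg AlgHom.toRingHom (aeval_algHom ψ a).symm
  obtain ⟨c, hc⟩ := exists_isPullback_imageι g w i (Spec.map (CommRingCat.ofHom ψ.toRingHom))
    (ker_SpecMap_eq_bot _ hψ) (by
      apply pullback.hom_ext
      · simp only [w, i, Category.assoc, pullback.map, pullback.lift_fst, pullback.lift_fst_assoc]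
        rw [reassoc_of% hcomp a, hg]
      · simp only [w, i, Category.assoc, pullback.map, pullback.lift_snd, pullback.lift_snd_assoc]
        rw [reassoc_of% hcomp b, hg'])
  refine ⟨c, MorphismProperty.of_isPullback hc inferInstance, ?_, ?_, ?_⟩
  · rw [← reassoc_of% hc.w]
    simp only [w, i, pullback.map, pullback.lift_fst, pullback.lift_fst_assoc]
  · rw [← reassoc_of% hc.w]
    simp only [w, i, pullback.map, pullback.lift_snd, pullback.lift_snd_assoc]
  · intro y h1 h2
    have hw : g.imageι y ∈ Set.range w := by
      rw [Scheme.Pullback.range_map]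
      exact ⟨h1, h2⟩
    obtain ⟨v, hv⟩ := hw
    obtain ⟨z, -, hz⟩ := Scheme.exists_preimage_of_isPullback hc v y hv
    exact ⟨z, hz⟩

end ImageCharts

/-! ### The closure of the graph of `z ↦ z / π` -/

section Model

variable {R : Type u} [CommRing R]

/-- The morphism `b : M ⟶ ℙ¹` is covered by the three standard charts of the blow-up of `ℙ¹` in
the ideal `(z, π)`: `c₀` and `c₁` with coordinates `z / π` and `z, π / z` over `z ≠ ∞`, and `c₂`
with coordinate `1 / z` over `z ≠ 0`. -/
structure HasBlowUpCharts (π : R) {M : Scheme.{u}} (b : M ⟶ P1 R) (c₀ : Spec (.of R[X]) ⟶ M)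
    (c₁ : Spec (.of (NodeRing π)) ⟶ M) (c₂ : Spec (.of R[X]) ⟶ M) : Prop where
  isOpenImmersion₀ : IsOpenImmersion c₀
  isOpenImmersion₁ : IsOpenImmersion c₁
  isOpenImmersion₂ : IsOpenImmersion c₂
  comp₀ : c₀ ≫ b = P1.point R (C π * X) 1 isCoprime_one_right
  comp₁ : c₁ ≫ b = P1.point R (NodeRing.x π) 1 isCoprime_one_right
  comp₂ : c₂ ≫ b = P1.point R 1 X isCoprime_one_left
  cover (y : M) : y ∈ Set.range c₀ ∨ y ∈ Set.range c₁ ∨ y ∈ Set.range c₂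

/-- The closure in `ℙ¹ × ℙ¹` of the graph of `z ↦ z / π`, with its charts. -/
lemma exists_model [IsDomain R] {π : R} (hπ : π ≠ 0) : ∃ (M : Scheme.{u}) (b v : M ⟶ P1 R)
    (c₀ : Spec (.of R[X]) ⟶ M) (c₁ : Spec (.of (NodeRing π)) ⟶ M) (c₂ : Spec (.of R[X]) ⟶ M),
    HasBlowUpCharts π b c₀ c₁ c₂ ∧ IsSeparated b ∧
    c₀ ≫ v = P1.point R X 1 isCoprime_one_right ∧
    c₁ ≫ v = P1.point R 1 (NodeRing.y π) isCoprime_one_left ∧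
    c₂ ≫ v = P1.point R 1 (C π * X) isCoprime_one_left ∧
    ∀ (T : Scheme.{u}) (h h' : T ⟶ M), h ≫ b = h' ≫ b → h ≫ v = h' ≫ v → h = h' := by
  let L := FractionRing R[X]
  let z : L := algebraMap R[X] L X
  let ϖ : L := algebraMap R L π
  have hϖ : ϖ ≠ 0 := by
    simpa [ϖ, IsScalarTower.algebraMap_apply R R[X] L] using hπ
  have hz : z ≠ 0 := by simp [z]
  have htz : Transcendental R z :=
    (transcendental_algebraMap_iff (IsFractionRing.injective R[X] L)).mpr
      (Polynomial.transcendental_X R)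
  let g : Spec (.of L) ⟶ pullback (P1.toSpec R) (P1.toSpec R) :=
    pullback.lift (P1.point R z 1 isCoprime_one_right) (P1.point R (z / ϖ) 1 isCoprime_one_right)
      (by rw [point_toSpec, point_toSpec])
  have hg : g ≫ pullback.fst _ _ = P1.point R z 1 isCoprime_one_right := pullback.lift_fst _ _ _
  have hg' : g ≫ pullback.snd _ _ = P1.point R (z / ϖ) 1 isCoprime_one_right :=
    pullback.lift_snd _ _ _
  have hinv (w w' : L) (h : w * w' = 1) : P1.point R w 1 isCoprime_one_right =
      P1.point R 1 w' isCoprime_one_left := point_eq_of_mul_eq_mul _ _ (by rw [h, one_mul])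
  have hχ : P1.chart R ≫ P1.toSpec R = Spec.map (CommRingCat.ofHom (algebraMap R R[X])) :=
    point_toSpec _ _ _
  have hχ' : P1.chartInfty R ≫ P1.toSpec R = Spec.map (CommRingCat.ofHom (algebraMap R R[X])) :=
    point_toSpec _ _ _
  have hadj (a : R[X]) : Algebra.adjoin R {a, X} = ⊤ := by
    rw [← top_le_iff, ← adjoin_X]
    exact Algebra.adjoin_mono (by simp)
  -- the chart with coordinate `w = z / π`
  obtain ⟨c₀, h₀, hb₀, hv₀, hr₀⟩ := exists_image_chart (P1.chart R) (P1.chart R) hχ hχ g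
    (C π * X) (X : R[X]) (hadj _) (aeval (z / ϖ)) (by
      rw [← transcendental_iff_injective]
      intro h
      refine htz ?_
      have := (isAlgebraic_algebraMap (A := L) π).mul h
      rwa [mul_div_cancel₀ _ hϖ] at this)
    (by rw [hg, ← point_one_right]; congr 1; simp [ϖ, mul_div_cancel₀ _ hϖ])
    (by rw [hg', ← point_one_right]; congr 1; simp)
  -- the chart with coordinates `x = z` and `y = π / z`
  obtain ⟨c₁, h₁, hb₁, hv₁, hr₁⟩ := exists_image_chart (P1.chart R) (P1.chartInfty R) hχ hχ' g
    (NodeRing.x π) (NodeRing.y π) (NodeRing.adjoin_eq_top π)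
    (NodeRing.lift z (ϖ / z) (mul_div_cancel₀ _ hz)) (NodeRing.lift_injective hπ _ _)
    (by rw [hg, ← point_one_right]; congr 1; simp)
    (by
      rw [hg', ← point_one_left]
      refine (hinv _ (ϖ / z) ?_).trans (by congr 1; simp)
      rw [div_mul_div_comm, mul_comm, div_self (mul_ne_zero hϖ hz)])
  -- the chart with coordinate `s = 1 / z`
  obtain ⟨c₂, h₂, hb₂, hv₂, hr₂⟩ := exists_image_chart (P1.chartInfty R) (P1.chartInfty R) hχ' hχ'
    g (X : R[X]) (C π * X) (by rw [Set.pair_comm]; exact hadj _) (aeval z⁻¹) (by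
      rw [← transcendental_iff_injective]
      exact fun h ↦ htz (IsAlgebraic.inv_iff.mp h))
    (by
      rw [hg, ← point_one_left]
      exact (hinv _ z⁻¹ (mul_inv_cancel₀ hz)).trans (by congr 1; simp))
    (by
      rw [hg', ← point_one_left]
      refine (hinv _ (ϖ / z) ?_).trans (by congr 1; simp [ϖ, div_eq_mul_inv])
      rw [div_mul_div_comm, mul_comm, div_self (mul_ne_zero hϖ hz)])
  -- the chart with coordinates `1 / z` and `z / π`, which is contained in the first one
  let s : Set L := {z⁻¹, z / ϖ}
  let a₃ : Algebra.adjoin R s := ⟨z⁻¹, Algebra.subset_adjoin (by simp [s])⟩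
  let b₃ : Algebra.adjoin R s := ⟨z / ϖ, Algebra.subset_adjoin (by simp [s])⟩
  obtain ⟨c₃, h₃, hb₃, hv₃, hr₃⟩ := exists_image_chart (P1.chartInfty R) (P1.chart R) hχ' hχ
    g a₃ b₃ (by
      rw [← Algebra.adjoin_adjoin_coe_preimage (R := R) (s := s)]
      congr 1
      ext t
      simp [s, a₃, b₃, Subtype.ext_iff]) (Algebra.adjoin R s).val Subtype.val_injective
    (by
      rw [hg, ← point_one_left]
      exact (hinv _ z⁻¹ (mul_inv_cancel₀ hz)).trans (by congr 1))
    (by rw [hg', ← point_one_right]; congr 1)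
  rw [← point_one_right] at hb₀ hv₀ hb₁ hv₃
  rw [← point_one_left] at hb₂ hv₂ hv₁ hb₃
  refine ⟨g.image, g.imageι ≫ pullback.fst _ _, g.imageι ≫ pullback.snd _ _, c₀, c₁, c₂,
    ⟨h₀, h₁, h₂, hb₀, hb₁, hb₂, fun y ↦ ?_⟩, inferInstance, hv₀, hv₁, hv₂, fun T h h' e e' ↦ ?_⟩
  · rcases mem_range_chart_or ((g.imageι ≫ pullback.fst _ _) y) with h | h <;>
      rcases mem_range_chart_or ((g.imageι ≫ pullback.snd _ _) y) with h' | h'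
    · exact Or.inl (hr₀ y h h')
    · exact Or.inr (Or.inl (hr₁ y h h'))
    · refine Or.inl (hr₀ y ?_ h')
      obtain ⟨x, rfl⟩ := hr₃ y h h'
      have hu : a₃ * (b₃ * algebraMap R _ π) = 1 := by
        ext
        simp only [a₃, b₃, MulMemClass.coe_mul, OneMemClass.coe_one]
        change z⁻¹ * (z / ϖ * ϖ) = 1
        rw [div_mul_cancel₀ _ hϖ, inv_mul_cancel₀ hz]
      rw [← Scheme.Hom.comp_apply, hb₃, point_right_eq 1 a₃ _ _ hu]
      exact ⟨_, (Scheme.Hom.comp_apply _ _ _).symm⟩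
    · exact Or.inr (Or.inr (hr₂ y h h'))
  · rw [← cancel_mono g.imageι]
    apply pullback.hom_ext
    · simpa using e
    · simpa using e'

end Model

/-! ### The universal property of the blow-up -/

section UniversalProperty

variable {R : Type u} [CommRing R]

/-- An `R`-morphism `Spec A ⟶ M` with image in an affine chart `c` of `M` is given by a
homomorphism of `R`-algebras. -/
lemma exists_SpecMap_comp_eq {A B : Type u} [CommRing A] [Algebra R A] [CommRing B] [Algebra R B]
    {M : Scheme.{u}} (s : M ⟶ Spec (.of R)) (c : Spec (.of B) ⟶ M) [IsOpenImmersion c]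
    (hc : c ≫ s = Spec.map (CommRingCat.ofHom (algebraMap R B))) (f : Spec (.of A) ⟶ M)
    (hf : f ≫ s = Spec.map (CommRingCat.ofHom (algebraMap R A))) (h : Set.range f ⊆ Set.range c) :
    ∃ ψ : B →ₐ[R] A, f = Spec.map (CommRingCat.ofHom ψ.toRingHom) ≫ c := by
  let l := IsOpenImmersion.lift c f h
  have hl : l ≫ c = f := IsOpenImmersion.lift_fac c f h
  have h1 : CommRingCat.ofHom (algebraMap R B) ≫ Spec.preimage l =
      CommRingCat.ofHom (algebraMap R A) := by
    apply Spec.map_injective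
    rw [Spec.map_comp, Spec.map_preimage, ← hc, reassoc_of% hl, hf]
  refine ⟨⟨(Spec.preimage l).hom, fun r ↦ congr(($h1).hom r)⟩, ?_⟩
  exact hl.symm.trans (congrArg (· ≫ c) (Spec.map_preimage l).symm)

variable [IsLocalRing R] {π : R}

/-- At `[1 : b]`, the inverse image of the centre is written in the form `(x, π y)` that it has at
any point `[x : y]`. -/
lemma specIdeal_comap_point_one_left' {A : Type u} [CommRing A] [Algebra R A] (b : A) :
    specIdeal ((P1.zeroPoint R).ker.comap (P1.point R 1 b isCoprime_one_left)) =
      Ideal.span {1, algebraMap R A π * b} := by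
  rw [specIdeal_comap_point_one_left, eq_comm, Ideal.eq_top_iff_one]
  exact Ideal.subset_span (Set.mem_insert _ _)

variable (hm : IsLocalRing.maximalIdeal R = Ideal.span {π})
include hm

lemma specIdeal_comap_point_one_right' {A : Type u} [CommRing A] [Algebra R A] (a : A) :
    specIdeal ((P1.zeroPoint R).ker.comap (P1.point R a 1 isCoprime_one_right)) =
      Ideal.span {a, algebraMap R A π * 1} := by
  rw [specIdeal_comap_point_one_right, hm, Ideal.map_span, Set.image_singleton, mul_one,
    ← Ideal.span_union, Set.singleton_union]

variable {M : Scheme.{u}} {b v : M ⟶ P1 R} {c₀ : Spec (.of R[X]) ⟶ M}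
  {c₁ : Spec (.of (NodeRing π)) ⟶ M} {c₂ : Spec (.of R[X]) ⟶ M}
  (hc : HasBlowUpCharts π b c₀ c₁ c₂)
  (hv₀ : c₀ ≫ v = P1.point R X 1 isCoprime_one_right)
  (hv₁ : c₁ ≫ v = P1.point R 1 (NodeRing.y π) isCoprime_one_left)
  (hv₂ : c₂ ≫ v = P1.point R 1 (C π * X) isCoprime_one_left)
include hc hv₀ hv₁ hv₂

/-- On an open subset of the model that lies in a single chart, the points `b = [x : y]` and
`v = [p : q]` satisfy the equation `x q = π y p` of the graph of `z ↦ z / π`. -/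
lemma exists_coordinates {A : Type u} [CommRing A] [Algebra R A] (f : Spec (.of A) ⟶ M)
    (hf : f ≫ b ≫ P1.toSpec R = Spec.map (CommRingCat.ofHom (algebraMap R A)))
    (hr : Set.range f ⊆ Set.range c₀ ∨ Set.range f ⊆ Set.range c₁ ∨ Set.range f ⊆ Set.range c₂) :
    ∃ (x y p q : A) (h : IsCoprime x y) (h' : IsCoprime p q), f ≫ b = P1.point R x y h ∧
      f ≫ v = P1.point R p q h' ∧ x * q = algebraMap R A π * y * p ∧
      specIdeal ((P1.zeroPoint R).ker.comap (f ≫ b)) = Ideal.span {x, algebraMap R A π * y} := by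
  have := hc.isOpenImmersion₀
  have := hc.isOpenImmersion₁
  have := hc.isOpenImmersion₂
  rcases hr with hr | hr | hr
  · obtain ⟨ψ, rfl⟩ := exists_SpecMap_comp_eq (b ≫ P1.toSpec R) c₀
      (by rw [reassoc_of% hc.comp₀, point_toSpec]) f hf hr
    have e : (Spec.map (CommRingCat.ofHom ψ.toRingHom) ≫ c₀) ≫ b =
        P1.point R (ψ (C π * X)) 1 isCoprime_one_right := by
      rw [Category.assoc, hc.comp₀, SpecMap_point]
      congr 1
      exact map_one ψ
    refine ⟨_, _, ψ X, 1, _, isCoprime_one_right, e, ?_, ?_, ?_⟩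
    · rw [Category.assoc, hv₀, SpecMap_point]
      congr 1
      exact map_one ψ
    · rw [map_mul, mul_one, mul_one, ← ψ.commutes]
      rfl
    · rw [e, specIdeal_comap_point_one_right' hm]
  · obtain ⟨ψ, rfl⟩ := exists_SpecMap_comp_eq (b ≫ P1.toSpec R) c₁
      (by rw [reassoc_of% hc.comp₁, point_toSpec]) f hf hr
    have e : (Spec.map (CommRingCat.ofHom ψ.toRingHom) ≫ c₁) ≫ b =
        P1.point R (ψ (NodeRing.x π)) 1 isCoprime_one_right := by
      rw [Category.assoc, hc.comp₁, SpecMap_point]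
      congr 1
      exact map_one ψ
    refine ⟨_, _, 1, ψ (NodeRing.y π), _, isCoprime_one_left, e, ?_, ?_, ?_⟩
    · rw [Category.assoc, hv₁, SpecMap_point]
      congr 1
      exact map_one ψ
    · rw [← map_mul, NodeRing.x_mul_y, ψ.commutes, mul_one, mul_one]
    · rw [e, specIdeal_comap_point_one_right' hm]
  · obtain ⟨ψ, rfl⟩ := exists_SpecMap_comp_eq (b ≫ P1.toSpec R) c₂
      (by rw [reassoc_of% hc.comp₂, point_toSpec]) f hf hr
    have e : (Spec.map (CommRingCat.ofHom ψ.toRingHom) ≫ c₂) ≫ b =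
        P1.point R 1 (ψ X) isCoprime_one_left := by
      rw [Category.assoc, hc.comp₂, SpecMap_point]
      congr 1
      exact map_one ψ
    refine ⟨_, _, 1, ψ (C π * X), _, isCoprime_one_left, e, ?_, ?_, ?_⟩
    · rw [Category.assoc, hv₂, SpecMap_point]
      congr 1
      exact map_one ψ
    · rw [map_mul, mul_one, one_mul, ← ψ.commutes]
      rfl
    · rw [e, specIdeal_comap_point_one_left']

/-- A morphism to the model is determined by its composition with `b` if the inverse image of
the centre is invertible: where `b = [x : y]`, the ideal `(x, π y)` is generated by a
nonzerodivisor, so the equation `x q = π y p` has at most one solution `[p : q]`. -/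
lemma comp_eq_of_comp_eq {T : Scheme.{u}} (h h' : T ⟶ M) (e : h ≫ b = h' ≫ b)
    (hI : IsInvertible ((P1.zeroPoint R).ker.comap (h ≫ b))) : h ≫ v = h' ≫ v := by
  have := hc.isOpenImmersion₀
  have := hc.isOpenImmersion₁
  have := hc.isOpenImmersion₂
  have hopen (y : M) : ∃ U : M.Opens, y ∈ U ∧
      ((U : Set M) ⊆ Set.range c₀ ∨ (U : Set M) ⊆ Set.range c₁ ∨ (U : Set M) ⊆ Set.range c₂) := by
    rcases hc.cover y with hy | hy | hy
    · exact ⟨c₀.opensRange, hy, Or.inl subset_rfl⟩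
    · exact ⟨c₁.opensRange, hy, Or.inr (Or.inl subset_rfl)⟩
    · exact ⟨c₂.opensRange, hy, Or.inr (Or.inr subset_rfl)⟩
  have key (x : T) : ∃ (A : CommRingCat.{u}) (w : Spec A ⟶ T), IsOpenImmersion w ∧
      x ∈ Set.range w ∧ w ≫ h ≫ v = w ≫ h' ≫ v := by
    obtain ⟨U, hxU, hU⟩ := hopen (h x)
    obtain ⟨U', hxU', hU'⟩ := hopen (h' x)
    obtain ⟨A, w, hw, hx, hwU, hwI⟩ := hI.exists_chart x (h ⁻¹ᵁ U ⊓ h' ⁻¹ᵁ U') ⟨hxU, hxU'⟩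
    refine ⟨A, w, hw, hx, ?_⟩
    have hr : Set.range (w ≫ h) ⊆ U := by
      rintro _ ⟨z, rfl⟩
      rw [Scheme.Hom.comp_apply]
      exact (hwU ⟨z, rfl⟩).1
    have hr' : Set.range (w ≫ h') ⊆ U' := by
      rintro _ ⟨z, rfl⟩
      rw [Scheme.Hom.comp_apply]
      exact (hwU ⟨z, rfl⟩).2
    let _ : Algebra R A := (Spec.preimage (w ≫ h ≫ b ≫ P1.toSpec R)).hom.toAlgebra
    have ha : w ≫ h ≫ b ≫ P1.toSpec R = Spec.map (CommRingCat.ofHom (algebraMap R A)) :=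
      (Spec.map_preimage _).symm
    obtain ⟨x, y, p, q, hxy, hpq, h1, h2, h3, h4⟩ := exists_coordinates hm hc hv₀ hv₁ hv₂ (A := A)
      (w ≫ h) (by simpa using ha)
      (hU.imp (hr.trans ·) (Or.imp (hr.trans ·) (hr.trans ·)))
    obtain ⟨x', y', p', q', hxy', hpq', h1', h2', h3', -⟩ :=
      exists_coordinates hm hc hv₀ hv₁ hv₂ (A := A) (w ≫ h')
      (by rw [Category.assoc, ← reassoc_of% e]; exact ha)
      (hU'.imp (hr'.trans ·) (Or.imp (hr'.trans ·) (hr'.trans ·)))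
    rw [← Category.assoc, ← Category.assoc, h2, h2']
    apply point_eq_of_mul_eq_mul
    have hxx : x * y' = x' * y := mul_eq_mul_of_point_eq (R := R) hxy hxy' (by
      rw [← h1, ← h1', Category.assoc, e, Category.assoc])
    obtain ⟨t, ht, hIt⟩ := hwI
    rw [← Scheme.IdealSheafData.comap_comp, ← Category.assoc, h4] at hIt
    obtain ⟨α, β, hαβ⟩ := hxy'
    have hx : x = x' * (α * x + β * y) := by linear_combination (-x) * hαβ + β * hxx
    have hy : y = y' * (α * x + β * y) := by linear_combination (-y) * hαβ - α * hxx
    have h5 : x * q' = algebraMap R A π * y * p' := by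
      linear_combination (α * x + β * y) * h3' + q' * hx - algebraMap R A π * p' * hy
    obtain ⟨a, d, hat⟩ := Ideal.mem_span_pair.mp (hIt.ge (Ideal.mem_span_singleton_self t))
    have h6 : (p * q' - p' * q) * t = 0 := by
      rw [← hat]
      linear_combination (a * p + d * q) * h5 - (a * p' + d * q') * h3
    exact sub_eq_zero.mp ((mul_right_mem_nonZeroDivisors_eq_zero_iff ht).mp h6)
  choose A w hw hx hwe using key
  exact Scheme.Cover.hom_ext (coverOfPoints (fun x ↦ Spec (A x)) w hw hx) _ _ hwe

omit hv₀ hv₁ hv₂ in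
/-- The inverse image of the centre is generated by `π`, `z` and `1` on the three charts. -/
lemma HasBlowUpCharts.isInvertible_comap [IsDomain R] (hπ : π ≠ 0) :
    IsInvertible ((P1.zeroPoint R).ker.comap b) := by
  refine isInvertible_of_charts fun y ↦ ?_
  rcases hc.cover y with hy | hy | hy
  · refine ⟨_, c₀, hc.isOpenImmersion₀, hy, C π, by simpa using hπ, ?_⟩
    rw [← Scheme.IdealSheafData.comap_comp, hc.comp₀, specIdeal_comap_point_one_right' hm]
    refine le_antisymm (Ideal.span_le.mpr ?_) (Ideal.span_le.mpr ?_)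
    · rintro _ (rfl | rfl)
      · exact Ideal.mul_mem_right _ _ (Ideal.mem_span_singleton_self _)
      · exact Ideal.mul_mem_right _ _ (Ideal.mem_span_singleton_self _)
    · rintro _ rfl
      refine Ideal.subset_span (Set.mem_insert_of_mem _ ?_)
      exact (mul_one _).symm
  · refine ⟨_, c₁, hc.isOpenImmersion₁, hy, NodeRing.x π, ?_, ?_⟩
    · rw [mem_nonZeroDivisors_iff_left]
      exact fun a ↦ NodeRing.eq_zero_of_x_mul_eq_zero hπ a
    rw [← Scheme.IdealSheafData.comap_comp, hc.comp₁, specIdeal_comap_point_one_right' hm,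
      mul_one, ← NodeRing.x_mul_y]
    refine le_antisymm (Ideal.span_le.mpr ?_) (Ideal.span_mono (by simp))
    rintro _ (rfl | rfl)
    · exact Ideal.mem_span_singleton_self _
    · exact Ideal.mul_mem_right _ _ (Ideal.mem_span_singleton_self _)
  · refine ⟨_, c₂, hc.isOpenImmersion₂, hy, 1, one_mem _, ?_⟩
    rw [← Scheme.IdealSheafData.comap_comp, hc.comp₂, specIdeal_comap_point_one_left,
      Ideal.span_singleton_one]

omit [IsLocalRing R] hm hc hv₀ hv₁ hv₂ in
/-- If `(a, d) = (t)` with `t` a nonzerodivisor, then `d / t` and `a / t` are coprime. -/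
lemma exists_mul_eq_of_span_pair_eq {A : Type u} [CommRing A] {a d t : A} (ht : t ∈ A⁰)
    (h : Ideal.span {a, d} = Ideal.span {t}) :
    ∃ α β : A, IsCoprime α β ∧ d = α * t ∧ a = β * t := by
  obtain ⟨α, hα⟩ := Ideal.mem_span_singleton'.mp
    (h.le (Ideal.subset_span (Set.mem_insert_of_mem _ rfl)))
  obtain ⟨β, hβ⟩ := Ideal.mem_span_singleton'.mp
    (h.le (Ideal.subset_span (Set.mem_insert _ _)))
  obtain ⟨k, l, hkl⟩ := Ideal.mem_span_pair.mp (h.ge (Ideal.mem_span_singleton_self t))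
  refine ⟨α, β, ⟨l, k, ?_⟩, hα.symm, hβ.symm⟩
  refine sub_eq_zero.mp ((mul_right_mem_nonZeroDivisors_eq_zero_iff ht).mp ?_)
  linear_combination hkl + l * hα + k * hβ

omit hv₀ hv₁ hv₂ in
/-- Local existence of lifts to the blow-up: if `(a, π) = (β t, α t)`, then `[a : 1]` lifts to the
chart `z / π` where `α` is invertible, and to the chart `π / z` where `β` is. -/
lemma HasBlowUpCharts.exists_lift_nhd {T : Scheme.{u}} (g : T ⟶ P1 R)
    (hg : IsInvertible ((P1.zeroPoint R).ker.comap g)) (x : T) :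
    ∃ (W : Scheme.{u}) (w : W ⟶ T) (l : W ⟶ M), IsOpenImmersion w ∧ x ∈ Set.range w ∧
      l ≫ b = w ≫ g := by
  rcases mem_range_chart_or (g x) with hx | hx
  · obtain ⟨A, w, hw, ⟨y, rfl⟩, hwU, t, ht, hI⟩ :=
      hg.exists_chart x (g ⁻¹ᵁ (P1.chart R).opensRange) hx
    have hr : Set.range (w ≫ g) ⊆ Set.range (P1.chart R) := by
      rintro _ ⟨z, rfl⟩
      rw [Scheme.Hom.comp_apply]
      exact hwU ⟨z, rfl⟩
    obtain ⟨_, a, ha⟩ := exists_eq_point_one_right (w ≫ g) hr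
    rw [← Scheme.IdealSheafData.comap_comp, ha] at hI
    replace hI := (specIdeal_comap_point_one_right' hm a).symm.trans hI
    obtain ⟨α, β, hαβ, hα, hβ⟩ := exists_mul_eq_of_span_pair_eq ht hI
    rw [mul_one] at hα
    by_cases hy : α ∈ y.asIdeal
    · -- `β` is invertible at `y`, and `π = (α / β) a`
      have hy' : β ∉ y.asIdeal := fun hβ ↦ y.2.ne_top <| by
        obtain ⟨k, l, hkl⟩ := hαβ
        rw [Ideal.eq_top_iff_one, ← hkl]
        exact add_mem (Ideal.mul_mem_left _ _ hy) (Ideal.mul_mem_left _ _ hβ)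
      let B := Localization.Away β
      let ψ : A →ₐ[R] B := IsScalarTower.toAlgHom R A B
      have : IsOpenImmersion (Spec.map (CommRingCat.ofHom ψ.toRingHom)) :=
        IsOpenImmersion.of_isLocalization (S := B) β
      have hu : ψ β * IsLocalization.Away.invSelf β = 1 := IsLocalization.Away.mul_invSelf β
      refine ⟨_, Spec.map (CommRingCat.ofHom ψ.toRingHom) ≫ w, Spec.map (CommRingCat.ofHom
        (NodeRing.lift (ψ a) (ψ α * IsLocalization.Away.invSelf β) ?_).toRingHom) ≫ c₁,
        inferInstance, ?_, ?_⟩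
      · rw [← ψ.commutes, hα, hβ, map_mul, map_mul]
        linear_combination ψ t * ψ α * hu
      · obtain ⟨z, hz⟩ := (PrimeSpectrum.localization_away_comap_range B β).ge hy'
        exact ⟨z, (Scheme.Hom.comp_apply _ _ _).trans (congrArg w hz)⟩
      · rw [Category.assoc, hc.comp₁, Category.assoc, ha, SpecMap_point, SpecMap_point]
        congr 1
        · simp
        · rw [map_one, map_one]
    · -- `α` is invertible at `y`, and `a = (β / α) π`
      let B := Localization.Away α
      let ψ : A →ₐ[R] B := IsScalarTower.toAlgHom R A B
      have : IsOpenImmersion (Spec.map (CommRingCat.ofHom ψ.toRingHom)) :=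
        IsOpenImmersion.of_isLocalization (S := B) α
      have hu : ψ α * IsLocalization.Away.invSelf α = 1 := IsLocalization.Away.mul_invSelf α
      refine ⟨_, Spec.map (CommRingCat.ofHom ψ.toRingHom) ≫ w, Spec.map (CommRingCat.ofHom
        (aeval (R := R) (ψ β * IsLocalization.Away.invSelf α)).toRingHom) ≫ c₀,
        inferInstance, ?_, ?_⟩
      · obtain ⟨z, hz⟩ := (PrimeSpectrum.localization_away_comap_range B α).ge hy
        exact ⟨z, (Scheme.Hom.comp_apply _ _ _).trans (congrArg w hz)⟩
      · rw [Category.assoc, hc.comp₀, Category.assoc, ha, SpecMap_point, SpecMap_point]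
        congr 1
        · rw [map_mul, aeval_C, aeval_X, ← ψ.commutes, hα, hβ, map_mul, map_mul]
          linear_combination ψ t * ψ β * hu
        · rw [map_one, map_one]
  · obtain ⟨A, w, hw, hx, hwU⟩ := exists_affine_nhd x (g ⁻¹ᵁ (P1.chartInfty R).opensRange) hx
    have hr : Set.range (w ≫ g) ⊆ Set.range (P1.chartInfty R) := by
      rintro _ ⟨z, rfl⟩
      rw [Scheme.Hom.comp_apply]
      exact hwU ⟨z, rfl⟩
    obtain ⟨_, a, ha⟩ := exists_eq_point_one_left (w ≫ g) hr
    refine ⟨_, w, Spec.map (CommRingCat.ofHom (aeval (R := R) a).toRingHom) ≫ c₂, hw, hx, ?_⟩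
    rw [Category.assoc, hc.comp₂, ha, SpecMap_point]
    congr 1
    · rw [map_one]
    · rw [aeval_X]

omit hc hv₀ hv₁ hv₂ in
/-- The blow-up of `ℙ¹` at the closed point `z̃ = 0` exists, is separated, and has the standard
charts. -/
lemma exists_isBlowUp [IsDomain R] (hπ : π ≠ 0) : ∃ (M : Scheme.{u}) (b : M ⟶ P1 R)
    (c₀ : Spec (.of R[X]) ⟶ M) (c₁ : Spec (.of (NodeRing π)) ⟶ M) (c₂ : Spec (.of R[X]) ⟶ M),
    IsBlowUp (P1.zeroPoint R).ker b ∧ HasBlowUpCharts π b c₀ c₁ c₂ ∧ IsSeparated b := by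
  obtain ⟨M, b, v, c₀, c₁, c₂, hc, hb, hv₀, hv₁, hv₂, hbv⟩ := exists_model hπ
  refine ⟨M, b, c₀, c₁, c₂, ⟨hc.isInvertible_comap hm hπ, fun g hg ↦ ?_⟩, hc, hb⟩
  have hu {T : Scheme.{u}} (h h' : T ⟶ M) (e : h ≫ b = h' ≫ b)
      (hI : IsInvertible ((P1.zeroPoint R).ker.comap (h ≫ b))) : h = h' :=
    hbv T h h' e (comp_eq_of_comp_eq hm hc hv₀ hv₁ hv₂ h h' e hI)
  obtain ⟨l, hl⟩ := exists_lift_of_local b g (fun W w hw l l' e e' ↦ by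
    refine hu l l' (e.trans e'.symm) ?_
    rw [e, Scheme.IdealSheafData.comap_comp]
    exact hg.comap_of_isOpenImmersion w) (hc.exists_lift_nhd hm g hg)
  exact ⟨l, hl, fun l' hl' ↦ hu l' l (hl'.trans hl.symm) (by rwa [hl'])⟩

end UniversalProperty

/-! ### Non-smoothness at the node -/

section SmoothLocus

lemma exists_formallySmooth_away {R A : Type u} [CommRing R] [CommRing A] [Algebra R A]
    (f : Spec (.of A) ⟶ Spec (.of R)) (hf : f = Spec.map (CommRingCat.ofHom (algebraMap R A)))
    [LocallyOfFinitePresentation f] (x : Spec (.of A)) (hx : x ∈ f.smoothLocus) :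
    ∃ a : A, a ∉ x.asIdeal ∧ Algebra.FormallySmooth R (Localization.Away a) := by
  obtain ⟨a, hxa, ha⟩ := exists_basicOpen_nhd x f.smoothLocus hx
  refine ⟨a, (PrimeSpectrum.localization_away_comap_range (Localization.Away a) a).le hxa, ?_⟩
  have : IsOpenImmersion (Spec.map (CommRingCat.ofHom (algebraMap A (Localization.Away a)))) :=
    IsOpenImmersion.of_isLocalization a
  have h1 : Smooth (Spec.map (CommRingCat.ofHom (algebraMap A (Localization.Away a))) ≫ f) := by
    rw [← Scheme.Hom.smoothLocus_eq_top_iff, ← Scheme.Hom.preimage_smoothLocus_eq, ← top_le_iff]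
    exact fun y _ ↦ ha ⟨y, rfl⟩
  rw [hf, ← Spec.map_comp, ← CommRingCat.ofHom_comp, ← IsScalarTower.algebraMap_eq,
    HasRingHomProperty.Spec_iff (P := @Smooth)] at h1
  have h2 : (algebraMap R (Localization.Away a)).Smooth := h1
  rw [RingHom.smooth_algebraMap] at h2
  infer_instance

/-- The blow-up is not smooth at the node `x = y = π = 0`: the residue map at the node would lift
to a homomorphism to `R / 𝔪²` that sends `x` and `y` into the square-zero ideal `𝔪 / 𝔪²`,
contradicting `x y = π`. -/
lemma not_formallySmooth_nodeRing {R : Type u} [CommRing R] [IsLocalRing R] {π : R}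
    (hπ : π ∈ IsLocalRing.maximalIdeal R) (hπ2 : π ∉ IsLocalRing.maximalIdeal R ^ 2)
    (p : Ideal (NodeRing π)) [p.IsPrime] (hx : NodeRing.x π ∈ p) (hy : NodeRing.y π ∈ p)
    (hm : (IsLocalRing.maximalIdeal R).map (algebraMap R (NodeRing π)) ≤ p)
    (a : NodeRing π) (ha : a ∉ p) : ¬ Algebra.FormallySmooth R (Localization.Away a) := by
  intro hs
  let m := IsLocalRing.maximalIdeal R
  let φ : NodeRing π →ₐ[R] R ⧸ m := NodeRing.lift 0 0 (by
    rw [mul_zero]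
    exact (Ideal.Quotient.eq_zero_iff_mem.mpr hπ).symm)
  -- every element is congruent to a constant modulo `p`, compatibly with `φ`
  have hφ (b : NodeRing π) : ∃ r : R, b - algebraMap R _ r ∈ p ∧ φ b = Ideal.Quotient.mk m r := by
    have hb : b ∈ Algebra.adjoin R {NodeRing.x π, NodeRing.y π} := by
      rw [NodeRing.adjoin_eq_top]
      trivial
    induction hb using Algebra.adjoin_induction with
    | mem b hb =>
      rcases hb with rfl | rfl
      · exact ⟨0, by simpa using hx, by simp [φ]⟩
      · exact ⟨0, by simpa using hy, by simp [φ]⟩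
    | algebraMap r => exact ⟨r, by simp, φ.commutes r⟩
    | add b b' _ _ h h' =>
      obtain ⟨r, hr, hr'⟩ := h
      obtain ⟨s, hs, hs'⟩ := h'
      refine ⟨r + s, ?_, by rw [map_add, hr', hs', map_add]⟩
      convert add_mem hr hs using 1
      rw [map_add]
      ring
    | mul b b' _ _ h h' =>
      obtain ⟨r, hr, hr'⟩ := h
      obtain ⟨s, hs, hs'⟩ := h'
      refine ⟨r * s, ?_, by rw [map_mul, hr', hs', map_mul]⟩
      convert add_mem (p.mul_mem_right b' hr) (p.mul_mem_left (algebraMap R _ r) hs) using 1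
      rw [map_mul]
      ring
  have hu : IsUnit (φ a) := by
    obtain ⟨r, hr, hr'⟩ := hφ a
    rw [hr']
    refine IsUnit.map _ (not_not.mp fun h ↦ ha ?_)
    have := p.add_mem hr (hm (Ideal.mem_map_of_mem _ ((IsLocalRing.mem_maximalIdeal r).mpr h)))
    simpa using this
  let φ' : Localization.Away a →ₐ[R] R ⧸ m :=
    IsLocalization.liftAlgHom (M := Submonoid.powers a) (f := φ) (by
      rintro ⟨_, n, rfl⟩
      simpa using hu.pow n)
  let q : R ⧸ m ^ 2 →ₐ[R] R ⧸ m := Ideal.Quotient.factorₐ R (Ideal.pow_le_self two_ne_zero)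
  have hq : Function.Surjective q :=
    Ideal.Quotient.factor_surjective (Ideal.pow_le_self two_ne_zero)
  have hk (t : R ⧸ m ^ 2) (ht : q t = 0) : t ∈ m.map (Ideal.Quotient.mk (m ^ 2)) := by
    obtain ⟨t, rfl⟩ := Ideal.Quotient.mk_surjective t
    exact Ideal.mem_map_of_mem _ (Ideal.Quotient.eq_zero_iff_mem.mp ht)
  have hk2 : m.map (Ideal.Quotient.mk (m ^ 2)) ^ 2 = ⊥ := by
    rw [← Ideal.map_pow, Ideal.map_quotient_self]
  let ψ := Algebra.FormallySmooth.liftOfSurjective φ' q hq ⟨2, by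
    rw [Ideal.zero_eq_bot, eq_bot_iff, ← hk2]
    exact Ideal.pow_right_mono (fun t ht ↦ hk t ht) 2⟩
  have hψ (t) : q (ψ t) = φ' t := Algebra.FormallySmooth.liftOfSurjective_apply _ _ _ _ t
  have hφ' (b : NodeRing π) : φ' (algebraMap _ _ b) = φ b := IsLocalization.lift_eq _ b
  have h1 := hk (ψ (algebraMap _ _ (NodeRing.x π))) (by rw [hψ, hφ']; simp [φ])
  have h2 := hk (ψ (algebraMap _ _ (NodeRing.y π))) (by rw [hψ, hφ']; simp [φ])
  have h3 : ψ (algebraMap _ _ (NodeRing.x π)) * ψ (algebraMap _ _ (NodeRing.y π)) = 0 := by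
    have := Ideal.mul_mem_mul h1 h2
    rwa [← sq, hk2] at this
  rw [← map_mul, ← map_mul, NodeRing.x_mul_y, ← IsScalarTower.algebraMap_apply, ψ.commutes] at h3
  exact hπ2 (Ideal.Quotient.eq_zero_iff_mem.mp h3)

end SmoothLocus

/-! ### Charts and smooth locus of the blow-up -/

section BlowUp

lemma locallyOfFinitePresentation_of_local {S T : Scheme.{u}} (f : T ⟶ S)
    (h : ∀ x : T, ∃ (W : Scheme.{u}) (w : W ⟶ T), IsOpenImmersion w ∧ x ∈ Set.range w ∧
      LocallyOfFinitePresentation (w ≫ f)) : LocallyOfFinitePresentation f := by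
  choose W w hw hx h using h
  have := HasRingHomProperty.instIsZariskiLocalAtSource (P := @LocallyOfFinitePresentation)
  exact (IsZariskiLocalAtSource.iff_of_openCover (P := @LocallyOfFinitePresentation)
    (coverOfPoints W w hw hx)).mpr h

lemma mem_range_of_comp_eq {T T' W Y : Scheme.{u}} {f : T ⟶ W} {c : W ⟶ Y} {g : T ⟶ T'} {d : T' ⟶ Y}
    (e : f ≫ c = g ≫ d) (z : T) : c (f z) ∈ Set.range d :=
  ⟨g z, by rw [← Scheme.Hom.comp_apply, ← e, Scheme.Hom.comp_apply]⟩

lemma IsBlowUp.hom_ext {X Y T : Scheme.{u}} {I : X.IdealSheafData} {b : Y ⟶ X}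
    (hb : IsBlowUp I b) {l l' : T ⟶ Y} (h : l ≫ b = l' ≫ b) (hI : IsInvertible (I.comap (l ≫ b))) :
    l = l' :=
  (hb.existsUnique_lift (l ≫ b) hI).unique rfl h.symm

/-- On an open subscheme of the blow-up, the inverse image of the centre is invertible, so the
universal property applies. -/
lemma IsBlowUp.hom_ext_of_isOpenImmersion {X Y T : Scheme.{u}} {I : X.IdealSheafData} {b : Y ⟶ X}
    (hb : IsBlowUp I b) {l l' : T ⟶ Y} (h : l ≫ b = l' ≫ b) [IsOpenImmersion l] : l = l' :=
  hb.hom_ext h (by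
    rw [Scheme.IdealSheafData.comap_comp]
    exact hb.invertible.comap_of_isOpenImmersion l)

lemma IsBlowUp.exists_iso {X Y Y' : Scheme.{u}} {I : X.IdealSheafData} {b : Y ⟶ X}
    (hb : IsBlowUp I b) {b' : Y' ⟶ X} (hb' : IsBlowUp I b') : ∃ e : Y ≅ Y', e.hom ≫ b' = b := by
  obtain ⟨h, hh, -⟩ := hb'.existsUnique_lift b hb.invertible
  obtain ⟨k, hk, -⟩ := hb.existsUnique_lift b' hb'.invertible
  refine ⟨⟨h, k, hb.hom_ext ?_ ?_, hb'.hom_ext ?_ ?_⟩, hh⟩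
  · rw [Category.assoc, hk, hh, Category.id_comp]
  · rw [Category.assoc, hk, hh]
    exact hb.invertible
  · rw [Category.assoc, hh, hk, Category.id_comp]
  · rw [Category.assoc, hh, hk]
    exact hb'.invertible

variable {R : Type u} [CommRing R] [IsDomain R] [IsLocalRing R] {π : R}

/-- Every blow-up has the standard charts, being isomorphic to the model. -/
lemma IsBlowUp.exists_charts (hm : IsLocalRing.maximalIdeal R = Ideal.span {π}) (hπ : π ≠ 0)
    {Y : Scheme.{u}} {b : Y ⟶ P1 R} (hb : IsBlowUp (P1.zeroPoint R).ker b) :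
    IsSeparated b ∧ ∃ (c₀ : Spec (.of R[X]) ⟶ Y) (c₁ : Spec (.of (NodeRing π)) ⟶ Y)
      (c₂ : Spec (.of R[X]) ⟶ Y), HasBlowUpCharts π b c₀ c₁ c₂ := by
  obtain ⟨M, b', c₀, c₁, c₂, hb', hc, hs⟩ := exists_isBlowUp hm hπ
  obtain ⟨e, he⟩ := hb'.exists_iso hb
  have := hc.isOpenImmersion₀
  have := hc.isOpenImmersion₁
  have := hc.isOpenImmersion₂
  have he' : b = e.inv ≫ b' := by rw [← he, e.inv_hom_id_assoc]
  have hr {Z : Scheme.{u}} (c : Z ⟶ M) (y : Y) (h : e.inv y ∈ Set.range c) :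
      y ∈ Set.range (c ≫ e.hom) := by
    obtain ⟨z, hz⟩ := h
    refine ⟨z, ?_⟩
    rw [Scheme.Hom.comp_apply, hz, ← Scheme.Hom.comp_apply, e.inv_hom_id]
    rfl
  refine ⟨by rw [he']; infer_instance, c₀ ≫ e.hom, c₁ ≫ e.hom, c₂ ≫ e.hom, inferInstance,
    inferInstance, inferInstance, ?_, ?_, ?_, fun y ↦ ?_⟩
  · rw [Category.assoc, he, hc.comp₀]
  · rw [Category.assoc, he, hc.comp₁]
  · rw [Category.assoc, he, hc.comp₂]
  · exact (hc.cover (e.inv y)).imp (hr c₀ y) (Or.imp (hr c₁ y) (hr c₂ y))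

variable {Y : Scheme.{u}} {b : Y ⟶ P1 R} {c₀ : Spec (.of R[X]) ⟶ Y}
  {c₁ : Spec (.of (NodeRing π)) ⟶ Y} {c₂ : Spec (.of R[X]) ⟶ Y}
  (hc : HasBlowUpCharts π b c₀ c₁ c₂)
include hc

omit [IsDomain R] [IsLocalRing R]

lemma HasBlowUpCharts.comp_toSpec₀ :
    c₀ ≫ b ≫ P1.toSpec R = Spec.map (CommRingCat.ofHom (algebraMap R R[X])) := by
  rw [reassoc_of% hc.comp₀, point_toSpec]

lemma HasBlowUpCharts.comp_toSpec₁ :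
    c₁ ≫ b ≫ P1.toSpec R = Spec.map (CommRingCat.ofHom (algebraMap R (NodeRing π))) := by
  rw [reassoc_of% hc.comp₁, point_toSpec]

lemma HasBlowUpCharts.comp_toSpec₂ :
    c₂ ≫ b ≫ P1.toSpec R = Spec.map (CommRingCat.ofHom (algebraMap R R[X])) := by
  rw [reassoc_of% hc.comp₂, point_toSpec]

omit hc in
lemma locallyOfFinitePresentation_SpecMap_algebraMap (A : Type u) [CommRing A] [Algebra R A]
    [Algebra.FinitePresentation R A] :
    LocallyOfFinitePresentation (Spec.map (CommRingCat.ofHom (algebraMap R A))) := by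
  rw [HasRingHomProperty.Spec_iff (P := @LocallyOfFinitePresentation)]
  exact RingHom.finitePresentation_algebraMap.mpr ‹_›

lemma HasBlowUpCharts.locallyOfFinitePresentation :
    LocallyOfFinitePresentation (b ≫ P1.toSpec R) := by
  refine locallyOfFinitePresentation_of_local _ fun y ↦ ?_
  rcases hc.cover y with hy | hy | hy
  · refine ⟨_, c₀, hc.isOpenImmersion₀, hy, ?_⟩
    rw [hc.comp_toSpec₀]
    exact locallyOfFinitePresentation_SpecMap_algebraMap _
  · refine ⟨_, c₁, hc.isOpenImmersion₁, hy, ?_⟩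
    rw [hc.comp_toSpec₁]
    exact locallyOfFinitePresentation_SpecMap_algebraMap _
  · refine ⟨_, c₂, hc.isOpenImmersion₂, hy, ?_⟩
    rw [hc.comp_toSpec₂]
    exact locallyOfFinitePresentation_SpecMap_algebraMap _

omit hc in
lemma range_subset_smoothLocus (c : Spec (.of R[X]) ⟶ Y) [IsOpenImmersion c]
    (s : Y ⟶ Spec (.of R)) [LocallyOfFinitePresentation s]
    (h : c ≫ s = Spec.map (CommRingCat.ofHom (algebraMap R R[X]))) :
    Set.range c ⊆ s.smoothLocus := by
  have : Smooth (c ≫ s) := by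
    rw [h, HasRingHomProperty.Spec_iff (P := @Smooth)]
    have : Algebra.Smooth R R[X] := {}
    exact RingHom.smooth_algebraMap.mpr this
  rintro _ ⟨x, rfl⟩
  have hx : x ∈ c ⁻¹ᵁ s.smoothLocus := by
    rw [Scheme.Hom.preimage_smoothLocus_eq, Scheme.Hom.smoothLocus_eq_top]
    trivial
  exact hx

/-- The smooth locus of the blow-up is the complement of the node, that is, the union of the
charts with coordinates `z / π` and `1 / z`. -/
lemma HasBlowUpCharts.coe_smoothLocus [IsDomain R] [IsLocalRing R]
    (hm : IsLocalRing.maximalIdeal R = Ideal.span {π}) (hπ : π ≠ 0)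
    (hb : IsBlowUp (P1.zeroPoint R).ker b) [LocallyOfFinitePresentation (b ≫ P1.toSpec R)] :
    ((b ≫ P1.toSpec R).smoothLocus : Set Y) = Set.range c₀ ∪ Set.range c₂ := by
  have := hc.isOpenImmersion₀
  have := hc.isOpenImmersion₁
  have := hc.isOpenImmersion₂
  refine subset_antisymm (fun y hy ↦ ?_) (Set.union_subset
    (range_subset_smoothLocus c₀ _ hc.comp_toSpec₀) (range_subset_smoothLocus c₂ _ hc.comp_toSpec₂))
  rcases hc.cover y with h | ⟨x, rfl⟩ | h
  · exact Or.inl h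
  · have hx : x ∈ (c₁ ≫ b ≫ P1.toSpec R).smoothLocus := by
      rw [← Scheme.Hom.preimage_smoothLocus_eq]
      exact hy
    obtain ⟨a, ha, hs⟩ := exists_formallySmooth_away _ hc.comp_toSpec₁ x hx
    by_cases h1 : NodeRing.x π ∈ x.asIdeal
    · by_cases h2 : NodeRing.y π ∈ x.asIdeal
      · have := x.2
        refine (not_formallySmooth_nodeRing ?_ ?_ x.asIdeal h1 h2 ?_ a ha hs).elim
        · rw [hm]
          exact Ideal.mem_span_singleton_self π
        · rw [hm, Ideal.span_singleton_pow, Ideal.mem_span_singleton]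
          rintro ⟨d, hd⟩
          have hu : IsUnit π := IsUnit.of_mul_eq_one d
            (mul_left_cancel₀ hπ (by linear_combination -hd))
          exact (IsLocalRing.mem_maximalIdeal π).mp (hm ▸ Ideal.mem_span_singleton_self π) hu
        · rw [hm, Ideal.map_span, Ideal.span_le, Set.image_singleton, Set.singleton_subset_iff]
          rw [← NodeRing.x_mul_y]
          exact Ideal.mul_mem_right _ _ h1
      · -- where `y` is invertible, the chart is contained in `c₀`, with `z / π = 1 / y`
        left
        let B := Localization.Away (NodeRing.y π)
        let ψ : NodeRing π →ₐ[R] B := IsScalarTower.toAlgHom R _ B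
        have : IsOpenImmersion (Spec.map (CommRingCat.ofHom ψ.toRingHom)) :=
          IsOpenImmersion.of_isLocalization (S := B) (NodeRing.y π)
        have hu : ψ (NodeRing.y π) * IsLocalization.Away.invSelf (NodeRing.y π) = 1 :=
          IsLocalization.Away.mul_invSelf (NodeRing.y π)
        have e : Spec.map (CommRingCat.ofHom ψ.toRingHom) ≫ c₁ =
            Spec.map (CommRingCat.ofHom (aeval (R := R)
              (IsLocalization.Away.invSelf (NodeRing.y π) : B)).toRingHom) ≫ c₀ := by
          refine hb.hom_ext_of_isOpenImmersion ?_
          rw [Category.assoc, hc.comp₁, Category.assoc, hc.comp₀, SpecMap_point, SpecMap_point]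
          congr 1
          · rw [map_mul, aeval_C, aeval_X, ← ψ.commutes, ← NodeRing.x_mul_y, map_mul]
            linear_combination (-ψ (NodeRing.x π)) * hu
          · rw [map_one, map_one]
        obtain ⟨w, rfl⟩ := (PrimeSpectrum.localization_away_comap_range B (NodeRing.y π)).ge h2
        exact mem_range_of_comp_eq e w
    · -- where `x` is invertible, the chart is contained in `c₂`, with `1 / z = 1 / x`
      right
      let B := Localization.Away (NodeRing.x π)
      let ψ : NodeRing π →ₐ[R] B := IsScalarTower.toAlgHom R _ B
      have : IsOpenImmersion (Spec.map (CommRingCat.ofHom ψ.toRingHom)) :=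
        IsOpenImmersion.of_isLocalization (S := B) (NodeRing.x π)
      have hu : ψ (NodeRing.x π) * IsLocalization.Away.invSelf (NodeRing.x π) = 1 :=
        IsLocalization.Away.mul_invSelf (NodeRing.x π)
      have e : Spec.map (CommRingCat.ofHom ψ.toRingHom) ≫ c₁ =
          Spec.map (CommRingCat.ofHom (aeval (R := R)
            (IsLocalization.Away.invSelf (NodeRing.x π) : B)).toRingHom) ≫ c₂ := by
        refine hb.hom_ext_of_isOpenImmersion ?_
        rw [Category.assoc, hc.comp₁, Category.assoc, hc.comp₂, SpecMap_point, SpecMap_point]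
        apply point_eq_of_mul_eq_mul
        rw [aeval_X, hu, map_one, map_one, one_mul]
      obtain ⟨w, rfl⟩ := (PrimeSpectrum.localization_away_comap_range B (NodeRing.x π)).ge h1
      exact mem_range_of_comp_eq e w
  · exact Or.inr h

end BlowUp

/-! ### Base change of the projective line -/

section BaseChange

variable {R : Type u} [CommRing R]

/-- An `A`-valued point of `ℙ¹` with image in one of the two charts is `[a : 1]` or `[1 : a]`. -/
lemma exists_eq_point {A : Type u} [CommRing A] [Algebra R A] (f : Spec (.of A) ⟶ P1 R)
    (hf : f ≫ P1.toSpec R = Spec.map (CommRingCat.ofHom (algebraMap R A)))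
    (h : Set.range f ⊆ Set.range (P1.chart R) ∨ Set.range f ⊆ Set.range (P1.chartInfty R)) :
    (∃ a : A, f = P1.point R a 1 isCoprime_one_right) ∨
      ∃ a : A, f = P1.point R 1 a isCoprime_one_left := by
  refine h.imp (fun h ↦ ?_) (fun h ↦ ?_)
  · obtain ⟨ψ, rfl⟩ := exists_SpecMap_comp_eq (P1.toSpec R) (P1.chart R) (point_toSpec _ _ _) f hf h
    refine ⟨ψ X, (SpecMap_point ψ X 1 _).trans ?_⟩
    congr 1
    exact map_one ψ
  · obtain ⟨ψ, rfl⟩ :=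
      exists_SpecMap_comp_eq (P1.toSpec R) (P1.chartInfty R) (point_toSpec _ _ _) f hf h
    refine ⟨ψ X, (SpecMap_point ψ 1 X _).trans ?_⟩
    congr 1
    exact map_one ψ

lemma exists_opens_chart (y : P1 R) : ∃ U : (P1 R).Opens, y ∈ U ∧
    ((U : Set (P1 R)) ⊆ Set.range (P1.chart R) ∨
      (U : Set (P1 R)) ⊆ Set.range (P1.chartInfty R)) := by
  rcases mem_range_chart_or y with h | h
  · exact ⟨_, h, Or.inl subset_rfl⟩
  · exact ⟨_, h, Or.inr subset_rfl⟩

variable (R) (K : Type u) [CommRing K] [Algebra R K]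

lemma baseChange_toSpec : P1.baseChange R K ≫ P1.toSpec R =
    P1.toSpec K ≫ Spec.map (CommRingCat.ofHom (algebraMap R K)) := by
  have hloc (y : P1 K) : ∃ (W : Scheme.{u}) (w : W ⟶ P1 K), IsOpenImmersion w ∧ y ∈ Set.range w ∧
      w ≫ P1.baseChange R K ≫ P1.toSpec R =
        w ≫ P1.toSpec K ≫ Spec.map (CommRingCat.ofHom (algebraMap R K)) := by
    have h (a b : K[X]) (hab : IsCoprime a b) :
        P1.point K a b hab ≫ P1.baseChange R K ≫ P1.toSpec R =
        P1.point K a b hab ≫ P1.toSpec K ≫ Spec.map (CommRingCat.ofHom (algebraMap R K)) := by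
      rw [reassoc_of% point_baseChange, reassoc_of% point_toSpec, point_toSpec, ← Spec.map_comp]
      rfl
    rcases mem_range_chart_or y with hy | hy
    · exact ⟨_, P1.chart K, inferInstance, hy, h _ _ _⟩
    · exact ⟨_, P1.chartInfty K, inferInstance, hy, h _ _ _⟩
  choose W w hw hy h using hloc
  exact Scheme.Cover.hom_ext (coverOfPoints W w hw hy) _ _ h

variable {R K}

/-- `ℙ¹_K ⟶ ℙ¹_R ×_R K` is a monomorphism, since both sides have the same points. -/
lemma hom_ext_of_baseChange {T : Scheme.{u}} {l l' : T ⟶ P1 K}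
    (h : l ≫ P1.baseChange R K = l' ≫ P1.baseChange R K)
    (h' : l ≫ P1.toSpec K = l' ≫ P1.toSpec K) : l = l' := by
  have hloc (x : T) : ∃ (W : Scheme.{u}) (w : W ⟶ T), IsOpenImmersion w ∧ x ∈ Set.range w ∧
      w ≫ l = w ≫ l' := by
    obtain ⟨U, hxU, hU⟩ := exists_opens_chart (l x)
    obtain ⟨U', hxU', hU'⟩ := exists_opens_chart (l' x)
    obtain ⟨A, w, hw, hx, hwU⟩ := exists_affine_nhd x (l ⁻¹ᵁ U ⊓ l' ⁻¹ᵁ U') ⟨hxU, hxU'⟩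
    refine ⟨_, w, hw, hx, ?_⟩
    have hr : Set.range (w ≫ l) ⊆ U := by
      rintro _ ⟨z, rfl⟩
      rw [Scheme.Hom.comp_apply]
      exact (hwU ⟨z, rfl⟩).1
    have hr' : Set.range (w ≫ l') ⊆ U' := by
      rintro _ ⟨z, rfl⟩
      rw [Scheme.Hom.comp_apply]
      exact (hwU ⟨z, rfl⟩).2
    let _ : Algebra K A := (Spec.preimage (w ≫ l ≫ P1.toSpec K)).hom.toAlgebra
    let _ : Algebra R A := Algebra.compHom A (algebraMap R K)
    have : IsScalarTower R K A := .of_algebraMap_eq fun _ ↦ rfl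
    have ha : (w ≫ l) ≫ P1.toSpec K = Spec.map (CommRingCat.ofHom (algebraMap K A)) :=
      (Category.assoc _ _ _).trans (Spec.map_preimage _).symm
    have ha' : (w ≫ l') ≫ P1.toSpec K = Spec.map (CommRingCat.ofHom (algebraMap K A)) := by
      rw [← ha, Category.assoc, Category.assoc, h']
    have key (a b a' b' : A) (hab : IsCoprime a b) (hab' : IsCoprime a' b')
        (e : w ≫ l = P1.point K a b hab) (e' : w ≫ l' = P1.point K a' b' hab') :
        w ≫ l = w ≫ l' := by
      rw [e, e']
      refine point_eq_of_mul_eq_mul _ _ (mul_eq_mul_of_point_eq (R := R) hab hab' ?_)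
      rw [← point_baseChange (R := R) K a b hab, ← point_baseChange (R := R) K a' b' hab', ← e,
        ← e',
        Category.assoc, h, Category.assoc]
    rcases exists_eq_point (A := A) _ ha (hU.imp (hr.trans ·) (hr.trans ·)) with ⟨a, e⟩ | ⟨a, e⟩ <;>
      rcases exists_eq_point (A := A) _ ha' (hU'.imp (hr'.trans ·) (hr'.trans ·))
        with ⟨a', e'⟩ | ⟨a', e'⟩ <;>
      exact key _ _ _ _ _ _ e e'
  choose W w hw hx h using hloc
  exact Scheme.Cover.hom_ext (coverOfPoints W w hw hx) _ _ h

variable (R K)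

lemma isPullback_baseChange : IsPullback (P1.baseChange R K) (P1.toSpec K) (P1.toSpec R)
    (Spec.map (CommRingCat.ofHom (algebraMap R K))) := by
  let m := Spec.map (CommRingCat.ofHom (algebraMap R K))
  let f : P1 K ⟶ pullback (P1.toSpec R) m := pullback.lift _ _ (baseChange_toSpec R K)
  have hf : f ≫ pullback.fst _ _ = P1.baseChange R K := pullback.lift_fst _ _ _
  have hf' : f ≫ pullback.snd _ _ = P1.toSpec K := pullback.lift_snd _ _ _
  have hu {W : Scheme.{u}} (l l' : W ⟶ P1 K) (h : l ≫ f = l' ≫ f) : l = l' :=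
    hom_ext_of_baseChange (R := R) (by rw [← hf, reassoc_of% h]) (by rw [← hf', reassoc_of% h])
  obtain ⟨l, hl⟩ := exists_lift_of_local f (𝟙 _)
    (fun W w _ l l' e e' ↦ hu l l' (e.trans e'.symm)) (fun x ↦ by
      obtain ⟨U, hxU, hU⟩ := exists_opens_chart (pullback.fst (P1.toSpec R) m x)
      obtain ⟨A, w, hw, hx, hwU⟩ := exists_affine_nhd x (pullback.fst (P1.toSpec R) m ⁻¹ᵁ U) hxU
      have hr : Set.range (w ≫ pullback.fst _ _) ⊆ U := by
        rintro _ ⟨z, rfl⟩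
        rw [Scheme.Hom.comp_apply]
        exact hwU ⟨z, rfl⟩
      let _ : Algebra K A := (Spec.preimage (w ≫ pullback.snd _ _)).hom.toAlgebra
      let _ : Algebra R A := Algebra.compHom A (algebraMap R K)
      have : IsScalarTower R K A := .of_algebraMap_eq fun _ ↦ rfl
      have ha : w ≫ pullback.snd _ _ = Spec.map (CommRingCat.ofHom (algebraMap K A)) :=
        (Spec.map_preimage _).symm
      have ha' : (w ≫ pullback.fst _ _) ≫ P1.toSpec R =
          Spec.map (CommRingCat.ofHom (algebraMap R A)) := by
        rw [Category.assoc, pullback.condition, reassoc_of% ha, ← Spec.map_comp]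
        rfl
      have key (a b : A) (hab : IsCoprime a b)
          (e : w ≫ pullback.fst _ _ = P1.point R a b hab) : P1.point K a b hab ≫ f = w ≫ 𝟙 _ := by
        rw [Category.comp_id]
        apply pullback.hom_ext
        · rw [Category.assoc, hf, point_baseChange, e]
        · rw [Category.assoc, hf', point_toSpec, ha]
      rcases exists_eq_point (A := A) _ ha' (hU.imp (hr.trans ·) (hr.trans ·))
        with ⟨a, e⟩ | ⟨a, e⟩
      · exact ⟨_, w, _, hw, hx, key _ _ _ e⟩
      · exact ⟨_, w, _, hw, hx, key _ _ _ e⟩)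
  have : IsIso f := ⟨l, hu _ _ (by rw [Category.assoc, hl, Category.comp_id, Category.id_comp]), hl⟩
  exact IsPullback.of_iso_pullback ⟨baseChange_toSpec R K⟩ (asIso f) hf hf'

end BaseChange

/-! ### The generic fibre of the blow-up -/

section GenericFibre

variable {R : Type u} [CommRing R] [IsLocalRing R] {π : R}
  {K : Type u} [CommRing K] [Algebra R K] (hπK : IsUnit (algebraMap R K π))
include hπK

/-- The inverse image of the centre of the blow-up is the unit ideal wherever `π` is
invertible. -/
lemma isInvertible_comap_of_isUnit {T : Scheme.{u}} (g : T ⟶ P1 R) (c : T ⟶ Spec (.of K))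
    (h : g ≫ P1.toSpec R = c ≫ Spec.map (CommRingCat.ofHom (algebraMap R K)))
    (hm : IsLocalRing.maximalIdeal R = Ideal.span {π}) :
    IsInvertible ((P1.zeroPoint R).ker.comap g) := by
  refine isInvertible_of_charts fun x ↦ ?_
  obtain ⟨U, hxU, hU⟩ := exists_opens_chart (g x)
  obtain ⟨A, w, hw, hx, hwU⟩ := exists_affine_nhd x (g ⁻¹ᵁ U) hxU
  refine ⟨A, w, hw, hx, 1, one_mem _, ?_⟩
  have hr : Set.range (w ≫ g) ⊆ U := by
    rintro _ ⟨z, rfl⟩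
    rw [Scheme.Hom.comp_apply]
    exact hwU ⟨z, rfl⟩
  let _ : Algebra K A := (Spec.preimage (w ≫ c)).hom.toAlgebra
  let _ : Algebra R A := Algebra.compHom A (algebraMap R K)
  have ha : (w ≫ g) ≫ P1.toSpec R = Spec.map (CommRingCat.ofHom (algebraMap R A)) := by
    rw [Category.assoc, h, ← Category.assoc, ← Spec.map_preimage (w ≫ c), ← Spec.map_comp]
    rfl
  rw [← Scheme.IdealSheafData.comap_comp, Ideal.span_singleton_one]
  rcases exists_eq_point (A := A) _ ha (hU.imp (hr.trans ·) (hr.trans ·)) with ⟨a, e⟩ | ⟨a, e⟩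
  · rw [e]
    refine (specIdeal_comap_point_one_right' hm a).trans ?_
    rw [mul_one]
    exact Ideal.eq_top_of_isUnit_mem _ (Ideal.subset_span (Set.mem_insert_of_mem _ rfl))
      (hπK.map (algebraMap K A))
  · rw [e]
    exact specIdeal_comap_point_one_left a

variable (hm : IsLocalRing.maximalIdeal R = Ideal.span {π})
  {Y : Scheme.{u}} {b : Y ⟶ P1 R} (hb : IsBlowUp (P1.zeroPoint R).ker b)
include hm hb

lemma IsBlowUp.exists_genericFibre : ∃ j : P1 K ⟶ Y, j ≫ b = P1.baseChange R K :=
  (hb.existsUnique_lift _ (isInvertible_comap_of_isUnit hπK _ _ (baseChange_toSpec R K) hm)).exists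

variable {j : P1 K ⟶ Y} (hj : j ≫ b = P1.baseChange R K)
include hj

/-- A morphism to the blow-up that factors through `ℙ¹_K` below factors through it above. -/
lemma IsBlowUp.eq_comp_genericFibre {T : Scheme.{u}} (f : T ⟶ P1 K) (l : T ⟶ Y)
    (h : l ≫ b = f ≫ P1.baseChange R K) : l = f ≫ j := by
  refine hb.hom_ext (by rw [h, Category.assoc, hj]) ?_
  rw [h]
  exact isInvertible_comap_of_isUnit hπK _ (f ≫ P1.toSpec K)
    (by rw [Category.assoc, baseChange_toSpec, Category.assoc]) hm

/-- The blow-up is an isomorphism on generic fibres. -/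
lemma IsBlowUp.isPullback_genericFibre : IsPullback j (P1.toSpec K) (b ≫ P1.toSpec R)
    (Spec.map (CommRingCat.ofHom (algebraMap R K))) := by
  have hP := isPullback_baseChange R K
  refine ⟨⟨by rw [reassoc_of% hj, baseChange_toSpec]⟩, ⟨PullbackCone.IsLimit.mk _
    (fun s ↦ hP.lift (s.fst ≫ b) s.snd (by rw [Category.assoc, s.condition]))
    (fun s ↦ ?_) (fun s ↦ hP.lift_snd _ _ _) (fun s l h h' ↦ ?_)⟩⟩
  · exact (hb.eq_comp_genericFibre hπK hm hj _ _ (hP.lift_fst _ _ _).symm).symm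
  · apply hP.hom_ext
    · rw [hP.lift_fst, ← h, Category.assoc, hj]
    · rw [hP.lift_snd, h']

end GenericFibre

/-! ### Extension of rational points -/

section Sections

lemma range_subset_of_isLocalRing {A : Type u} [CommRing A] [IsLocalRing A] {T : Scheme.{u}}
    (f : Spec (.of A) ⟶ T) (U : T.Opens) (h : f (IsLocalRing.closedPoint A) ∈ U) :
    Set.range f ⊆ U := by
  have : f ⁻¹ᵁ U = ⊤ := IsLocalRing.closed_point_mem_iff.mp h
  rintro _ ⟨x, rfl⟩
  exact this.ge (Set.mem_univ x)

variable {R : Type u} [CommRing R] [IsDomain R] [IsDiscreteValuationRing R] {π : R}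
  (hπ : Irreducible π) {K : Type u} [Field K] [Algebra R K] [IsFractionRing R K]
  {Y : Scheme.{u}} {b : Y ⟶ P1 R} {c₀ : Spec (.of R[X]) ⟶ Y}
  {c₁ : Spec (.of (NodeRing π)) ⟶ Y} {c₂ : Spec (.of R[X]) ⟶ Y}
  (hc : HasBlowUpCharts π b c₀ c₁ c₂) (hb : IsBlowUp (P1.zeroPoint R).ker b)
  {j : P1 K ⟶ Y} (hj : j ≫ b = P1.baseChange R K)

omit [IsDomain R] [IsDiscreteValuationRing R] in
include hπ in
lemma isUnit_algebraMap_uniformizer : IsUnit (algebraMap R K π) :=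
  ((map_ne_zero_iff _ (IsFractionRing.injective R K)).mpr hπ.ne_zero).isUnit

include hπ in
/-- Either `z / π` or `1 / z` is integral. -/
lemma exists_algebraMap_eq_or (ζ : K) : (∃ a : R, ζ = algebraMap R K (π * a)) ∨
    ∃ a : R, ζ * algebraMap R K a = 1 := by
  have h0 := (isUnit_algebraMap_uniformizer hπ (K := K)).ne_zero
  rcases ValuationRing.isInteger_or_isInteger R (ζ / algebraMap R K π) with ⟨a, ha⟩ | ⟨a, ha⟩
  · refine Or.inl ⟨a, ?_⟩
    rw [map_mul, ha, mul_div_cancel₀ _ h0]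
  · by_cases hu : IsUnit a
    · obtain ⟨a', h⟩ := hu.exists_right_inv
      refine Or.inl ⟨a', ?_⟩
      have h1 : algebraMap R K a * algebraMap R K a' = 1 := by rw [← map_mul, h, map_one]
      rw [ha, inv_div] at h1
      have hζ : ζ ≠ 0 := by
        rintro rfl
        simp at h1
      rw [map_mul]
      field_simp at h1
      exact h1.symm
    · have ha' : a ∈ IsLocalRing.maximalIdeal R := hu
      rw [hπ.maximalIdeal_eq, Ideal.mem_span_singleton] at ha'
      obtain ⟨d, rfl⟩ := ha'
      rw [inv_div, map_mul] at ha
      by_cases hζ : ζ = 0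
      · exact Or.inl ⟨0, by simp [hζ]⟩
      · refine Or.inr ⟨d, ?_⟩
        field_simp at ha
        rw [mul_comm]
        exact ha

include hπ hc hb hj in
/-- Every rational point of the generic fibre extends to a section through one of the two smooth
charts. -/
lemma HasBlowUpCharts.exists_section (P : Spec (.of K) ⟶ P1 K) (hP : P ≫ P1.toSpec K = 𝟙 _) :
    ∃ Q : Spec (.of R) ⟶ Y, Set.range Q ⊆ Set.range c₀ ∪ Set.range c₂ ∧
      Q ≫ b ≫ P1.toSpec R = 𝟙 _ ∧
      Spec.map (CommRingCat.ofHom (algebraMap R K)) ≫ Q = P ≫ j := by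
  have hid : Spec.map (CommRingCat.ofHom (algebraMap K K)) = 𝟙 _ := Spec.map_id _
  have hid' : Spec.map (CommRingCat.ofHom (algebraMap R R)) = 𝟙 _ := Spec.map_id _
  have hu := isUnit_algebraMap_uniformizer hπ (K := K)
  have haev (a : R) : Spec.map (CommRingCat.ofHom (aeval (R := R) a).toRingHom) ≫
      Spec.map (CommRingCat.ofHom (algebraMap R R[X])) = 𝟙 _ := by
    rw [← hid', ← Spec.map_comp, ← CommRingCat.ofHom_comp]
    congr 2
    exact RingHom.ext fun r ↦ aeval_C a r
  have hR (x y : R) (hxy : IsCoprime x y) :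
      Spec.map (CommRingCat.ofHom (algebraMap R K)) ≫ P1.point R x y hxy =
      P1.point R (algebraMap R K x) (algebraMap R K y) (hxy.map _) :=
    SpecMap_point (Algebra.ofId R K) x y hxy
  have key (x y : K) (hxy : IsCoprime x y) (hPxy : P = P1.point K x y hxy) (c : Spec (.of R[X]) ⟶ Y)
      (hc : c ≫ b ≫ P1.toSpec R = Spec.map (CommRingCat.ofHom (algebraMap R R[X]))) (a : R)
      (x' y' : R) (hxy' : IsCoprime x' y')
      (h : Spec.map (CommRingCat.ofHom (aeval (R := R) a).toRingHom) ≫ c ≫ b =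
        P1.point R x' y' hxy') (e : algebraMap R K x' * y = x * algebraMap R K y')
      (hr : Set.range c ⊆ Set.range c₀ ∪ Set.range c₂) :
      ∃ Q : Spec (.of R) ⟶ Y, Set.range Q ⊆ Set.range c₀ ∪ Set.range c₂ ∧
        Q ≫ b ≫ P1.toSpec R = 𝟙 _ ∧
        Spec.map (CommRingCat.ofHom (algebraMap R K)) ≫ Q = P ≫ j := by
    refine ⟨Spec.map (CommRingCat.ofHom (aeval (R := R) a).toRingHom) ≫ c, ?_, ?_, ?_⟩
    · rintro _ ⟨z, rfl⟩
      rw [Scheme.Hom.comp_apply]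
      exact hr ⟨_, rfl⟩
    · rw [Category.assoc, hc, haev]
    · refine hb.eq_comp_genericFibre hu hπ.maximalIdeal_eq hj _ _ ?_
      rw [Category.assoc, Category.assoc, h, hR, hPxy, point_baseChange]
      exact point_eq_of_mul_eq_mul _ _ e
  have key' (ζ : K) (hζ : P = P1.point K ζ 1 isCoprime_one_right) :
      ∃ Q : Spec (.of R) ⟶ Y, Set.range Q ⊆ Set.range c₀ ∪ Set.range c₂ ∧
        Q ≫ b ≫ P1.toSpec R = 𝟙 _ ∧
        Spec.map (CommRingCat.ofHom (algebraMap R K)) ≫ Q = P ≫ j := by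
    rcases exists_algebraMap_eq_or hπ ζ with ⟨a, rfl⟩ | ⟨a, ha⟩
    · refine key _ _ _ hζ c₀ hc.comp_toSpec₀ a _ _ _
        (by rw [hc.comp₀, SpecMap_point]) ?_ Set.subset_union_left
      simp
    · refine key _ _ _ hζ c₂ hc.comp_toSpec₂ a _ _ _
        (by rw [hc.comp₂, SpecMap_point]) ?_ Set.subset_union_right
      simp [ha]
  obtain ⟨U, hxU, hU⟩ := exists_opens_chart (P (IsLocalRing.closedPoint K))
  have hr := range_subset_of_isLocalRing P U hxU
  rcases exists_eq_point P (hP.trans hid.symm) (hU.imp (hr.trans ·) (hr.trans ·))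
    with ⟨ζ, hζ⟩ | ⟨η, hη⟩
  · exact key' ζ hζ
  · by_cases h0 : η = 0
    · refine key _ _ _ hη c₂ hc.comp_toSpec₂ 0 _ _ _
        (by rw [hc.comp₂, SpecMap_point]) ?_ Set.subset_union_right
      simp [h0]
    · refine key' η⁻¹ (hη.trans (point_eq_of_mul_eq_mul _ _ ?_))
      rw [one_mul, inv_mul_cancel₀ h0]

end Sections

/-! ### Generic points and polynomial maps -/

section GenericPoint

lemma isReduced_of_local {T : Scheme.{u}} (h : ∀ x : T, ∃ (W : Scheme.{u}) (w : W ⟶ T),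
    IsOpenImmersion w ∧ x ∈ Set.range w ∧ IsReduced W) : IsReduced T := by
  choose W w hw hx h using h
  have (i : (coverOfPoints W w hw hx).I₀) : IsReduced ((coverOfPoints W w hw hx).X i) := h i
  exact IsReduced.of_openCover _ (coverOfPoints W w hw hx)

lemma isDominant_of_local {T X : Scheme.{u}} (t : T ⟶ X) (h : ∀ x : X, ∃ (W : Scheme.{u})
    (w : W ⟶ X) (t' : T ⟶ W), x ∈ Set.range w ∧ IsDominant t' ∧ t' ≫ w = t) : IsDominant t := by
  refine ⟨fun x ↦ ?_⟩
  obtain ⟨W, w, t', ⟨y, rfl⟩, ht', rfl⟩ := h x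
  refine map_mem_closure w.continuous (ht'.denseRange y) ?_
  rintro _ ⟨z, rfl⟩
  exact ⟨z, Scheme.Hom.comp_apply _ _ _⟩

lemma isDominant_SpecMap_aeval {R L : Type u} [CommRing R] [CommRing L] [Algebra R L] {ζ : L}
    (h : Transcendental R ζ) :
    IsDominant (Spec.map (CommRingCat.ofHom (aeval (R := R) ζ).toRingHom)) := by
  refine ⟨(PrimeSpectrum.denseRange_comap_iff_ker_le_nilRadical _).mpr ?_⟩
  refine le_of_eq_of_le (b := ⊥) ?_ bot_le
  exact (RingHom.injective_iff_ker_eq_bot (aeval (R := R) ζ).toRingHom).mp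
    (transcendental_iff_injective.mp h)

/-- Evaluation at a point `ζ` with `G(ζ) ≠ 0` extends to `R[X][1 / G]`. -/
lemma exists_algHom_away {R L : Type u} [CommRing R] [Field L] [Algebra R L] (G : R[X]) (ζ : L)
    (h : aeval ζ G ≠ 0) : ∃ ψ : Localization.Away G →ₐ[R] L,
      (∀ q : R[X], ψ (algebraMap _ _ q) = aeval ζ q) ∧
      aeval ζ G * ψ (IsLocalization.Away.invSelf G) = 1 := by
  let ψ : Localization.Away G →ₐ[R] L := IsLocalization.liftAlgHom (M := Submonoid.powers G)
    (f := aeval ζ) (by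
      rintro ⟨_, n, rfl⟩
      simpa using (IsUnit.mk0 _ h).pow n)
  have hψ (q : R[X]) : ψ (algebraMap _ _ q) = aeval ζ q := IsLocalization.lift_eq _ q
  refine ⟨ψ, hψ, ?_⟩
  rw [← hψ, ← map_mul, IsLocalization.Away.mul_invSelf, map_one]

lemma isDominant_SpecMap_away {R L : Type u} [CommRing R] [Field L] [Algebra R L] (G : R[X])
    {ζ : L} (hζ : Transcendental R ζ) (ψ : Localization.Away G →ₐ[R] L)
    (hψ : ∀ q : R[X], ψ (algebraMap _ _ q) = aeval ζ q) :
    IsDominant (Spec.map (CommRingCat.ofHom ψ.toRingHom)) := by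
  have : IsOpenImmersion (Spec.map (CommRingCat.ofHom (algebraMap R[X] (Localization.Away G)))) :=
    IsOpenImmersion.of_isLocalization G
  have h : IsDominant (Spec.map (CommRingCat.ofHom ψ.toRingHom) ≫
      Spec.map (CommRingCat.ofHom (algebraMap R[X] (Localization.Away G)))) := by
    rw [← Spec.map_comp, ← CommRingCat.ofHom_comp]
    convert isDominant_SpecMap_aeval hζ using 3
    exact RingHom.ext hψ
  exact .of_comp_of_isOpenImmersion _
    (Spec.map (CommRingCat.ofHom (algebraMap R[X] (Localization.Away G))))

variable {K : Type u} [Field K]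

instance : IsReduced (P1 K) := by
  refine isReduced_of_local fun x ↦ ?_
  rcases mem_range_chart_or x with hx | hx
  · exact ⟨_, P1.chart K, inferInstance, hx, inferInstance⟩
  · exact ⟨_, P1.chartInfty K, inferInstance, hx, inferInstance⟩

variable {L : Type u} [Field L] [Algebra K L] {z : L} (hz : Transcendental K z)
include hz

/-- A transcendental element defines the generic point of `ℙ¹`. -/
lemma isDominant_point : IsDominant (P1.point K z 1 isCoprime_one_right) := by
  refine isDominant_of_local _ fun x ↦ ?_
  rcases mem_range_chart_or x with hx | hx
  · exact ⟨_, P1.chart K, _, hx, isDominant_SpecMap_aeval hz, (point_one_right z).symm⟩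
  · refine ⟨_, P1.chartInfty K, _, hx, isDominant_SpecMap_aeval (ζ := z⁻¹)
      (fun h ↦ hz (IsAlgebraic.inv_iff.mp h)), (point_one_left z⁻¹).symm.trans ?_⟩
    refine point_eq_of_mul_eq_mul _ _ ?_
    rw [one_mul, mul_inv_cancel₀ (fun h : z = 0 ↦ hz (by rw [h]; exact isAlgebraic_zero))]

lemma aeval_ne_zero_of_transcendental {q : K[X]} (hq : q ≠ 0) : aeval z q ≠ 0 :=
  fun h ↦ hq ((transcendental_iff.mp hz) q h)

omit hz in
lemma IsPolynomialMap.point_comp {p : K[X]} {φ : P1 K ⟶ P1 K} (hφ : IsPolynomialMap p φ) :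
    P1.point K z 1 isCoprime_one_right ≫ φ = P1.point K (aeval z p) 1 isCoprime_one_right := by
  rw [point_one_right, Category.assoc, hφ.chart, point_one_right, ← Spec.map_comp_assoc,
    ← CommRingCat.ofHom_comp]
  congr 3
  exact congrArg AlgHom.toRingHom (aeval_algHom (aeval (R := K) z) p).symm

omit hz in
/-- A nonzero polynomial `p` defines a unique endomorphism of `ℙ¹`. Near `∞` it is
`[1 : s] ↦ [1 : s ^ d / H(s)]`, where `H` is the reverse of `p`. -/
lemma existsUnique_isPolynomialMap {p : K[X]} (hp : p ≠ 0) :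
    ∃! φ : P1 K ⟶ P1 K, IsPolynomialMap p φ := by
  let L := FractionRing K[X]
  let z : L := algebraMap K[X] L X
  have hz : Transcendental K z :=
    (transcendental_algebraMap_iff (IsFractionRing.injective K[X] L)).mpr
      (Polynomial.transcendental_X K)
  have hz0 : z ≠ 0 := fun h ↦ hz (by rw [h]; exact isAlgebraic_zero)
  have hzi : Transcendental K z⁻¹ := fun h ↦ hz (IsAlgebraic.inv_iff.mp h)
  let η : Spec (.of L) ⟶ P1 K := P1.point K z 1 isCoprime_one_right
  have hη : IsDominant η := isDominant_point hz
  let e : Spec (.of L) ⟶ P1 K := P1.point K (aeval z p) 1 isCoprime_one_right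
  have hη₀ : Spec.map (CommRingCat.ofHom (aeval (R := K) z).toRingHom) ≫ P1.chart K = η :=
    (point_one_right z).symm
  have he₀ : Spec.map (CommRingCat.ofHom (aeval (R := K) z).toRingHom) ≫
      Spec.map (CommRingCat.ofHom (aeval (R := K) p).toRingHom) ≫ P1.chart K = e := by
    rw [← Spec.map_comp_assoc, ← CommRingCat.ofHom_comp]
    refine Eq.trans ?_ (point_one_right (aeval z p)).symm
    congr 3
    exact congrArg AlgHom.toRingHom (aeval_algHom (aeval (R := K) z) p).symm
  have hd₀ : IsDominant (Spec.map (CommRingCat.ofHom (aeval (R := K) z).toRingHom)) :=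
    isDominant_SpecMap_aeval hz
  obtain ⟨F, hF⟩ := exists_extension_of_local η e (fun y ↦ by
    by_cases hy : y ∈ (P1.chart K).opensRange
    · exact ⟨_, P1.chart K, _, _, inferInstance, hy, hd₀, hη₀, he₀⟩
    obtain ⟨x, rfl⟩ : y ∈ (P1.chartInfty K).opensRange := (mem_range_chart_or y).resolve_left hy
    let H := p.reverse
    let B := Localization.Away H
    let ι : K[X] →ₐ[K] B := IsScalarTower.toAlgHom K K[X] B
    have hι : IsOpenImmersion (Spec.map (CommRingCat.ofHom ι.toRingHom)) :=
      IsOpenImmersion.of_isLocalization (S := B) H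
    -- the points with `H = 0` are different from `∞`, since `H(0)` is the leading coefficient
    have hH : H ∉ x.asIdeal := by
      intro hH
      apply hy
      rw [opensRange_chart]
      refine (point_preimage_basicOpenX (R := K) (1 : K[X]) X isCoprime_one_left 1).ge ?_
      change X ∉ x.asIdeal
      intro hX
      have h1 : C p.leadingCoeff ∈ x.asIdeal := by
        rw [← coeff_zero_reverse, ← add_sub_cancel_left (X * H.divX) (C (coeff H 0)),
          X_mul_divX_add]
        exact sub_mem hH (Ideal.mul_mem_right _ _ hX)
      exact x.2.ne_top (Ideal.eq_top_of_isUnit_mem _ h1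
        ((leadingCoeff_ne_zero.mpr hp).isUnit.map C))
    obtain ⟨w, hw⟩ := (PrimeSpectrum.localization_away_comap_range B H).ge hH
    have hHz : aeval z⁻¹ H ≠ 0 := aeval_ne_zero_of_transcendental hzi (by simpa [H] using hp)
    obtain ⟨ψ, hψ, hψ'⟩ := exists_algHom_away H z⁻¹ hHz
    have hpz : aeval z⁻¹ H * z ^ p.natDegree = aeval z p := by
      have := invertibleOfNonzero hz0
      have h := eval₂_reverse_mul_pow (algebraMap K L) z p
      rwa [invOf_eq_inv] at h
    refine ⟨_, Spec.map (CommRingCat.ofHom ι.toRingHom) ≫ P1.chartInfty K,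
      Spec.map (CommRingCat.ofHom ψ.toRingHom),
      P1.point K 1 (ι X ^ p.natDegree * IsLocalization.Away.invSelf H) isCoprime_one_left,
      inferInstance, ⟨w, ?_⟩, isDominant_SpecMap_away H hzi ψ hψ, ?_, ?_⟩
    · exact (Scheme.Hom.comp_apply _ _ _).trans (congrArg (P1.chartInfty K) hw)
    · rw [P1.chartInfty, SpecMap_point, SpecMap_point]
      refine point_eq_of_mul_eq_mul _ _ ?_
      rw [map_one, map_one, one_mul, show ψ (ι X) = z⁻¹ from (hψ X).trans (aeval_X _),
        mul_inv_cancel₀ hz0]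
    · rw [SpecMap_point]
      refine point_eq_of_mul_eq_mul _ _ ?_
      rw [map_one, map_mul, map_pow, show ψ (ι X) = z⁻¹ from (hψ X).trans (aeval_X _), ← hpz,
        one_mul]
      have h1 : z ^ p.natDegree * z⁻¹ ^ p.natDegree = 1 := by
        rw [← mul_pow, mul_inv_cancel₀ hz0, one_pow]
      linear_combination (-z ^ p.natDegree * z⁻¹ ^ p.natDegree) * hψ' - h1)
  have hF₀ := hF _ (P1.chart K) _ _ inferInstance hd₀ hη₀ he₀
  refine ⟨F, ⟨?_, hF₀⟩, fun φ hφ ↦ ?_⟩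
  · refine ext_of_isDominant (ι := η) ?_
    rw [← hη₀, Category.assoc, reassoc_of% hF₀, Category.assoc]
    congr 1
    rw [P1.chart, point_toSpec, ← Spec.map_comp, ← CommRingCat.ofHom_comp]
    congr 2
    exact RingHom.ext fun a ↦ aeval_C p a
  · refine ext_of_isDominant (ι := η) ?_
    rw [hφ.point_comp, ← hη₀, Category.assoc, hF₀, he₀]

end GenericPoint

/-! ### Valuations of the coefficients and rational fixed points -/

section Arithmetic

/-- A polynomial whose reduction is a nonzero constant does not vanish at any point of the special
fibre. -/
lemma add_mul_notMem {R : Type u} [CommRing R] {π : R} {q : R[X]} {β : R}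
    (hβ : IsUnit β) (I : Ideal R[X]) (hI : I ≠ ⊤)
    (h : C π ∈ I) : C β + C π * q ∉ I := fun hq ↦
  hI (Ideal.eq_top_of_isUnit_mem _
    ((Ideal.add_mem_iff_left I (Ideal.mul_mem_right _ _ h)).mp hq) (hβ.map C))

/-- The reduction of `β t³ + α t² + a t + d` has the simple root `-α / β ≠ 0`, which lifts. -/
lemma exists_unit_root {R : Type u} [CommRing R] [HenselianLocalRing R] {α β a d : R}
    (hα : IsUnit α) (hβ : IsUnit β)
    (ha : a ∈ IsLocalRing.maximalIdeal R) (hd : d ∈ IsLocalRing.maximalIdeal R) :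
    ∃ t : R, IsUnit t ∧ β * t ^ 3 + α * t ^ 2 + a * t + d = 0 := by
  obtain ⟨γ, hγ⟩ := hβ.exists_right_inv
  have hγu : IsUnit γ := .of_mul_eq_one_right β hγ
  let F : R[X] := X ^ 3 + C (γ * α) * X ^ 2 + C (γ * a) * X + C (γ * d)
  have hF : F.Monic := by
    unfold F
    monicity!
  obtain ⟨t, ht, ht'⟩ := HenselianLocalRing.is_henselian F hF (-(γ * α)) (by
      have : F.eval (-(γ * α)) = -γ ^ 2 * α * a + γ * d := by
        simp only [F, eval_add, eval_mul, eval_pow, eval_X, eval_C]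
        ring
      rw [this]
      exact add_mem (Ideal.mul_mem_left _ _ ha) (Ideal.mul_mem_left _ _ hd)) (by
      have : F.derivative.eval (-(γ * α)) = (γ * α) ^ 2 + γ * a := by
        simp [F]
        ring
      rw [this]
      by_contra h
      have h1 := (Ideal.add_mem_iff_left _ (Ideal.mul_mem_left _ γ ha)).mp
        ((IsLocalRing.mem_maximalIdeal _).mpr h)
      exact (IsLocalRing.mem_maximalIdeal _).mp h1 ((hγu.mul hα).pow 2))
  refine ⟨t, ?_, ?_⟩
  · by_contra h
    have h1 := sub_mem ((IsLocalRing.mem_maximalIdeal _).mpr h) ht'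
    rw [sub_sub_cancel, neg_mem_iff] at h1
    exact (IsLocalRing.mem_maximalIdeal _).mp h1 (hγu.mul hα)
  · have h1 : t ^ 3 + γ * α * t ^ 2 + γ * a * t + γ * d = 0 := by
      simpa [F, IsRoot] using ht
    linear_combination β * h1 - (α * t ^ 2 + a * t + d) * hγ

variable {R : Type u} [CommRing R] [IsDomain R] [IsDiscreteValuationRing R]
  {π : R} (hπ : Irreducible π)
include hπ

lemma exists_eq_pow_mul_unit_of_addVal {a : R} {k : ℕ}
    (h : IsDiscreteValuationRing.addVal R a = (k : ℕ∞)) : ∃ β : R, IsUnit β ∧ a = π ^ k * β := by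
  have ha : a ≠ 0 := by
    rintro rfl
    simp at h
  obtain ⟨m, u, rfl⟩ := IsDiscreteValuationRing.eq_unit_mul_pow_irreducible ha hπ
  rw [IsDiscreteValuationRing.addVal_def' u hπ m] at h
  obtain rfl : m = k := by exact_mod_cast h
  exact ⟨u, u.isUnit, mul_comm _ _⟩

lemma dvd_of_mem_maximalIdeal {a : R} (h : a ∈ IsLocalRing.maximalIdeal R) : π ∣ a := by
  rwa [hπ.maximalIdeal_eq, Ideal.mem_span_singleton] at h

variable {K : Type u} [Field K] [Algebra R K] [IsFractionRing R K]

/-- If `v(a₃) = 2`, then `v(a₂) ≥ 2`: otherwise the Newton polygon of `f(z) - πⁿz` has a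
segment of length one, and Hensel's lemma gives a rational fixed point. -/
lemma sq_dvd_of_irreducible [HenselianLocalRing R] {n : ℕ} (hn : 2 ≤ n) {c a₁ a₂ β : R}
    (hc : c ≠ 0) (ha₁ : a₁ ∈ IsLocalRing.maximalIdeal R) (ha₂ : a₂ ∈ IsLocalRing.maximalIdeal R)
    (hβ : IsUnit β) {p : K[X]}
    (hp : p = C ((algebraMap R K π ^ n)⁻¹) *
      (C c * X ^ 3 + C a₁ * X ^ 2 + C a₂ * X + C (π ^ 2 * β) : R[X]).map (algebraMap R K))
    (hirr : Irreducible (p - X)) : π ^ 2 ∣ a₂ := by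
  obtain ⟨α, rfl⟩ := dvd_of_mem_maximalIdeal hπ ha₂
  rw [pow_two]
  refine mul_dvd_mul_left π (dvd_of_mem_maximalIdeal hπ ?_)
  rw [IsLocalRing.mem_maximalIdeal, mem_nonunits_iff]
  intro hα
  have hπm : π ∈ IsLocalRing.maximalIdeal R := hπ.not_isUnit
  obtain ⟨m, rfl⟩ := Nat.exists_eq_add_of_le' hn
  have hα' : IsUnit (α - π ^ (m + 1)) := by
    by_contra h
    have h1 := add_mem ((IsLocalRing.mem_maximalIdeal _).mpr h)
      (Ideal.pow_mem_of_mem _ hπm (m + 1) m.succ_pos)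
    rw [sub_add_cancel] at h1
    exact (IsLocalRing.mem_maximalIdeal _).mp h1 hα
  obtain ⟨t, ht, e⟩ := exists_unit_root hα' hβ ha₁ (Ideal.mul_mem_left _ c hπm)
  have hπ0 : algebraMap R K π ≠ 0 := (isUnit_algebraMap_uniformizer hπ).ne_zero
  have ht0 : algebraMap R K t ≠ 0 := (ht.map _).ne_zero
  have hc0 : algebraMap R K c ≠ 0 := (map_ne_zero_iff _ (IsFractionRing.injective R K)).mpr hc
  have e' := congrArg (algebraMap R K) e
  simp only [map_add, map_mul, map_sub, map_pow, map_zero] at e'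
  have hroot : (p - X).IsRoot (algebraMap R K π / algebraMap R K t) := by
    rw [IsRoot, eval_sub, hp]
    simp only [Polynomial.map_add, Polynomial.map_mul, Polynomial.map_pow, map_X, map_C, eval_add,
      eval_mul, eval_pow, eval_X, eval_C, map_mul, map_pow]
    field_simp
    linear_combination algebraMap R K π ^ 2 * e'
  have hdeg := degree_eq_one_of_irreducible_of_root hirr hroot
  have h3 : (p - X).coeff 3 = (algebraMap R K π ^ (m + 2))⁻¹ * algebraMap R K c := by
    rw [hp]
    simp [coeff_X, -map_mul, -map_pow]
  have h4 : (p - X).coeff 3 = 0 := coeff_eq_zero_of_degree_lt (by rw [hdeg]; decide)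
  exact mul_ne_zero (inv_ne_zero (pow_ne_zero _ hπ0)) hc0 (h3.symm.trans h4)

end Arithmetic

/-! ### The two affine lines covering the smooth locus -/

section SmoothCharts

lemma isPullback_of_comp_mono {𝒞 : Type*} [Category 𝒞] {A B D E M : 𝒞}
    {f : A ⟶ B} {g : A ⟶ D} {h : B ⟶ E} {k : D ⟶ E} (hP : IsPullback f g h k)
    {f' : A ⟶ M} {i : M ⟶ B} [Mono i] (hf : f' ≫ i = f) {h' : M ⟶ E} (hh : i ≫ h = h') :
    IsPullback f' g h' k := by
  refine ⟨⟨by rw [← hh, reassoc_of% hf, hP.w]⟩, ⟨PullbackCone.IsLimit.mk _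
    (fun s ↦ hP.lift (s.fst ≫ i) s.snd (by rw [Category.assoc, hh, s.condition]))
    (fun s ↦ ?_) (fun s ↦ hP.lift_snd _ _ _) (fun s l h h' ↦ ?_)⟩⟩
  · rw [← cancel_mono i, Category.assoc, hf, hP.lift_fst]
  · apply hP.hom_ext
    · rw [hP.lift_fst, ← h, Category.assoc, hf]
    · rw [hP.lift_snd, h']

/-- The charts of the smooth locus `V` of the blow-up: `V` is covered by two affine lines, with
coordinates `z / π` (over `z ≠ ∞`) and `1 / z` (over `z ≠ 0`), and `j` is its generic fibre. By
`eq_comp`, a morphism to `V` with values in the generic fibre is determined by its composition with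
`b : V ⟶ ℙ¹`. -/
structure HasSmoothCharts {R : Type u} [CommRing R] (π : R) (K : Type u) [CommRing K] [Algebra R K]
    {V : Scheme.{u}} (b : V ⟶ P1 R) (j : P1 K ⟶ V) (c₀ c₂ : Spec (.of R[X]) ⟶ V) : Prop where
  isOpenImmersion₀ : IsOpenImmersion c₀
  isOpenImmersion₂ : IsOpenImmersion c₂
  comp₀ : c₀ ≫ b = P1.point R (C π * X) 1 isCoprime_one_right
  comp₂ : c₂ ≫ b = P1.point R 1 X isCoprime_one_left
  cover (y : V) : y ∈ Set.range c₀ ∨ y ∈ Set.range c₂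
  comp_eq_baseChange : j ≫ b = P1.baseChange R K
  eq_comp {T : Scheme.{u}} (f : T ⟶ P1 K) (l : T ⟶ V) (h : l ≫ b = f ≫ P1.baseChange R K) :
    l = f ≫ j
  isPullback : IsPullback j (P1.toSpec K) (b ≫ P1.toSpec R)
    (Spec.map (CommRingCat.ofHom (algebraMap R K)))

section

variable {R : Type u} [CommRing R] [IsDomain R] [IsLocalRing R] {π : R}
  {K : Type u} [Field K] [Algebra R K]

/-- The charts `c₀` and `c₂` and the generic fibre of the blow-up lie in the smooth locus. -/
lemma IsBlowUp.exists_smoothCharts (hπK : IsUnit (algebraMap R K π))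
    (hm : IsLocalRing.maximalIdeal R = Ideal.span {π}) (hπ : π ≠ 0)
    {Y : Scheme.{u}} {b : Y ⟶ P1 R} (hb : IsBlowUp (P1.zeroPoint R).ker b)
    {c₀ : Spec (.of R[X]) ⟶ Y} {c₁ : Spec (.of (NodeRing π)) ⟶ Y} {c₂ : Spec (.of R[X]) ⟶ Y}
    (hc : HasBlowUpCharts π b c₀ c₁ c₂) [LocallyOfFinitePresentation (b ≫ P1.toSpec R)]
    {j : P1 K ⟶ Y} (hj : j ≫ b = P1.baseChange R K) :
    ∃ (j' : P1 K ⟶ (b ≫ P1.toSpec R).smoothLocus) (c₀' c₂' : Spec (.of R[X]) ⟶ _),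
      HasSmoothCharts π K ((b ≫ P1.toSpec R).smoothLocus.ι ≫ b) j' c₀' c₂' ∧
      j' ≫ (b ≫ P1.toSpec R).smoothLocus.ι = j := by
  have hs := hc.coe_smoothLocus hm hπ hb
  have := hc.isOpenImmersion₀
  have := hc.isOpenImmersion₂
  let ι := (b ≫ P1.toSpec R).smoothLocus.ι
  have hι : Set.range ι = Set.range c₀ ∪ Set.range c₂ := by rw [← hs]; simp [ι]
  have hjι : Set.range j ⊆ Set.range ι := by
    rw [hι]
    rintro _ ⟨y, rfl⟩
    rcases mem_range_chart_or y with ⟨x, rfl⟩ | ⟨x, rfl⟩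
    · have e : P1.chart K ≫ j = Spec.map (CommRingCat.ofHom
          (aeval (R := R) (C (algebraMap R K π)⁻¹ * X : K[X])).toRingHom) ≫ c₀ := by
        refine (hb.eq_comp_genericFibre hπK hm hj _ _ ?_).symm
        rw [Category.assoc, hc.comp₀, SpecMap_point, P1.chart, point_baseChange]
        refine point_eq_of_mul_eq_mul _ _ ?_
        rw [map_one, mul_one, mul_one, map_mul, aeval_C, aeval_X, ← mul_assoc,
          IsScalarTower.algebraMap_apply R K K[X], algebraMap_eq, ← C_mul,
          mul_inv_cancel₀ hπK.ne_zero, C_1, one_mul]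
      exact Or.inl (mem_range_of_comp_eq e x)
    · have e : P1.chartInfty K ≫ j = Spec.map (CommRingCat.ofHom
          (aeval (R := R) (X : K[X])).toRingHom) ≫ c₂ := by
        refine (hb.eq_comp_genericFibre hπK hm hj _ _ ?_).symm
        rw [Category.assoc, hc.comp₂, SpecMap_point, P1.chartInfty, point_baseChange]
        refine point_eq_of_mul_eq_mul _ _ ?_
        rw [map_one, aeval_X]
      exact Or.inr (mem_range_of_comp_eq e x)
  have h₀ : Set.range c₀ ⊆ Set.range ι := hι ▸ Set.subset_union_left
  have h₂ : Set.range c₂ ⊆ Set.range ι := hι ▸ Set.subset_union_right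
  let j' := IsOpenImmersion.lift ι j hjι
  let c₀' := IsOpenImmersion.lift ι c₀ h₀
  let c₂' := IsOpenImmersion.lift ι c₂ h₂
  have hj' : j' ≫ ι = j := IsOpenImmersion.lift_fac _ _ _
  have hc₀' : c₀' ≫ ι = c₀ := IsOpenImmersion.lift_fac _ _ _
  have hc₂' : c₂' ≫ ι = c₂ := IsOpenImmersion.lift_fac _ _ _
  have i₀ : IsOpenImmersion (c₀' ≫ ι) := by rwa [hc₀']
  have i₂ : IsOpenImmersion (c₂' ≫ ι) := by rwa [hc₂']
  have heq {T : Scheme.{u}} (f : T ⟶ P1 K) (l : T ⟶ (b ≫ P1.toSpec R).smoothLocus)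
      (h : l ≫ ι ≫ b = f ≫ P1.baseChange R K) : l = f ≫ j' := by
    rw [← cancel_mono ι, Category.assoc, hj']
    exact hb.eq_comp_genericFibre hπK hm hj _ _ (by rw [Category.assoc, h])
  refine ⟨j', c₀', c₂', ⟨.of_comp _ ι, .of_comp _ ι, ?_, ?_, fun y ↦ ?_, ?_, heq, ?_⟩, hj'⟩
  · rw [reassoc_of% hc₀', hc.comp₀]
  · rw [reassoc_of% hc₂', hc.comp₂]
  · have hinj : Function.Injective ι := ι.isOpenEmbedding.injective
    rcases hι.le ⟨y, rfl⟩ with ⟨x, hx⟩ | ⟨x, hx⟩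
    · refine Or.inl ⟨x, hinj ?_⟩
      rw [← hx, ← Scheme.Hom.comp_apply, hc₀']
    · refine Or.inr ⟨x, hinj ?_⟩
      rw [← hx, ← Scheme.Hom.comp_apply, hc₂']
  · rw [reassoc_of% hj', hj]
  · exact isPullback_of_comp_mono (hb.isPullback_genericFibre hπK hm hj) hj'
      (Category.assoc _ _ _).symm

end

section

variable {R : Type u} [CommRing R] {π : R} {K : Type u} [Field K] [Algebra R K]
  {V : Scheme.{u}} {b : V ⟶ P1 R} {j : P1 K ⟶ V} {c₀ c₂ : Spec (.of R[X]) ⟶ V}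
  (hV : HasSmoothCharts π K b j c₀ c₂)
include hV

lemma HasSmoothCharts.isReduced [IsDomain R] : IsReduced V := by
  refine isReduced_of_local fun y ↦ ?_
  rcases hV.cover y with hy | hy
  · exact ⟨_, c₀, hV.isOpenImmersion₀, hy, inferInstance⟩
  · exact ⟨_, c₂, hV.isOpenImmersion₂, hy, inferInstance⟩

lemma HasSmoothCharts.compactSpace : CompactSpace V := by
  have h : Set.range c₀ ∪ Set.range c₂ = Set.univ := Set.eq_univ_of_forall hV.cover
  rw [← isCompact_univ_iff, ← h]
  exact (isCompact_range c₀.continuous).union (isCompact_range c₂.continuous)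

section

variable {L : Type u} [CommRing L] [Algebra K L] [Algebra R L] [IsScalarTower R K L]

/-- A point `[x : y]` of the generic fibre, in the coordinate `z / π`. -/
lemma HasSmoothCharts.point_comp_eq₀ {x y : L} (hxy : IsCoprime x y) (ζ : L)
    (h : algebraMap R L π * ζ * y = x) :
    Spec.map (CommRingCat.ofHom (aeval (R := R) ζ).toRingHom) ≫ c₀ = P1.point K x y hxy ≫ j := by
  refine hV.eq_comp _ _ ?_
  rw [Category.assoc, hV.comp₀, SpecMap_point, point_baseChange]
  refine point_eq_of_mul_eq_mul _ _ ?_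
  rw [map_one, mul_one, map_mul, aeval_C, aeval_X, h]

/-- A point `[x : y]` of the generic fibre, in the coordinate `1 / z`. -/
lemma HasSmoothCharts.point_comp_eq₂ {x y : L} (hxy : IsCoprime x y) (ζ : L)
    (h : x * ζ = y) :
    Spec.map (CommRingCat.ofHom (aeval (R := R) ζ).toRingHom) ≫ c₂ = P1.point K x y hxy ≫ j := by
  refine hV.eq_comp _ _ ?_
  rw [Category.assoc, hV.comp₂, SpecMap_point, point_baseChange]
  refine point_eq_of_mul_eq_mul _ _ ?_
  rw [map_one, one_mul, aeval_X, h]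

end

lemma HasSmoothCharts.isOpenImmersion [IsLocalization.Away π K] : IsOpenImmersion j := by
  have : IsOpenImmersion (Spec.map (CommRingCat.ofHom (algebraMap R K))) :=
    IsOpenImmersion.of_isLocalization π
  exact MorphismProperty.of_isPullback hV.isPullback.flip this

/-- The points of a chart where `π` is invertible lie in the generic fibre. -/
lemma HasSmoothCharts.mem_range_of_notMem [IsLocalization.Away π K] (c : Spec (.of R[X]) ⟶ V)
    (hc : c ≫ b ≫ P1.toSpec R = Spec.map (CommRingCat.ofHom (algebraMap R R[X])))
    (x : Spec (.of R[X])) (hx : C π ∉ x.asIdeal) : c x ∈ Set.range j := by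
  obtain ⟨w, hw⟩ := (PrimeSpectrum.localization_away_comap_range K π).ge
    (show PrimeSpectrum.comap (algebraMap R R[X]) x ∈ PrimeSpectrum.basicOpen π from hx)
  obtain ⟨p, hp, -⟩ := AlgebraicGeometry.Scheme.exists_preimage_of_isPullback hV.isPullback (c x) w
    ((Scheme.Hom.comp_apply _ _ _).symm.trans ((congrArg (fun f ↦ f x) hc).trans hw.symm))
  exact ⟨p, hp⟩

end

end SmoothCharts

/-! ### Extension of rational maps -/

section Extension

/-- A rational map between two affine lines `c` and `c'` in `V` that is given by the fraction
`q / G` is defined at the points of `c` where `G` does not vanish. Here `ζ` and `ξ` are the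
coordinates of the generic point `η` and of its image `e`. -/
lemma exists_local_extension {R L : Type u} [CommRing R] [Field L] [Algebra R L]
    {V : Scheme.{u}} {c c' : Spec (.of R[X]) ⟶ V} (hc : IsOpenImmersion c) {ζ ξ : L}
    (hζ : Transcendental R ζ) {η e : Spec (.of L) ⟶ V}
    (hη : Spec.map (CommRingCat.ofHom (aeval (R := R) ζ).toRingHom) ≫ c = η)
    (he : Spec.map (CommRingCat.ofHom (aeval (R := R) ξ).toRingHom) ≫ c' = e)
    (x : Spec (.of R[X])) (G q : R[X]) (hG : G ∉ x.asIdeal) (h : ξ * aeval ζ G = aeval ζ q) :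
    ∃ (W : Scheme.{u}) (w : W ⟶ V) (t : Spec (.of L) ⟶ W) (m : W ⟶ V),
      IsOpenImmersion w ∧ c x ∈ Set.range w ∧ IsDominant t ∧ t ≫ w = η ∧ t ≫ m = e := by
  have hG0 : aeval ζ G ≠ 0 := fun h ↦ hG (by
    rw [(transcendental_iff.mp hζ) G h]
    exact zero_mem _)
  obtain ⟨ψ, hψ, hψ'⟩ := exists_algHom_away G ζ hG0
  let B := Localization.Away G
  let ι : R[X] →ₐ[R] B := IsScalarTower.toAlgHom R R[X] B
  have hι : IsOpenImmersion (Spec.map (CommRingCat.ofHom ι.toRingHom)) :=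
    IsOpenImmersion.of_isLocalization (S := B) G
  obtain ⟨w, hw⟩ := (PrimeSpectrum.localization_away_comap_range B G).ge hG
  refine ⟨_, Spec.map (CommRingCat.ofHom ι.toRingHom) ≫ c, Spec.map (CommRingCat.ofHom ψ.toRingHom),
    Spec.map (CommRingCat.ofHom (aeval (R := R)
      (ι q * IsLocalization.Away.invSelf G : B)).toRingHom) ≫ c', inferInstance, ⟨w, ?_⟩,
    isDominant_SpecMap_away G hζ ψ hψ, ?_, ?_⟩
  · exact (Scheme.Hom.comp_apply _ _ _).trans (congrArg c hw)
  · rw [← hη, ← Spec.map_comp_assoc, ← CommRingCat.ofHom_comp]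
    congr 3
    exact RingHom.ext hψ
  · rw [← he, ← Spec.map_comp_assoc, ← CommRingCat.ofHom_comp]
    congr 3
    refine (congrArg AlgHom.toRingHom (aeval_algHom ψ _).symm).trans ?_
    congr 2
    rw [map_mul, show ψ (ι q) = aeval ζ q from hψ q, ← h, mul_assoc, hψ', mul_one]

end Extension

/-! ### Extension of `φ` to the smooth locus -/

section Dynamics

lemma isLocalization_away_uniformizer {R : Type u} [CommRing R] [IsDomain R]
    [IsDiscreteValuationRing R] {π : R} (hπ : Irreducible π) (K : Type u) [Field K] [Algebra R K]
    [IsFractionRing R K] : IsLocalization.Away π K := by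
  have hu := isUnit_algebraMap_uniformizer hπ (K := K)
  have hinj := IsFractionRing.injective R K
  refine ⟨?_, ?_, ?_⟩
  · rintro ⟨_, n, rfl⟩
    simpa using hu.pow n
  · intro ζ
    obtain ⟨a, s, hs, rfl⟩ := IsFractionRing.div_surjective (A := R) ζ
    have hs0 := nonZeroDivisors.ne_zero hs
    obtain ⟨m, u, rfl⟩ := IsDiscreteValuationRing.eq_unit_mul_pow_irreducible hs0 hπ
    obtain ⟨v, hv⟩ := u.isUnit.exists_right_inv
    refine ⟨(v * a, ⟨π ^ m, m, rfl⟩), ?_⟩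
    have hv' := congrArg (algebraMap R K) hv
    have h1 := (u.isUnit.map (algebraMap R K)).ne_zero
    have h2 := hu.ne_zero
    simp only [map_mul, map_pow, map_one] at hv' ⊢
    field_simp
    linear_combination (-algebraMap R K a) * hv'
  · intro x y h
    exact ⟨1, by rw [hinj h]⟩

variable {R : Type u} [CommRing R] [IsDomain R] {π : R} {K : Type u} [Field K]
  [Algebra R K] [IsFractionRing R K] [IsLocalization.Away π K]
  {V : Scheme.{u}} {b : V ⟶ P1 R} {j : P1 K ⟶ V} {c₀ c₂ : Spec (.of R[X]) ⟶ V}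

/-- The extension of `φ = f / πⁿ` to `V`. Near a point of the special fibre, it is given by
`1 / z ↦ 1 / φ(z)` in the second chart. In the first one, with `w = z / π`, it is `w ↦ φ(πw) / π` if
this is integral, and `w ↦ 1 / φ(πw)` if `f(πw) / πʳ` reduces to a nonzero constant with `r ≤ n`.

The field `L` and its element `z` only serve to describe the generic point of `V`. -/
theorem HasSmoothCharts.exists_extension (hV : HasSmoothCharts π K b j c₀ c₂) [V.IsSeparated]
    {L : Type u} [Field L] [Algebra K L] [Algebra R L] [IsScalarTower R K L]
    {z : L} (hz : Transcendental K z)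
    {n : ℕ} {c b₁ b₂ b₃ : R} (hc : IsUnit c)
    {f : R[X]} (hf : f = C c * X ^ 3 + C (π * b₁) * X ^ 2 + C (π * b₂) * X + C (π * b₃))
    (hcase : (∃ g : R[X], f.comp (C π * X) = C (π ^ (n + 1)) * g) ∨
      ∃ (r : ℕ) (β : R) (q : R[X]), r ≤ n ∧ IsUnit β ∧
        f.comp (C π * X) = C (π ^ r) * (C β + C π * q))
    {p : K[X]} (hp : p = C ((algebraMap R K π ^ n)⁻¹) * f.map (algebraMap R K))
    {φ : P1 K ⟶ P1 K} (hφ : IsPolynomialMap p φ) :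
    ∃ Φ : V ⟶ V, j ≫ Φ = φ ≫ j ∧ Φ ≫ b ≫ P1.toSpec R = b ≫ P1.toSpec R := by
  have hinj := IsFractionRing.injective R K
  have hπK : algebraMap R K π ≠ 0 := (IsLocalization.Away.algebraMap_isUnit π).ne_zero
  have hϖ : algebraMap R L π ≠ 0 := by
    rwa [IsScalarTower.algebraMap_apply R K L, _root_.map_ne_zero]
  have hz0 : z ≠ 0 := fun h ↦ hz (by rw [h]; exact isAlgebraic_zero)
  have htr {ζ : L} (h : IsAlgebraic K ζ → IsAlgebraic K z) : Transcendental R ζ :=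
    fun h' ↦ hz (h (h'.extendScalars hinj))
  have hζ₀ : Transcendental R (z / algebraMap R L π) := htr fun h ↦ by
    have := h.mul (isAlgebraic_algebraMap (A := L) (algebraMap R K π))
    rwa [← IsScalarTower.algebraMap_apply, div_mul_cancel₀ _ hϖ] at this
  have hζ₂ : Transcendental R z⁻¹ := htr IsAlgebraic.inv_iff.mp
  have hP : algebraMap R L π ^ n * aeval z p = aeval z f := by
    rw [hp, map_mul, aeval_C, aeval_map_algebraMap, map_inv₀, map_pow,
      ← IsScalarTower.algebraMap_apply, mul_inv_cancel_left₀ (pow_ne_zero _ hϖ)]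
  have hP0 : aeval z p ≠ 0 := by
    refine aeval_ne_zero_of_transcendental hz ?_
    rintro rfl
    have h3 : f.coeff 3 = c := by simp [hf, -map_mul]
    have h0 : f.map (algebraMap R K) = 0 := by
      simpa [hπK] using hp.symm
    rw [(Polynomial.map_eq_zero_iff hinj).mp h0, coeff_zero] at h3
    exact hc.ne_zero h3.symm
  let η₀ : Spec (.of L) ⟶ P1 K := P1.point K z 1 isCoprime_one_right
  have hη₀ : IsDominant η₀ := isDominant_point hz
  let η : Spec (.of L) ⟶ V := η₀ ≫ j
  let e : Spec (.of L) ⟶ V := P1.point K (aeval z p) 1 isCoprime_one_right ≫ j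
  have he : η₀ ≫ φ ≫ j = e := by rw [reassoc_of% hφ.point_comp]
  have hd₀ : Spec.map (CommRingCat.ofHom (aeval (R := R) (z / algebraMap R L π)).toRingHom) ≫ c₀ =
      η := hV.point_comp_eq₀ _ _ (by rw [mul_div_cancel₀ _ hϖ, mul_one])
  have hd₂ : Spec.map (CommRingCat.ofHom (aeval (R := R) z⁻¹).toRingHom) ≫ c₂ = η :=
    hV.point_comp_eq₂ _ _ (mul_inv_cancel₀ hz0)
  have he₀ : Spec.map (CommRingCat.ofHom
      (aeval (R := R) (aeval z p / algebraMap R L π)).toRingHom) ≫ c₀ = e :=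
    hV.point_comp_eq₀ _ _ (by rw [mul_div_cancel₀ _ hϖ, mul_one])
  have he₂ : Spec.map (CommRingCat.ofHom (aeval (R := R) (aeval z p)⁻¹).toRingHom) ≫ c₂ = e :=
    hV.point_comp_eq₂ _ _ (mul_inv_cancel₀ hP0)
  have hj := hV.isOpenImmersion
  have hred := hV.isReduced
  have hfibre (c : Spec (.of R[X]) ⟶ V)
      (hc : c ≫ b ≫ P1.toSpec R = Spec.map (CommRingCat.ofHom (algebraMap R R[X])))
      (x : Spec (.of R[X])) (hx : C π ∉ x.asIdeal) :
      ∃ (W : Scheme.{u}) (w : W ⟶ V) (t : Spec (.of L) ⟶ W) (m : W ⟶ V),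
        IsOpenImmersion w ∧ c x ∈ Set.range w ∧ IsDominant t ∧ t ≫ w = η ∧ t ≫ m = e :=
    ⟨_, j, η₀, φ ≫ j, hj, hV.mem_range_of_notMem c hc x hx, hη₀, rfl, he⟩
  have hfz : aeval (z / algebraMap R L π) (f.comp (C π * X)) = aeval z f := by
    rw [aeval_comp, map_mul, aeval_C, aeval_X, mul_div_cancel₀ _ hϖ]
  have hloc (y : V) : ∃ (W : Scheme.{u}) (w : W ⟶ V) (t : Spec (.of L) ⟶ W) (m : W ⟶ V),
      IsOpenImmersion w ∧ y ∈ Set.range w ∧ IsDominant t ∧ t ≫ w = η ∧ t ≫ m = e := by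
    rcases hV.cover y with ⟨x, rfl⟩ | ⟨x, rfl⟩
    · by_cases hx : C π ∈ x.asIdeal
      · rcases hcase with ⟨g, hg⟩ | ⟨r, β, q, hr, hβ, hq⟩
        · refine exists_local_extension hV.isOpenImmersion₀ hζ₀ hd₀ he₀ x 1 g
            ((Ideal.ne_top_iff_one _).mp x.2.ne_top) ?_
          rw [hg, ← hP, map_mul, aeval_C, map_pow] at hfz
          rw [map_one, mul_one]
          apply mul_left_cancel₀ (pow_ne_zero (n + 1) hϖ)
          rw [hfz]
          field_simp
          ring
        · refine exists_local_extension hV.isOpenImmersion₀ hζ₀ hd₀ he₂ x (C β + C π * q)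
            (C (π ^ (n - r))) (add_mul_notMem hβ _ x.2.ne_top hx) ?_
          obtain ⟨k, rfl⟩ := Nat.exists_eq_add_of_le hr
          rw [hq, ← hP, map_mul, aeval_C, map_pow] at hfz
          rw [aeval_C, map_pow, Nat.add_sub_cancel_left]
          apply mul_left_cancel₀ (pow_ne_zero r hϖ)
          rw [mul_left_comm, hfz]
          field_simp
          ring
      · exact hfibre c₀ (by rw [reassoc_of% hV.comp₀, point_toSpec]) x hx
    · by_cases hx : C π ∈ x.asIdeal
      · refine exists_local_extension hV.isOpenImmersion₂ hζ₂ hd₂ he₂ x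
          (C c + C π * (C b₁ * X + C b₂ * X ^ 2 + C b₃ * X ^ 3)) (C (π ^ n) * X ^ 3)
          (add_mul_notMem hc _ x.2.ne_top hx) ?_
        simp only [hf, map_add, map_mul, map_pow, aeval_C, aeval_X] at hP ⊢
        field_simp
        linear_combination -hP
      · exact hfibre c₂ (by rw [reassoc_of% hV.comp₂, point_toSpec]) x hx
  obtain ⟨Φ, hΦ⟩ := exists_extension_of_local η e hloc
  have hj' : j ≫ Φ = φ ≫ j := hΦ _ j η₀ _ hj hη₀ rfl he
  refine ⟨Φ, hj', ?_⟩
  have hη : IsDominant η := isDominant_of_local η fun y ↦ by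
    obtain ⟨W, w, t, -, -, hy, ht, hw, -⟩ := hloc y
    exact ⟨W, w, t, hy, ht, hw⟩
  refine ext_of_isDominant (ι := η) ?_
  rw [Category.assoc, reassoc_of% hj', hV.isPullback.w, reassoc_of% hφ.comp_toSpec, Category.assoc,
    hV.isPullback.w]

end Dynamics

/-! ### The weak Néron model -/

section WeakNeronModel

lemma smooth_smoothLocus_ι_comp {X S : Scheme.{u}} (f : X ⟶ S) [LocallyOfFinitePresentation f] :
    Smooth (f.smoothLocus.ι ≫ f) := by
  rw [← Scheme.Hom.smoothLocus_eq_top_iff, ← Scheme.Hom.preimage_smoothLocus_eq,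
    Scheme.Opens.ι_preimage_self]

/-- The normalization of `φ = f / πⁿ`, expressed by the polynomial `f(πw)`: either it is divisible
by `πⁿ⁺¹`, or for some `r ≤ n` it is `πʳ` times a polynomial that reduces to a nonzero
constant. -/
lemma comp_eq_of_normalized {R : Type u} [CommRing R] [IsDomain R] [IsDiscreteValuationRing R]
    [HenselianLocalRing R] {K : Type u} [Field K] [Algebra R K] [IsFractionRing R K]
    {π : R} (hπ : Irreducible π) {n l r : ℕ} (hn : 1 ≤ n) (hr : r < 3)
    {c a₁ a₂ a₃ : R} (hc : IsUnit c)
    (ha₁ : a₁ ∈ IsLocalRing.maximalIdeal R) (ha₂ : a₂ ∈ IsLocalRing.maximalIdeal R)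
    (ha₃ : a₃ ∈ IsLocalRing.maximalIdeal R)
    (hv : IsDiscreteValuationRing.addVal R a₃ = ((3 * l + r : ℕ) : ℕ∞))
    (hnorm : (l = 0 ∧ 2 * r ≤ 3 * n) ∨ (n = 1 ∧ 3 * n < 6 * l + 2 * r))
    {f : R[X]} (hf : f = C c * X ^ 3 + C a₁ * X ^ 2 + C a₂ * X + C a₃) {p : K[X]}
    (hp : p = C ((algebraMap R K π ^ n)⁻¹) * f.map (algebraMap R K))
    (hirr : Irreducible (p - X)) :
    (∃ g : R[X], f.comp (C π * X) = C (π ^ (n + 1)) * g) ∨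
      ∃ (r : ℕ) (β : R) (q : R[X]), r ≤ n ∧ IsUnit β ∧
        f.comp (C π * X) = C (π ^ r) * (C β + C π * q) := by
  obtain ⟨β, hβ, rfl⟩ := exists_eq_pow_mul_unit_of_addVal hπ hv
  obtain ⟨b₁, rfl⟩ := dvd_of_mem_maximalIdeal hπ ha₁
  rcases hnorm with ⟨rfl, h⟩ | ⟨rfl, h⟩
  · right
    rw [mul_zero, zero_add] at ha₃ hf
    interval_cases r
    · -- `r = 0` contradicts `v(a₃) > 0`
      rw [pow_zero, one_mul, IsLocalRing.mem_maximalIdeal] at ha₃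
      exact (ha₃ hβ).elim
    · obtain ⟨b₂, rfl⟩ := dvd_of_mem_maximalIdeal hπ ha₂
      refine ⟨1, β, C (c * π) * X ^ 3 + C (b₁ * π) * X ^ 2 + C b₂ * X, hn, hβ, ?_⟩
      rw [hf]
      simp
      ring
    · -- `2 r ≤ 3 n` gives `n ≥ 2`, and irreducibility gives `π² ∣ a₂`
      obtain ⟨b₂, rfl⟩ := sq_dvd_of_irreducible hπ (by omega) hc.ne_zero ha₁ ha₂ hβ (hf ▸ hp) hirr
      refine ⟨2, β, C c * X ^ 3 + C b₁ * X ^ 2 + C b₂ * X, by omega, hβ, ?_⟩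
      rw [hf]
      simp
      ring
  · -- `n = 1`, and `3 < 6 l + 2 r` gives `v(a₃) ≥ 2`
    left
    obtain ⟨b₂, rfl⟩ := dvd_of_mem_maximalIdeal hπ ha₂
    obtain ⟨k, hk⟩ := Nat.exists_eq_add_of_le (show 2 ≤ 3 * l + r by omega)
    rw [hk] at hf
    refine ⟨C (c * π) * X ^ 3 + C (π * b₁) * X ^ 2 + C b₂ * X + C (π ^ k * β), ?_⟩
    rw [hf]
    simp
    ring

variable {R : Type u} [CommRing R] [IsDomain R] [IsDiscreteValuationRing R]
  {K : Type u} [Field K] [Algebra R K] [IsFractionRing R K] {π : R} (hπ : Irreducible π)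
  {n : ℕ} {c b₁ b₂ b₃ : R} (hc : IsUnit c)
  {f : R[X]} (hf : f = C c * X ^ 3 + C (π * b₁) * X ^ 2 + C (π * b₂) * X + C (π * b₃))
  {p : K[X]} (hp : p = C ((algebraMap R K π ^ n)⁻¹) * f.map (algebraMap R K))
  (hcase : (∃ g : R[X], f.comp (C π * X) = C (π ^ (n + 1)) * g) ∨
    ∃ (r : ℕ) (β : R) (q : R[X]), r ≤ n ∧ IsUnit β ∧
      f.comp (C π * X) = C (π ^ r) * (C β + C π * q))
  {φ : P1 K ⟶ P1 K} (hφ : IsPolynomialMap p φ)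
  {Y : Scheme.{u}} {b : Y ⟶ P1 R} (hb : IsBlowUp (P1.zeroPoint R).ker b)
include hπ hc hf hp hcase hφ hb

/-- The smooth locus of the blow-up is a weak Néron model. -/
theorem IsBlowUp.isWeakNeronModel : ∃ (_ : LocallyOfFinitePresentation (b ≫ P1.toSpec R))
    (j : P1 K ⟶ (b ≫ P1.toSpec R).smoothLocus)
    (Φ : ((b ≫ P1.toSpec R).smoothLocus : Scheme.{u}) ⟶ (b ≫ P1.toSpec R).smoothLocus),
    j ≫ (b ≫ P1.toSpec R).smoothLocus.ι ≫ b = P1.baseChange R K ∧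
    IsWeakNeronModel R K φ ((b ≫ P1.toSpec R).smoothLocus.ι ≫ b ≫ P1.toSpec R) j Φ := by
  have hm := hπ.maximalIdeal_eq
  have hπK := isUnit_algebraMap_uniformizer hπ (K := K)
  have := isLocalization_away_uniformizer hπ K
  obtain ⟨hsep, c₀, c₁, c₂, hbc⟩ := hb.exists_charts hm hπ.ne_zero
  have hfp := hbc.locallyOfFinitePresentation
  obtain ⟨j₀, hj₀⟩ := hb.exists_genericFibre hπK hm
  obtain ⟨j, d₀, d₂, hV, hj⟩ := hb.exists_smoothCharts hπK hm hπ.ne_zero hbc hj₀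
  let s := b ≫ P1.toSpec R
  have hs : IsSeparated (s.smoothLocus.ι ≫ s) := inferInstance
  have hVsep : (s.smoothLocus : Scheme.{u}).IsSeparated := by
    constructor
    rw [← terminal.comp_from (s.smoothLocus.ι ≫ s)]
    infer_instance
  have hsm : Smooth (s.smoothLocus.ι ≫ s) := smooth_smoothLocus_ι_comp s
  obtain ⟨Φ, hΦ, hΦs⟩ := hV.exists_extension (L := FractionRing K[X])
    ((transcendental_algebraMap_iff (IsFractionRing.injective K[X] (FractionRing K[X]))).mpr
      (Polynomial.transcendental_X K)) hc hf hcase hp hφ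
  have hcomp := hV.compactSpace
  refine ⟨hfp, j, Φ, hV.comp_eq_baseChange, hsm, hs, inferInstance, ?_, ?_, ?_, fun P hP ↦ ?_, hΦ⟩
  · exact (quasiCompact_iff_compactSpace _).mpr hcomp
  · simpa only [Category.assoc] using hΦs
  · simpa only [Category.assoc] using hV.isPullback
  · obtain ⟨Q, hQ, hQs, hQj⟩ := hbc.exists_section hπ hb hj₀ P hP
    have hQ' : Set.range Q ⊆ Set.range s.smoothLocus.ι := by
      rw [← hbc.coe_smoothLocus hm hπ.ne_zero hb] at hQ
      simpa using hQ
    refine ⟨IsOpenImmersion.lift s.smoothLocus.ι Q hQ', ?_, ?_⟩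
    · rw [IsOpenImmersion.lift_fac_assoc, hQs]
    · rw [← cancel_mono s.smoothLocus.ι, Category.assoc, IsOpenImmersion.lift_fac, hQj,
        Category.assoc, hj]

end WeakNeronModel

end

end WeakNeron

theorem proposition3p1 {R K : Type u} [CommRing R] [IsDomain R] [IsDiscreteValuationRing R]
    [HenselianLocalRing R] [IsSepClosed (IsLocalRing.ResidueField R)]
    [Field K] [Algebra R K] [IsFractionRing R K]
    (π : R) (hπ : Irreducible π)
    (n l r : ℕ) (hn : 1 ≤ n) (hr : r < 3)
    (c a₁ a₂ a₃ : R) (hc : IsUnit c)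
    (ha₁ : a₁ ∈ IsLocalRing.maximalIdeal R) (ha₂ : a₂ ∈ IsLocalRing.maximalIdeal R)
    (ha₃ : a₃ ∈ IsLocalRing.maximalIdeal R)
    (hv : IsDiscreteValuationRing.addVal R a₃ = ((3 * l + r : ℕ) : ℕ∞))
    (hnorm : (l = 0 ∧ 2 * r ≤ 3 * n) ∨ (n = 1 ∧ 3 * n < 6 * l + 2 * r))
    (p : K[X])
    (hp : p = C ((algebraMap R K π ^ n)⁻¹) *
      (C c * X ^ 3 + C a₁ * X ^ 2 + C a₂ * X + C a₃ : R[X]).map (algebraMap R K))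
    (hirr : Irreducible (p - X)) :
    (∃! φ : WeakNeron.P1 K ⟶ WeakNeron.P1 K, WeakNeron.IsPolynomialMap p φ) ∧
    (∃ (X₁ : Scheme.{u}) (b : X₁ ⟶ WeakNeron.P1 R),
      WeakNeron.IsBlowUp (WeakNeron.P1.zeroPoint R).ker b) ∧
    ∀ (φ : WeakNeron.P1 K ⟶ WeakNeron.P1 K) (_ : WeakNeron.IsPolynomialMap p φ)
      (X₁ : Scheme.{u}) (b : X₁ ⟶ WeakNeron.P1 R)
      (_ : WeakNeron.IsBlowUp (WeakNeron.P1.zeroPoint R).ker b),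
      ∃ (_ : LocallyOfFinitePresentation (b ≫ WeakNeron.P1.toSpec R))
        (j : WeakNeron.P1 K ⟶ (b ≫ WeakNeron.P1.toSpec R).smoothLocus)
        (Φ : ((b ≫ WeakNeron.P1.toSpec R).smoothLocus : Scheme.{u}) ⟶
          (b ≫ WeakNeron.P1.toSpec R).smoothLocus),
        j ≫ (b ≫ WeakNeron.P1.toSpec R).smoothLocus.ι ≫ b = WeakNeron.P1.baseChange R K ∧
        WeakNeron.IsWeakNeronModel R K φ
          ((b ≫ WeakNeron.P1.toSpec R).smoothLocus.ι ≫ b ≫ WeakNeron.P1.toSpec R) j Φ := by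
  have hm := hπ.maximalIdeal_eq
  obtain ⟨b₁, hb₁⟩ := WeakNeron.dvd_of_mem_maximalIdeal hπ ha₁
  obtain ⟨b₂, hb₂⟩ := WeakNeron.dvd_of_mem_maximalIdeal hπ ha₂
  obtain ⟨b₃, hb₃⟩ := WeakNeron.dvd_of_mem_maximalIdeal hπ ha₃
  refine ⟨WeakNeron.existsUnique_isPolynomialMap ?_, ?_, fun φ hφ X₁ b hb ↦ ?_⟩
  · rintro rfl
    have h := congrArg (fun q : K[X] ↦ q.coeff 3) hp
    have hu := WeakNeron.isUnit_algebraMap_uniformizer hπ (K := K)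
    have hcK := (hc.map (algebraMap R K)).ne_zero
    simp [hu.ne_zero, hcK] at h
  · obtain ⟨M, b, -, -, -, hb, -⟩ := WeakNeron.exists_isBlowUp hm hπ.ne_zero
    exact ⟨M, b, hb⟩
  · exact hb.isWeakNeronModel hπ hc (by rw [hb₁, hb₂, hb₃]) hp
      (WeakNeron.comp_eq_of_normalized hπ hn hr hc ha₁ ha₂ ha₃ hv hnorm rfl hp hirr) hφ
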